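/- Let $\mathbb F$ be a finite field, and let $e_1,e_2$ and $e_1,e_2,e_3$ be the standard bases of $\mathbb F^2$ and $\mathbb F^3$. A $2\times3$ matrix $(m_{ij})$ stands for the tensor $\sum m_{ij}\,e_i\otimes e_j\in\mathbb F^2\otimes\mathbb F^3$, and a matrix whose entries are linear forms in parameters stands for the subspace of all tensors obtained by letting the parameters run over $\mathbb F$. Let $\sigma:\mathrm{PG}(\mathbb F^2)\times\mathrm{PG}(\mathbb F^3)\to\mathrm{PG}(\mathbb F^2\otimes\mathbb F^3)$, $(\langle a\rangle,\langle b\rangle)\mapsto\langle a\otimes b\rangle$, be the Segre embedding and $S_{2,3}$ its image. A line of the first kind is a set $\sigma(\mathrm{PG}(\mathbb F^2)\times y)$ with $y$ a point of $\mathrm{PG}(\mathbb F^3)$; a line of the second kind is a set $\sigma(x\times\ell)$ with $x$ a point of $\mathrm{PG}(\mathbb F^2)$ and $\ell$ a line of $\mathrm{PG}(\mathbb F^3)$. Let $\bar H_2$ be the group of permutations of the points of $\mathrm{PG}(\mathbb F^2\otimes\mathbb F^3)$ induced by the maps $g\otimes h$ with $g\in\mathrm{GL}(\mathbb F^2)$,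 $h\in\mathrm{GL}(\mathbb F^3)$. For a subspace $U$ of $\mathrm{PG}(\mathbb F^2\otimes\mathbb F^3)$ we say that $\mathrm{Min}(U)=m\times n$ if there is a smallest pair of subspaces $A\le\mathbb F^2$, $B\le\mathbb F^3$ with $U\subseteq\mathrm{PG}(A\otimes B)$, and $\dim A=m$, $\dim B=n$; so $\sigma(\mathrm{PG}(A)\times\mathrm{PG}(B))\cong S_{m,n}$ is the smallest such Segre variety whose span contains $U$. Then $(\langle g\rangle,\langle h\rangle)\mapsto(\langle v\rangle\mapsto\langle (g\otimes h)v\rangle)$ is a well-defined isomorphism $\mathrm{PGL}(2,\mathbb F)\times\mathrm{PGL}(3,\mathbb F)\cong\bar H_2$, and $\bar H_2$ has exactly 2 orbits on points, 7 orbits on lines and 11 orbits on planes of $\mathrm{PG}(\mathbb F^2\otimes\mathbb F^3)$. There are $u,v\in\mathbb F$ with $$(*)\qquad v\neq0\ \text{ and }\ v\lambda^2+uv\lambda-1\neq0\ \text{ for all }\lambda\in\mathbb F,$$ and $\alpha,\beta,\gamma\in\mathbb F$ with $$(**)\qquad \lambda^3+\gamma\lambda^2-\beta\lambda+\alpha\neq0\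 \text{ for all }\lambda\in\mathbb F,$$ and for every choice of parameters satisfying $(*)$ and $(**)$ the following matrices define subspaces of the stated dimension that represent each orbit exactly once; moreover every element $U$ of the orbit has the stated intersection with $S_{2,3}$ and the stated $\mathrm{Min}(U)$. Points: * $o_1$: $\begin{bmatrix}x&0&0\\0&0&0\end{bmatrix}$; one point; $1\times1$. * $o_4$: $\begin{bmatrix}x&0&0\\0&x&0\end{bmatrix}$; $\emptyset$; $2\times2$. Lines: * $o_2$: $\begin{bmatrix}x&y&0\\0&0&0\end{bmatrix}$; a line of the second kind; $1\times2$. * $o_4^T$: $\begin{bmatrix}x&0&0\\y&0&0\end{bmatrix}$; a line of the first kind; $2\times1$. * $o_5$: $\begin{bmatrix}x&0&0\\0&y&0\end{bmatrix}$; two points; $2\times2$. * $o_6$: $\begin{bmatrix}x&0&0\\y&x&0\end{bmatrix}$; one point; $2\times2$. * $o_7$: $\begin{bmatrix}x&y&0\\0&0&x\end{bmatrix}$; one point; $2\times3$. * $o_{10}$: $\begin{bmatrix}x&ux+y&0\\vy&x&0\end{bmatrix}$ with $(*)$; $\emptyset$; $2\times2$. * $o_{11}$: $\begin{bmatrix}x&y&0\\0&x&y\end{bmatrix}$;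 $\emptyset$; $2\times3$. Planes: * $o_3$: $\begin{bmatrix}x&y&z\\0&0&0\end{bmatrix}$; a plane; $1\times3$. * $o_7^T$: $\begin{bmatrix}z&0&0\\x&y&0\end{bmatrix}$; the union of a line of the first kind and a line of the second kind; $2\times2$. * $o_8$: $\begin{bmatrix}x&0&0\\0&y&z\end{bmatrix}$; a line of the second kind and a point not on it; $2\times3$. * $o_9$: $\begin{bmatrix}z&0&0\\x&y&z\end{bmatrix}$; a line of the second kind; $2\times3$. * $o_{11}^T$: $\begin{bmatrix}x&y&0\\y&z&0\end{bmatrix}$; a nondegenerate conic; $2\times2$. * $o_{12}$: $\begin{bmatrix}x&y&0\\0&z&x\end{bmatrix}$; a line of the first kind; $2\times3$. * $o_{13}$: $\begin{bmatrix}x&y&0\\0&x&z\end{bmatrix}$; two points; $2\times3$. * $o_{14}$: $\begin{bmatrix}x&y&0\\0&y&z\end{bmatrix}$; three points; $2\times3$. * $o_{15}$: $\begin{bmatrix}x&ux+y&z\\vy&x&0\end{bmatrix}$ with $(*)$; one point, and $U$ contains a line of the orbit $o_{10}$; $2\times3$. * $o_{16}$: $\begin{bmatrix}x&y&z\\0&x&y\end{bmatrix}$;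 one point, and $U$ contains a line of the orbit $o_{11}$; $2\times3$. * $o_{17}$: $\begin{bmatrix}x&y&z\\\alpha z&x+\beta z&y+\gamma z\end{bmatrix}$ with $(**)$; $\emptyset$; $2\times3$. -/

import Mathlib

open scoped TensorProduct LinearAlgebra.Projectivization Pointwise

noncomputable section

namespace Tensor23

/-! ### The projective space of 2 by 3 tensors and its Segre variety -/

/-- The tensor product `F^2 ⊗ F^3`. -/
abbrev V (F : Type*) [Field F] : Type _ := (Fin 2 → F) ⊗[F] (Fin 3 → F)

/-- The set of points of the projective subspace `PG(W)` attached to a vector subspace `W`. -/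
def PG {F M : Type*} [Field F] [AddCommGroup M] [Module F M] (W : Submodule F M) :
    Set (ℙ F M) :=
  (W.projectivization : Set (ℙ F M))

/-- `U` is (the point set of) a projective subspace of projective dimension `k`; the values
`k = 0, 1, 2` give points, lines and planes. -/
def IsProjSubspace {F M : Type*} [Field F] [AddCommGroup M] [Module F M] (k : ℕ)
    (U : Set (ℙ F M)) : Prop :=
  ∃ W : Submodule F M, Module.finrank F W = k + 1 ∧ U = PG W

theorem tmul_ne_zero {F : Type*} [Field F] {a : Fin 2 → F} {b : Fin 3 → F}
    (ha : a ≠ 0) (hb : b ≠ 0) : a ⊗ₜ[F] b ≠ 0 := by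
  obtain ⟨i, hi⟩ := Function.ne_iff.mp ha
  obtain ⟨j, hj⟩ := Function.ne_iff.mp hb
  intro h
  have h2 := congrArg (fun t => TensorProduct.lid F F
    (TensorProduct.map (LinearMap.proj (R := F) (φ := fun _ : Fin 2 => F) i)
      (LinearMap.proj (R := F) (φ := fun _ : Fin 3 => F) j) t)) h
  simp only [TensorProduct.map_tmul, LinearMap.proj_apply, TensorProduct.lid_tmul, map_zero,
    smul_eq_mul] at h2
  exact mul_ne_zero hi hj h2

variable {F : Type*} [Field F]

/-- The Segre embedding `(⟨a⟩, ⟨b⟩) ↦ ⟨a ⊗ b⟩`. -/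
def segre (x : ℙ F (Fin 2 → F)) (y : ℙ F (Fin 3 → F)) : ℙ F (V F) :=
  Projectivization.mk F (x.rep ⊗ₜ[F] y.rep) (tmul_ne_zero x.rep_nonzero y.rep_nonzero)

variable (F) in
/-- The Segre variety `S_{2,3}`: the points of rank one. -/
def segreVariety : Set (ℙ F (V F)) := {p | ∃ x y, p = segre x y}

/-- A line of the first kind on the Segre variety: `PG(F^2 ⊗ ⟨b⟩)`. -/
def IsFirstKindLine (X : Set (ℙ F (V F))) : Prop :=
  ∃ y : ℙ F (Fin 3 → F), X = Set.range fun x => segre x y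

/-- A line of the second kind on the Segre variety: `PG(⟨a⟩ ⊗ L)` with `PG(L)` a line of
`PG(F^3)`. -/
def IsSecondKindLine (X : Set (ℙ F (V F))) : Prop :=
  ∃ (x : ℙ F (Fin 2 → F)) (l : Set (ℙ F (Fin 3 → F))), IsProjSubspace 1 l ∧ X = segre x '' l

/-- A (nondegenerate) conic: the zero locus, in the plane `PG(W)`, of a quadratic form whose
restriction to `W` is nonsingular (this notion of nonsingularity, that no nonzero singular vector
lies in the radical of the polar form, is the one valid in every characteristic). -/
def IsConic (X : Set (ℙ F (V F))) : Prop :=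
  ∃ (W : Submodule F (V F)) (Q : QuadraticForm F (V F)),
    Module.finrank F W = 3 ∧
    (∀ w ∈ W, Q w = 0 → (∀ w' ∈ W, QuadraticMap.polar Q w w' = 0) → w = 0) ∧
    X = {p | p ∈ PG W ∧ Q p.rep = 0}

/-- The smallest sub-Segre variety `X = σ(PG(A) × PG(B))` of `S_{2,3}` whose span
`⟨X⟩ = PG(A ⊗ B)` contains `U` has `dim A = d.1` and `dim B = d.2`. Here `A ⊗ B` is the subspace
of `F^2 ⊗ F^3` spanned by the `a ⊗ b` with `a ∈ A`, `b ∈ B`. -/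
def HasMinSegre (U : Set (ℙ F (V F))) (d : ℕ × ℕ) : Prop :=
  ∃ (A : Submodule F (Fin 2 → F)) (B : Submodule F (Fin 3 → F)),
    Module.finrank F A = d.1 ∧ Module.finrank F B = d.2 ∧
    U ⊆ PG (Submodule.map₂ (TensorProduct.mk F (Fin 2 → F) (Fin 3 → F)) A B) ∧
    ∀ (A' : Submodule F (Fin 2 → F)) (B' : Submodule F (Fin 3 → F)),
      U ⊆ PG (Submodule.map₂ (TensorProduct.mk F (Fin 2 → F) (Fin 3 → F)) A' B') →
      A ≤ A' ∧ B ≤ B'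

/-! ### The groups and their orbits -/

variable (F) in
/-- The homomorphism `(g, h) ↦ g ⊗ h` from `GL(2, F) × GL(3, F)` to `GL(F^2 ⊗ F^3)`. -/
def tensorHom : GL (Fin 2) F × GL (Fin 3) F →* (V F ≃ₗ[F] V F) :=
  MonoidHom.mk'
    (fun p => TensorProduct.congr
      (DistribMulAction.toModuleAut F (Fin 2 → F) p.1)
      (DistribMulAction.toModuleAut F (Fin 3 → F) p.2))
    (fun p q => by
      simp only [Prod.fst_mul, Prod.snd_mul, map_mul]
      exact TensorProduct.congr_mul _ _ _ _)

variable (F) in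
/-- The group `H_2 = GL(F^2) × GL(F^3)`, as a subgroup of `GL(F^2 ⊗ F^3)`. -/
def H₂ : Subgroup (V F ≃ₗ[F] V F) := (tensorHom F).range

variable (F) in
/-- The projective group induced by `H_2`, as a group of permutations of the points of
`PG(F^2 ⊗ F^3)`. -/
def Hbar₂ : Subgroup (Equiv.Perm (ℙ F (V F))) :=
  (H₂ F).map (MulAction.toPermHom (V F ≃ₗ[F] V F) (ℙ F (V F)))

variable (F) in
/-- The number of orbits of the projective group on the projective subspaces of dimension `k`. -/
def numOrbits (k : ℕ) : ℕ :=
  {O : Set (Set (ℙ F (V F))) | ∃ U, IsProjSubspace k U ∧ O = MulAction.orbit (Hbar₂ F) U}.ncard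

/-- The subspaces `PG (r i)` have projective dimension `k`, and every projective subspace of
dimension `k` lies in the orbit of `PG (r i)` for exactly one index `i`. -/
def IsOrbitTransversal (k : ℕ) {ι : Type} (r : ι → Submodule F (V F)) : Prop :=
  (∀ i, IsProjSubspace k (PG (r i))) ∧
    ∀ U, IsProjSubspace k U → ∃! i, U ∈ MulAction.orbit (Hbar₂ F) (PG (r i))

/-! ### The tables -/

/-- The tensor `∑ m_ij e_i ⊗ e_j` of a 2 by 3 matrix. -/
def tensor (m : Matrix (Fin 2) (Fin 3) F) : V F :=
  ∑ i, ∑ j, m i j • ((Pi.single i 1 : Fin 2 → F) ⊗ₜ[F] (Pi.single j 1 : Fin 3 → F))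

/-- The subspace formed by the matrices `m x`. -/
def pointOf (m : F → Matrix (Fin 2) (Fin 3) F) : Submodule F (V F) :=
  Submodule.span F {t | ∃ x, t = tensor (m x)}

/-- The subspace formed by the matrices `m x y`. -/
def lineOf (m : F → F → Matrix (Fin 2) (Fin 3) F) : Submodule F (V F) :=
  Submodule.span F {t | ∃ x y, t = tensor (m x y)}

/-- The subspace formed by the matrices `m x y z`. -/
def planeOf (m : F → F → F → Matrix (Fin 2) (Fin 3) F) : Submodule F (V F) :=
  Submodule.span F {t | ∃ x y z, t = tensor (m x y z)}

/-- The condition on the parameters of `o10` and `o15`. -/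
def QuadCond (u v : F) : Prop := v ≠ 0 ∧ ∀ l : F, v * l ^ 2 + u * v * l - 1 ≠ 0

/-- The condition on the parameters of `o17`. -/
def CubicCond (α β γ : F) : Prop := ∀ l : F, l ^ 3 + γ * l ^ 2 - β * l + α ≠ 0

inductive PointType
  | o1 | o4

inductive LineType
  | o2 | o4T | o5 | o6 | o7 | o10 | o11

inductive PlaneType
  | o3 | o7T | o8 | o9 | o11T | o12 | o13 | o14 | o15 | o16 | o17

variable (F) in
/-- The representatives of the orbits of points. -/
def PointType.rep : PointType → Submodule F (V F)
  | o1 => pointOf fun x => !![x, 0, 0; 0, 0, 0]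
  | o4 => pointOf fun x => !![x, 0, 0; 0, x, 0]

/-- The representatives of the orbits of lines. -/
def LineType.rep (u v : F) : LineType → Submodule F (V F)
  | o2 => lineOf fun x y => !![x, y, 0; 0, 0, 0]
  | o4T => lineOf fun x y => !![x, 0, 0; y, 0, 0]
  | o5 => lineOf fun x y => !![x, 0, 0; 0, y, 0]
  | o6 => lineOf fun x y => !![x, 0, 0; y, x, 0]
  | o7 => lineOf fun x y => !![x, y, 0; 0, 0, x]
  | o10 => lineOf fun x y => !![x, u * x + y, 0; v * y, x, 0]
  | o11 => lineOf fun x y => !![x, y, 0; 0, x, y]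

/-- The representatives of the orbits of planes. -/
def PlaneType.rep (u v α β γ : F) : PlaneType → Submodule F (V F)
  | o3 => planeOf fun x y z => !![x, y, z; 0, 0, 0]
  | o7T => planeOf fun x y z => !![z, 0, 0; x, y, 0]
  | o8 => planeOf fun x y z => !![x, 0, 0; 0, y, z]
  | o9 => planeOf fun x y z => !![z, 0, 0; x, y, z]
  | o11T => planeOf fun x y z => !![x, y, 0; y, z, 0]
  | o12 => planeOf fun x y z => !![x, y, 0; 0, z, x]
  | o13 => planeOf fun x y z => !![x, y, 0; 0, x, z]
  | o14 => planeOf fun x y z => !![x, y, 0; 0, y, z]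
  | o15 => planeOf fun x y z => !![x, u * x + y, z; v * y, x, 0]
  | o16 => planeOf fun x y z => !![x, y, z; 0, x, y]
  | o17 => planeOf fun x y z => !![x, y, z; α * z, x + β * z, y + γ * z]

/-- The intersection of a point of the given orbit with the Segre variety. -/
def PointType.Intersection (U : Set (ℙ F (V F))) : PointType → Prop
  | o1 => (U ∩ segreVariety F).ncard = 1
  | o4 => U ∩ segreVariety F = ∅

/-- The intersection of a line of the given orbit with the Segre variety. -/
def LineType.Intersection (U : Set (ℙ F (V F))) : LineType → Prop
  | o2 => IsSecondKindLine (U ∩ segreVariety F)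
  | o4T => IsFirstKindLine (U ∩ segreVariety F)
  | o5 => (U ∩ segreVariety F).ncard = 2
  | o6 => (U ∩ segreVariety F).ncard = 1
  | o7 => (U ∩ segreVariety F).ncard = 1
  | o10 => U ∩ segreVariety F = ∅
  | o11 => U ∩ segreVariety F = ∅

/-- The intersection of a plane of the given orbit with the Segre variety; for `o15` and `o16`
also a line contained in the plane. -/
def PlaneType.Intersection (u v : F) (U : Set (ℙ F (V F))) : PlaneType → Prop
  | o3 => IsProjSubspace 2 (U ∩ segreVariety F)
  | o7T => ∃ l m, IsFirstKindLine l ∧ IsSecondKindLine m ∧ U ∩ segreVariety F = l ∪ m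
  | o8 => ∃ l p, IsSecondKindLine l ∧ p ∉ l ∧ U ∩ segreVariety F = l ∪ {p}
  | o9 => IsSecondKindLine (U ∩ segreVariety F)
  | o11T => IsConic (U ∩ segreVariety F)
  | o12 => IsFirstKindLine (U ∩ segreVariety F)
  | o13 => (U ∩ segreVariety F).ncard = 2
  | o14 => (U ∩ segreVariety F).ncard = 3
  | o15 => (U ∩ segreVariety F).ncard = 1 ∧
      ∃ l ∈ MulAction.orbit (Hbar₂ F) (PG (LineType.rep u v .o10)), l ⊆ U
  | o16 => (U ∩ segreVariety F).ncard = 1 ∧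
      ∃ l ∈ MulAction.orbit (Hbar₂ F) (PG (LineType.rep u v .o11)), l ⊆ U
  | o17 => U ∩ segreVariety F = ∅

/-- The dimensions of the minimal Segre variety, for points. -/
def PointType.minDims : PointType → ℕ × ℕ
  | o1 => (1, 1)
  | o4 => (2, 2)

/-- The dimensions of the minimal Segre variety, for lines. -/
def LineType.minDims : LineType → ℕ × ℕ
  | o2 => (1, 2)
  | o4T => (2, 1)
  | o5 => (2, 2)
  | o6 => (2, 2)
  | o7 => (2, 3)
  | o10 => (2, 2)
  | o11 => (2, 3)

/-- The dimensions of the minimal Segre variety, for planes. -/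
def PlaneType.minDims : PlaneType → ℕ × ℕ
  | o3 => (1, 3)
  | o7T => (2, 2)
  | o8 => (2, 3)
  | o9 => (2, 3)
  | o11T => (2, 2)
  | o12 => (2, 3)
  | o13 => (2, 3)
  | o14 => (2, 3)
  | o15 => (2, 3)
  | o16 => (2, 3)
  | o17 => (2, 3)

end Tensor23

end

open scoped TensorProduct LinearAlgebra.Projectivization Pointwise
noncomputable section
namespace Tensor23
variable {F : Type*} [Field F]

/-! Fix a basis a, a' of F². Every tensor is a ⊗ c + a' ⊗ d, and it has rank at most one exactly
when its rows c, d are dependent. The group acts by changing the frames of F² and F³, so a subspace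
lies in the orbit of a representative as soon as some frame turns the generators of that
representative into elements of the subspace and the dimensions agree (`mem_orbit_span`).
Classifying means finding good frames.

Lines and planes are sorted by their rank-one points. If there are enough of these (a line of either
kind, or two points with independent first factors), subtracting them from one further generator
leads to a normal form. Otherwise a plane PG(W) is handled as a graph W = {a ⊗ c + a' ⊗ C c} of an
endomorphism C of F³ (`exists_graph`), whose rank-one points are given by the eigenvectors of C.
With a single rank-one point ⟨a ⊗ b⟩, C kills b and has no other eigenvectors up to scalars: either
C is a nilpotent Jordan block (o16), or ⟨b⟩ splits off and C acts on its image without eigenvalues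
(o15). With no rank-one point the characteristic polynomial of C is an irreducible cubic (o17).
Lines without rank-one points are treated in the same spirit by chains r ↦ s ↦ e of rows (o10, o11).

Finiteness of F makes the extension of each degree unique. Two anisotropic quadratics are then
related by an affine substitution (`exists_affine_quadratic`), so o10 and o15 are single orbits,
independent of u and v. For o17, the cubic extension F[C] contains a root of the prescribed cubic;
that root is a fractional linear function of C (`exists_moebius`), and a change of frame of F²
realises this function. Finiteness also supplies the parameters, because a non-injective self-map of
F misses a value.

Different representatives are separated by the minimal Segre variety, the number of rank-one points
and the presence of lines of either kind. Only o15 and o16 agree in all of these; they differ in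
that an o16 plane contains no o10 line (`LineType.not_mem_orbit_of_subset_o16`). -/

theorem mem_PG {M : Type*} [AddCommGroup M] [Module F M] {W : Submodule F M} {p : ℙ F M} :
    p ∈ PG W ↔ p.rep ∈ W := by
  conv_lhs => rw [← p.mk_rep]
  exact Iff.rfl

theorem mk_mem_PG {M : Type*} [AddCommGroup M] [Module F M] {W : Submodule F M} {v : M}
    (hv : v ≠ 0) : Projectivization.mk F v hv ∈ PG W ↔ v ∈ W := Iff.rfl

/-! ### Equivariance of subspaces, Segre variety, its lines, conics and Min -/

theorem tensorHom_tmul (g : GL (Fin 2) F) (h : GL (Fin 3) F) (a : Fin 2 → F) (b : Fin 3 → F) :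
    tensorHom F (g, h) (a ⊗ₜ b) = (g.1.mulVec a) ⊗ₜ (h.1.mulVec b) := by
  rfl

theorem mem_orbit_iff {U U' : Set (ℙ F (V F))} :
    U ∈ MulAction.orbit (Hbar₂ F) U' ↔ ∃ g h, U = tensorHom F (g, h) • U' := by
  constructor
  · rintro ⟨⟨_, ⟨_, ⟨⟨g, h⟩, rfl⟩, rfl⟩⟩, rfl⟩
    exact ⟨g, h, rfl⟩
  · rintro ⟨g, h, rfl⟩
    exact ⟨⟨_, ⟨_, ⟨⟨g, h⟩, rfl⟩, rfl⟩⟩, rfl⟩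

theorem smul_PG (γ : V F ≃ₗ[F] V F) (W : Submodule F (V F)) :
    γ • PG W = PG (W.map (γ : V F →ₗ[F] V F)) := by
  ext p
  rw [Set.mem_smul_set_iff_inv_smul_mem]
  induction p with
  | h v hv => 
    rw [Projectivization.smul_mk, mk_mem_PG, mk_mem_PG, Submodule.mem_map_equiv]
    rfl

theorem segre_mk {a : Fin 2 → F} {b : Fin 3 → F} (ha : a ≠ 0) (hb : b ≠ 0) :
    segre (.mk F a ha) (.mk F b hb) = .mk F (a ⊗ₜ b) (tmul_ne_zero ha hb) := by
  obtain ⟨s, hs⟩ := Projectivization.exists_smul_eq_mk_rep F a ha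
  obtain ⟨t, ht⟩ := Projectivization.exists_smul_eq_mk_rep F b hb
  rw [segre, Projectivization.mk_eq_mk_iff]
  refine ⟨s * t, ?_⟩
  rw [← hs, ← ht]
  simp only [Units.smul_def, TensorProduct.smul_tmul', TensorProduct.tmul_smul, smul_smul, Units.val_mul]
  rw [mul_comm]

theorem mem_segreVariety {p : ℙ F (V F)} :
    p ∈ segreVariety F ↔ ∃ (a : Fin 2 → F) (b : Fin 3 → F) (ha : a ≠ 0) (hb : b ≠ 0),
      p = .mk F (a ⊗ₜ b) (tmul_ne_zero ha hb) := by
  constructor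
  · rintro ⟨x, y, rfl⟩
    exact ⟨x.rep, y.rep, x.rep_nonzero, y.rep_nonzero, rfl⟩
  · rintro ⟨a, b, ha, hb, rfl⟩
    exact ⟨_, _, (segre_mk ha hb).symm⟩

theorem smul_segre (g : GL (Fin 2) F) (h : GL (Fin 3) F) (x : ℙ F (Fin 2 → F))
    (y : ℙ F (Fin 3 → F)) : tensorHom F (g, h) • segre x y = segre (g • x) (h • y) := by
  induction x with | h a ha =>
  induction y with | h b hb =>
  rw [segre_mk, Projectivization.smul_mk, Projectivization.smul_mk, Projectivization.smul_mk,
    segre_mk]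
  rfl

theorem inv_tensorHom (g : GL (Fin 2) F) (h : GL (Fin 3) F) :
    (tensorHom F (g, h))⁻¹ = tensorHom F (g⁻¹, h⁻¹) := by
  rw [← map_inv]; rfl

theorem smul_segreVariety (g : GL (Fin 2) F) (h : GL (Fin 3) F) :
    tensorHom F (g, h) • segreVariety F = segreVariety F := by
  ext p
  rw [Set.mem_smul_set_iff_inv_smul_mem]
  constructor
  · rintro ⟨x, y, hp⟩
    refine ⟨g • x, h • y, ?_⟩
    rw [← smul_segre, ← hp, smul_inv_smul]
  · rintro ⟨x, y, rfl⟩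
    rw [inv_tensorHom]
    exact ⟨_, _, smul_segre _ _ _ _⟩

theorem smul_inter_segreVariety (g : GL (Fin 2) F) (h : GL (Fin 3) F) (U : Set (ℙ F (V F))) :
    (tensorHom F (g, h) • U) ∩ segreVariety F = tensorHom F (g, h) • (U ∩ segreVariety F) := by
  rw [Set.smul_set_inter, smul_segreVariety]

theorem IsProjSubspace.smul {k : ℕ} {U : Set (ℙ F (V F))} (hU : IsProjSubspace k U)
    (γ : V F ≃ₗ[F] V F) : IsProjSubspace k (γ • U) := by
  obtain ⟨W, hW, rfl⟩ := hU
  exact ⟨_, (LinearEquiv.finrank_map_eq γ W).trans hW, smul_PG γ W⟩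

theorem IsFirstKindLine.smul {X : Set (ℙ F (V F))} (hX : IsFirstKindLine X)
    (g : GL (Fin 2) F) (h : GL (Fin 3) F) : IsFirstKindLine (tensorHom F (g, h) • X) := by
  obtain ⟨y, rfl⟩ := hX
  refine ⟨h • y, ?_⟩
  ext p
  constructor
  · rintro ⟨_, ⟨x, rfl⟩, rfl⟩
    exact ⟨g • x, (smul_segre _ _ _ _).symm⟩
  · rintro ⟨x, rfl⟩
    refine ⟨_, ⟨g⁻¹ • x, rfl⟩, ?_⟩
    simp only [smul_segre, smul_inv_smul]

theorem smul_PG' (h : GL (Fin 3) F) (W : Submodule F (Fin 3 → F)) :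
    h • PG W = PG (W.map (DistribMulAction.toModuleAut F (Fin 3 → F) h).toLinearMap) := by
  ext p
  rw [Set.mem_smul_set_iff_inv_smul_mem]
  induction p with
  | h v hv =>
    rw [Projectivization.smul_mk, mk_mem_PG, mk_mem_PG]
    constructor
    · intro hw
      refine ⟨_, hw, ?_⟩
      exact smul_inv_smul h v
    · rintro ⟨w, hw, rfl⟩
      have : h⁻¹ • (h • w) ∈ W := by rwa [inv_smul_smul]
      exact this

theorem IsSecondKindLine.smul {X : Set (ℙ F (V F))} (hX : IsSecondKindLine X)
    (g : GL (Fin 2) F) (h : GL (Fin 3) F) : IsSecondKindLine (tensorHom F (g, h) • X) := by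
  obtain ⟨x, _, ⟨W, hW, rfl⟩, rfl⟩ := hX
  refine ⟨g • x, h • PG W, ⟨_, ?_, smul_PG' h W⟩, ?_⟩
  · rw [LinearEquiv.finrank_map_eq, hW]
  · ext p
    constructor
    · rintro ⟨_, ⟨y, hy, rfl⟩, rfl⟩
      exact ⟨h • y, Set.smul_mem_smul_set hy, (smul_segre _ _ _ _).symm⟩
    · rintro ⟨_, ⟨y, hy, rfl⟩, rfl⟩
      exact ⟨_, ⟨y, hy, rfl⟩, smul_segre _ _ _ _⟩

theorem apply_rep_eq_zero_iff (Q : QuadraticForm F (V F)) {v : V F} (hv : v ≠ 0) :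
    Q (Projectivization.mk F v hv).rep = 0 ↔ Q v = 0 := by
  obtain ⟨s, hs⟩ := Projectivization.exists_smul_eq_mk_rep F v hv
  rw [← hs, Units.smul_def, QuadraticMap.map_smul]
  simp

/-- The transported conic is cut out by the form Q composed with γ⁻¹, whose polar form is
transported in the same way. -/
theorem IsConic.smul {X : Set (ℙ F (V F))} (hX : IsConic X) (γ : V F ≃ₗ[F] V F) :
    IsConic (γ • X) := by
  obtain ⟨W, Q, hW, hQ, rfl⟩ := hX
  refine ⟨W.map (γ : V F →ₗ[F] V F), Q.comp (γ.symm : V F →ₗ[F] V F), ?_, ?_, ?_⟩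
  · exact (LinearEquiv.finrank_map_eq γ W).trans hW
  · rintro _ ⟨w, hw, rfl⟩ h0 hp
    rw [hQ w hw]
    · simp
    · simpa using h0
    · intro w' hw'
      simpa [QuadraticMap.polar] using hp _ ⟨w', hw', rfl⟩
  · ext p
    rw [Set.mem_smul_set_iff_inv_smul_mem]
    induction p with | h v hv =>
    rw [Projectivization.smul_mk, Set.mem_ofPred_eq, Set.mem_ofPred_eq, mk_mem_PG, mk_mem_PG,
      apply_rep_eq_zero_iff, apply_rep_eq_zero_iff, Submodule.mem_map_equiv]
    rfl

theorem smul_ncard (γ : V F ≃ₗ[F] V F) (X : Set (ℙ F (V F))) : (γ • X).ncard = X.ncard :=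
  Set.ncard_image_of_injective X (MulAction.injective γ)

/-- The subspace `A ⊗ B` of `F^2 ⊗ F^3`. -/
abbrev tensorSub (A : Submodule F (Fin 2 → F)) (B : Submodule F (Fin 3 → F)) :
    Submodule F (V F) :=
  Submodule.map₂ (TensorProduct.mk F (Fin 2 → F) (Fin 3 → F)) A B

/-- The linear automorphism attached to an invertible matrix. -/
abbrev glEquiv {n : ℕ} (g : GL (Fin n) F) : (Fin n → F) ≃ₗ[F] (Fin n → F) :=
  DistribMulAction.toModuleAut F (Fin n → F) g

theorem map_tensorSub (g : GL (Fin 2) F) (h : GL (Fin 3) F) (A : Submodule F (Fin 2 → F))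
    (B : Submodule F (Fin 3 → F)) :
    (tensorSub A B).map (tensorHom F (g, h) : V F →ₗ[F] V F) =
      tensorSub (A.map (glEquiv g).toLinearMap) (B.map (glEquiv h).toLinearMap) := by
  apply le_antisymm
  · rw [Submodule.map_le_iff_le_comap, Submodule.map₂_le]
    intro a ha b hb
    exact Submodule.apply_mem_map₂ _ (Submodule.mem_map_of_mem ha) (Submodule.mem_map_of_mem hb)
  · rw [Submodule.map₂_le]
    rintro _ ⟨a, ha, rfl⟩ _ ⟨b, hb, rfl⟩
    exact ⟨a ⊗ₜ b, Submodule.apply_mem_map₂ _ ha hb, rfl⟩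

theorem map_glEquiv_inv {n : ℕ} (g : GL (Fin n) F) (A : Submodule F (Fin n → F)) :
    (A.map (glEquiv g⁻¹).toLinearMap).map (glEquiv g).toLinearMap = A := by
  ext x
  constructor
  · rintro ⟨_, ⟨y, hy, rfl⟩, rfl⟩
    have : g • (g⁻¹ • y) ∈ A := by rwa [smul_inv_smul]
    exact this
  · intro hx
    exact ⟨_, ⟨x, hx, rfl⟩, smul_inv_smul g x⟩

theorem HasMinSegre.smul {X : Set (ℙ F (V F))} {d : ℕ × ℕ} (hX : HasMinSegre X d)
    (g : GL (Fin 2) F) (h : GL (Fin 3) F) : HasMinSegre (tensorHom F (g, h) • X) d := by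
  obtain ⟨A, B, hA, hB, hAB, hmin⟩ := hX
  refine ⟨A.map (glEquiv g).toLinearMap, B.map (glEquiv h).toLinearMap, ?_, ?_, ?_, ?_⟩
  · rw [LinearEquiv.finrank_map_eq, hA]
  · rw [LinearEquiv.finrank_map_eq, hB]
  · have h1 : tensorHom F (g, h) • X ⊆ tensorHom F (g, h) • PG (tensorSub A B) :=
      Set.smul_set_mono hAB
    rw [smul_PG, map_tensorSub] at h1
    exact h1
  · intro A' B' hX
    -- Minimality is checked by pulling a competitor for the image back to a competitor for X.
    have h1 : X ⊆ (tensorHom F (g, h))⁻¹ • PG (tensorSub A' B') :=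
      Set.smul_set_subset_iff_subset_inv_smul_set.mp hX
    rw [inv_tensorHom, smul_PG, map_tensorSub] at h1
    obtain ⟨h2, h3⟩ := hmin _ _ h1
    exact ⟨(Submodule.map_mono h2).trans (map_glEquiv_inv g A').le,
      (Submodule.map_mono h3).trans (map_glEquiv_inv h B').le⟩

theorem HasMinSegre.unique {X : Set (ℙ F (V F))} {d d' : ℕ × ℕ} (h : HasMinSegre X d)
    (h' : HasMinSegre X d') : d = d' := by
  obtain ⟨A, B, hA, hB, hAB, hmin⟩ := h
  obtain ⟨A', B', hA', hB', hAB', hmin'⟩ := h'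
  have h1 := hmin _ _ hAB'
  have h2 := hmin' _ _ hAB
  have e1 := le_antisymm h1.1 h2.1
  have e2 := le_antisymm h1.2 h2.2
  subst e1 e2
  exact Prod.ext (hA.symm.trans hA') (hB.symm.trans hB')

/-! ### The projective linear groups -/

/-- A linear map for which v and its image are never independent is a homothety, and the scalar
matrices form the centre of the general linear group. -/
theorem exists_scalar_of_forall_mem_span {n : ℕ} (g : GL (Fin n) F)
    (hg : ∀ a : Fin n → F, ∃ c : F, g.1.mulVec a = c • a) : g ∈ Subgroup.center (GL (Fin n) F) := by
  obtain ⟨c, hc⟩ := (Matrix.toLin' g.1).exists_eq_smul_id_of_forall_notLinearIndependent fun v => by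
    intro hv
    obtain ⟨c, hc⟩ := hg v
    have := LinearIndependent.pair_iff.mp hv c (-1) (by simp [hc])
    simp at this
  rw [Matrix.GeneralLinearGroup.mem_center_iff_val_mem_range_scalar]
  refine ⟨c, ?_⟩
  apply Matrix.toLin'.injective
  rw [hc]
  ext i j
  simp [Pi.single_apply]

theorem exists_scalar_of_mem_center {n : ℕ} {g : GL (Fin n) F}
    (hg : g ∈ Subgroup.center (GL (Fin n) F)) : ∃ c : F, ∀ a : Fin n → F, g.1.mulVec a = c • a := by
  rw [Matrix.GeneralLinearGroup.mem_center_iff_val_mem_range_scalar] at hg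
  obtain ⟨c, hc⟩ := hg
  exact ⟨c, fun a => by simp [← hc]⟩

/-- Compare coordinates: a'ᵢ b'ⱼ = c aᵢ bⱼ for all i, j. Fixing one j with b'ⱼ ≠ 0 exhibits a' as a
multiple of a, and symmetrically for b'. -/
theorem exists_smul_of_tmul_eq {a a' : Fin 2 → F} {b b' : Fin 3 → F}
    {c : F} (h : a' ⊗ₜ[F] b' = c • (a ⊗ₜ[F] b)) (ha' : a' ≠ 0) (hb' : b' ≠ 0) :
    (∃ s : F, a' = s • a) ∧ ∃ t : F, b' = t • b := by
  have key : ∀ i j, a' i * b' j = c * (a i * b j) := by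
    intro i j
    have h2 := congrArg (fun t => TensorProduct.lid F F
      (TensorProduct.map (LinearMap.proj (R := F) (φ := fun _ : Fin 2 => F) i)
        (LinearMap.proj (R := F) (φ := fun _ : Fin 3 => F) j) t)) h
    simpa using h2
  obtain ⟨i, hi⟩ := Function.ne_iff.mp ha'
  obtain ⟨j, hj⟩ := Function.ne_iff.mp hb'
  refine ⟨⟨c * b j / b' j, ?_⟩, ⟨c * a i / a' i, ?_⟩⟩
  · ext k
    have := key k j
    simp only [Pi.zero_apply, ne_eq] at hj
    simp only [Pi.smul_apply, smul_eq_mul]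
    field_simp
    linear_combination this
  · ext k
    have := key i k
    simp only [Pi.zero_apply, ne_eq] at hi
    simp only [Pi.smul_apply, smul_eq_mul]
    field_simp
    linear_combination this

variable (F) in
/-- The homomorphism from `GL(2, F) × GL(3, F)` onto the projective group. -/
def toHbar₂ : GL (Fin 2) F × GL (Fin 3) F →* Hbar₂ F :=
  ((MulAction.toPermHom (V F ≃ₗ[F] V F) (ℙ F (V F))).comp (tensorHom F)).codRestrict (Hbar₂ F)
    fun p => ⟨_, ⟨p, rfl⟩, rfl⟩

theorem toHbar₂_smul (x : GL (Fin 2) F × GL (Fin 3) F) (p : ℙ F (V F)) :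
    toHbar₂ F x • p = tensorHom F x • p := rfl

theorem toHbar₂_surjective : Function.Surjective (toHbar₂ F) := by
  rintro ⟨_, ⟨_, ⟨x, rfl⟩, rfl⟩⟩
  exact ⟨x, rfl⟩

/-- An element acting trivially fixes in particular every point of the Segre variety, so every
vector is an eigenvector of g and of h, and both are scalar. Conversely scalars s and t multiply
every tensor by st. -/
theorem mem_ker_toHbar₂ (g : GL (Fin 2) F) (h : GL (Fin 3) F) :
    (g, h) ∈ (toHbar₂ F).ker ↔ g ∈ Subgroup.center _ ∧ h ∈ Subgroup.center _ := by
  rw [MonoidHom.mem_ker]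
  constructor
  · intro hx
    have key : ∀ (a : Fin 2 → F) (b : Fin 3 → F), a ≠ 0 → b ≠ 0 →
        (∃ s : F, g.1.mulVec a = s • a) ∧ ∃ t : F, h.1.mulVec b = t • b := by
      intro a b ha hb
      have h1 : toHbar₂ F (g, h) • Projectivization.mk F (a ⊗ₜ[F] b) (tmul_ne_zero ha hb) =
          Projectivization.mk F (a ⊗ₜ[F] b) (tmul_ne_zero ha hb) := by
        rw [hx, one_smul]
      rw [toHbar₂_smul, Projectivization.smul_mk, Projectivization.mk_eq_mk_iff'] at h1
      obtain ⟨c, hc⟩ := h1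
      exact exists_smul_of_tmul_eq hc.symm ((smul_ne_zero_iff_ne g).mpr ha)
        ((smul_ne_zero_iff_ne h).mpr hb)
    constructor
    · apply exists_scalar_of_forall_mem_span
      intro a
      by_cases ha : a = 0
      · exact ⟨0, by simp [ha]⟩
      -- Any nonzero vector serves as the second factor here; the all-ones vector is a convenient
      -- choice.
      · exact (key a (fun _ => 1) ha (fun h => one_ne_zero (congrFun h 0))).1
    · apply exists_scalar_of_forall_mem_span
      intro b
      by_cases hb : b = 0
      · exact ⟨0, by simp [hb]⟩
      · exact (key (fun _ => 1) b (fun h => one_ne_zero (congrFun h 0)) hb).2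
  · rintro ⟨hg, hh⟩
    obtain ⟨s, hs⟩ := exists_scalar_of_mem_center hg
    obtain ⟨t, ht⟩ := exists_scalar_of_mem_center hh
    have key : ∀ v : V F, tensorHom F (g, h) v = (s * t) • v := by
      intro v
      induction v using TensorProduct.induction_on with
      | zero => simp
      | tmul a b =>
        rw [tensorHom_tmul, hs, ht, ← TensorProduct.smul_tmul', TensorProduct.tmul_smul, smul_smul]
      | add v w hv hw => rw [map_add, hv, hw, smul_add]
    apply Subtype.ext
    ext p
    change tensorHom F (g, h) • p = p
    induction p with | h v hv =>
    rw [Projectivization.smul_mk, Projectivization.mk_eq_mk_iff']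
    exact ⟨s * t, (key v).symm⟩

variable (F) in
-- The maps from GL₂ × GL₃ to PGL₂ × PGL₃ and to the projective group are both surjective with
-- kernel the product of the centres, so the first isomorphism theorem identifies their images.
theorem exists_mulEquiv_Hbar₂ :
    ∃ φ : Matrix.ProjGenLinGroup (Fin 2) F × Matrix.ProjGenLinGroup (Fin 3) F ≃* Hbar₂ F,
      ∀ (g : GL (Fin 2) F) (h : GL (Fin 3) F) (p : ℙ F (V F)),
        φ (Matrix.ProjGenLinGroup.mk g, Matrix.ProjGenLinGroup.mk h) • p =
          tensorHom F (g, h) • p := by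
  let π : GL (Fin 2) F × GL (Fin 3) F →*
      Matrix.ProjGenLinGroup (Fin 2) F × Matrix.ProjGenLinGroup (Fin 3) F :=
    Matrix.ProjGenLinGroup.mk.prodMap Matrix.ProjGenLinGroup.mk
  have hπ : Function.Surjective π :=
    Matrix.ProjGenLinGroup.mk_surjective.prodMap Matrix.ProjGenLinGroup.mk_surjective
  have hker : π.ker = (toHbar₂ F).ker := by
    ext ⟨g, h⟩
    rw [mem_ker_toHbar₂, MonoidHom.mem_ker, Prod.ext_iff]
    exact and_congr Matrix.ProjGenLinGroup.mk_eq_one Matrix.ProjGenLinGroup.mk_eq_one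
  let e := ((QuotientGroup.quotientKerEquivOfSurjective π hπ).symm.trans
    (QuotientGroup.quotientMulEquivOfEq hker)).trans
    (QuotientGroup.quotientKerEquivOfSurjective (toHbar₂ F) toHbar₂_surjective)
  refine ⟨e, fun g h p => ?_⟩
  have : e (π (g, h)) = toHbar₂ F (g, h) := by
    have h1 : (QuotientGroup.quotientKerEquivOfSurjective π hπ).symm (π (g, h)) =
        QuotientGroup.mk (g, h) := by
      rw [MulEquiv.symm_apply_eq]; rfl
    simp only [e, MulEquiv.trans_apply, h1]
    rfl
  exact congrArg (· • p) this

/-! ### Quadratic and cubic extensions of a finite field -/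

open Polynomial in
-- With q = |F| and n = [K : F], an irreducible g of degree n divides X^(q^n) - X, and that
-- polynomial splits over K because K has q^n elements.
theorem exists_root_of_natDegree_eq_finrank [Finite F] {K : Type*} [Field K] [Algebra F K]
    [FiniteDimensional F K] {g : F[X]} (hg : Irreducible g)
    (hd : g.natDegree = Module.finrank F K) : ∃ x : K, aeval x g = 0 := by
  have : Finite K := Module.finite_of_finite F
  have := Fintype.ofFinite K
  have h1 : g ∣ X ^ (Nat.card F) ^ (Module.finrank F K) - X :=
    hg.natDegree_dvd_iff_dvd_X_pow_card_pow_sub_X.mp hd.dvd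
  rw [← Module.natCard_eq_pow_finrank, Nat.card_eq_fintype_card] at h1
  have h2 : (map (algebraMap F K) g).Splits := by
    refine Splits.of_dvd (FiniteField.isSplittingField_sub K F).splits ?_
      (Polynomial.map_dvd (algebraMap F K) h1)
    exact map_ne_zero (FiniteField.X_pow_card_sub_X_ne_zero F Fintype.one_lt_card)
  obtain ⟨x, hx⟩ := h2.exists_eval_eq_zero (by
    rw [degree_map]
    exact (degree_pos_of_irreducible hg).ne')
  exact ⟨x, by rwa [eval_map_algebraMap] at hx⟩

open Polynomial in
theorem natDegree_quadratic (s t : F) : (X ^ 2 - C s * X - C t : F[X]).natDegree = 2 := by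
  compute_degree!

open Polynomial in
theorem natDegree_cubic (p q r : F) :
    (X ^ 3 - C p * X ^ 2 - C q * X - C r : F[X]).natDegree = 3 := by
  compute_degree!

open Polynomial in
theorem irreducible_quadratic {s t : F} (h : ∀ x, x ^ 2 - s * x - t ≠ 0) :
    Irreducible (X ^ 2 - C s * X - C t : F[X]) := by
  apply irreducible_of_degree_le_three_of_not_isRoot
  · rw [natDegree_quadratic]; simp
  · intro x hx
    exact h x (by simpa [IsRoot.def] using hx)

open Polynomial in
theorem irreducible_cubic {p q r : F} (h : ∀ x, x ^ 3 - p * x ^ 2 - q * x - r ≠ 0) :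
    Irreducible (X ^ 3 - C p * X ^ 2 - C q * X - C r : F[X]) := by
  apply irreducible_of_degree_le_three_of_not_isRoot
  · rw [natDegree_cubic]; simp
  · intro x hx
    exact h x (by simpa [IsRoot.def] using hx)

open Polynomial in
theorem finrank_adjoinRoot {f : F[X]} (hf : f ≠ 0) :
    Module.finrank F (AdjoinRoot f) = f.natDegree := by
  rw [(AdjoinRoot.powerBasis hf).finrank, AdjoinRoot.powerBasis_dim]

/-- Any two anisotropic quadratics over a finite field are related by an affine substitution. -/
theorem exists_affine_quadratic [Finite F] {s t u w : F} (h1 : ∀ x, x ^ 2 - s * x - t ≠ 0)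
    (h2 : ∀ x, x ^ 2 - u * x - w ≠ 0) :
    ∃ m n : F, n ≠ 0 ∧ m ^ 2 + n ^ 2 * t = u * m + w ∧ 2 * m + n * s = u := by
  have hf := irreducible_quadratic h1
  have hg := irreducible_quadratic h2
  set f := (Polynomial.X ^ 2 - Polynomial.C s * Polynomial.X - Polynomial.C t : Polynomial F)
    with hfdef
  have : Fact (Irreducible f) := ⟨hf⟩
  have hfin := finrank_adjoinRoot hf.ne_zero
  rw [natDegree_quadratic] at hfin
  have : FiniteDimensional F (AdjoinRoot f) := Module.finite_of_finrank_eq_succ hfin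
  -- In the quadratic extension F(θ) generated by a root θ of the first polynomial, the second one
  -- has a root η = m + nθ; these m, n are the required substitution.
  obtain ⟨η, hη⟩ := exists_root_of_natDegree_eq_finrank (K := AdjoinRoot f) hg
    (by rw [natDegree_quadratic, hfin])
  set θ := AdjoinRoot.root f with hθdef
  have hθ : θ ^ 2 = algebraMap F _ s * θ + algebraMap F _ t := by
    have h : Polynomial.aeval θ
        (Polynomial.X ^ 2 - Polynomial.C s * Polynomial.X - Polynomial.C t) = 0 := by
      rw [← hfdef, AdjoinRoot.aeval_eq, AdjoinRoot.mk_self]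
    simp only [map_sub, map_pow, map_mul, Polynomial.aeval_X, Polynomial.aeval_C] at h
    linear_combination h
  have hirr : ∀ x y : F, algebraMap F (AdjoinRoot f) x + algebraMap F _ y * θ = 0 →
      x = 0 ∧ y = 0 := by
    intro x y hxy
    have hy : y = 0 := by
      by_contra hy
      have hθx : θ = algebraMap F _ (-x / y) := by
        have : algebraMap F (AdjoinRoot f) y ≠ 0 := by simpa using hy
        rw [map_div₀, map_neg]
        field_simp
        linear_combination hxy
      apply h1 (-x / y)
      apply (algebraMap F (AdjoinRoot f)).injective
      rw [map_sub, map_sub, map_pow, map_mul, map_zero, ← hθx]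
      linear_combination hθ
    subst hy
    simpa using hxy
  obtain ⟨m, n, hmn⟩ : ∃ m n : F, η = algebraMap F _ m + algebraMap F _ n * θ := by
    have hli : LinearIndependent F ![(1 : AdjoinRoot f), θ] := by
      rw [LinearIndependent.pair_iff]
      intro x y hxy
      exact hirr x y (by simpa [Algebra.smul_def] using hxy)
    have hsp := hli.span_eq_top_of_card_eq_finrank' (by simp [hfin])
    have hη' : η ∈ Submodule.span F (Set.range ![(1 : AdjoinRoot f), θ]) := by
      rw [hsp]; trivial
    simp only [Matrix.range_cons, Matrix.range_empty, Set.union_empty, Set.singleton_union] at hη'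
    obtain ⟨m, n, h⟩ := Submodule.mem_span_pair.mp hη'
    exact ⟨m, n, by simpa [Algebra.smul_def] using h.symm⟩
  have hη2 : η ^ 2 - algebraMap F _ u * η - algebraMap F _ w = 0 := by
    simpa using hη
  -- Substituting η = m + nθ and θ² = sθ + t into the equation of η, the coefficients of 1 and θ
  -- vanish separately. The second carries a factor n, which is nonzero since otherwise m would be a
  -- root in F.
  obtain ⟨e1, e2⟩ := hirr (m ^ 2 + n ^ 2 * t - u * m - w) (2 * m * n + n ^ 2 * s - u * n) (by
    rw [hmn] at hη2
    simp only [map_add, map_sub, map_mul, map_pow, map_ofNat]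
    linear_combination hη2 - algebraMap F _ n ^ 2 * hθ)
  have hn : n ≠ 0 := by
    rintro rfl
    exact h2 m (by linear_combination e1)
  refine ⟨m, n, hn, by linear_combination e1, ?_⟩
  have : n * (2 * m + n * s - u) = 0 := by linear_combination e2
  linear_combination (mul_eq_zero.mp this).resolve_left hn

/-- In a cubic extension any two elements outside the ground field are related by an invertible
fractional linear transformation. -/
theorem exists_moebius {K : Type*} [Field K] [Algebra F K] (hK : Module.finrank F K = 3)
    {θ η : K} (hθ : ∀ x, θ ≠ algebraMap F K x) (hη : ∀ x, η ≠ algebraMap F K x) :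
    ∃ t₀ t₁ s₀ s₁ : F, t₀ * s₁ - t₁ * s₀ ≠ 0 ∧
      (algebraMap F K t₀ + algebraMap F K t₁ * θ) * η =
        -(algebraMap F K s₀ + algebraMap F K s₁ * θ) := by
  have hirr : ∀ ζ : K, (∀ x, ζ ≠ algebraMap F K x) → ∀ x y : F,
      algebraMap F K x + algebraMap F _ y * ζ = 0 → x = 0 ∧ y = 0 := by
    intro ζ hζ x y hxy
    have hy : y = 0 := by
      by_contra hy
      apply hζ (-x / y)
      have : algebraMap F K y ≠ 0 := by simpa using hy
      rw [map_div₀, map_neg]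
      field_simp
      linear_combination hxy
    subst hy
    simpa using hxy
  have : FiniteDimensional F K := Module.finite_of_finrank_eq_succ hK
  -- Four elements of a three-dimensional space are dependent; solving the relation c₀ + c₁θ + c₂η +
  -- c₃θη = 0 for η gives the fractional linear expression.
  have hdep : ¬ LinearIndependent F ![1, θ, η, θ * η] := by
    intro h
    have := h.fintype_card_le_finrank
    simp [hK] at this
  obtain ⟨c, hc, i, hi⟩ := Fintype.not_linearIndependent_iff.mp hdep
  simp only [Fin.sum_univ_four, Matrix.cons_val, Algebra.smul_def] at hc
  refine ⟨c 2, c 3, c 0, c 1, ?_, by linear_combination hc⟩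
  -- If the determinant vanished, both c₀ + c₂η and c₁ + c₃η would be annihilated by c₂ + c₃θ, which
  -- is nonzero. Hence both would be zero, and c₂ = c₃ = 0, which is excluded.
  intro hdet
  have hdet' : algebraMap F K (c 2) * algebraMap F K (c 1) =
      algebraMap F K (c 3) * algebraMap F K (c 0) := by
    rw [← map_mul, ← map_mul]; congr 1; linear_combination hdet
  have hc0 : c 2 = 0 ∧ c 3 = 0 → False := by
    rintro ⟨h2, h3⟩
    obtain ⟨h0, h1⟩ := hirr θ hθ (c 0) (c 1) (by rw [h2, h3] at hc; simpa using hc)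
    fin_cases i <;> simp_all
  have hne : algebraMap F K (c 2) + algebraMap F K (c 3) * θ ≠ 0 := fun h => hc0 (hirr θ hθ _ _ h)
  have e1 : algebraMap F K (c 0) + algebraMap F K (c 2) * η = 0 := by
    apply (mul_eq_zero.mp _).resolve_left hne
    linear_combination algebraMap F K (c 2) * hc - θ * hdet'
  have e2 : algebraMap F K (c 1) + algebraMap F K (c 3) * η = 0 := by
    apply (mul_eq_zero.mp _).resolve_left hne
    linear_combination algebraMap F K (c 3) * hc + hdet'
  exact hc0 ⟨(hirr η hη _ _ e1).2, (hirr η hη _ _ e2).2⟩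

open Polynomial in
/-- A cyclic submodule whose generator is annihilated by an irreducible polynomial is a
one-dimensional space over the corresponding extension field. -/
theorem exists_linearMap_adjoinRoot {M : Type*} [AddCommGroup M] [Module F M] (D : Module.End F M)
    {f : F[X]} (hf : Irreducible f) {r : M} (hr : r ≠ 0) (hfr : aeval D f r = 0) :
    ∃ ψ : AdjoinRoot f →ₗ[F] M, Function.Injective ψ ∧
      ∀ x, ψ (AdjoinRoot.root f * x) = D (ψ x) := by
  have : Fact (Irreducible f) := ⟨hf⟩
  let φ : F[X] →ₗ[F] M := (LinearMap.applyₗ r).comp (aeval D).toLinearMap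
  have hφ : ∀ p, φ p = aeval D p r := fun p => rfl
  -- The map p ↦ p(D) r factors through F[X]/(f). The induced map is written as the composite with a
  -- linear section σ; the choice of σ is immaterial because f(D) r = 0.
  obtain ⟨σ, hσ⟩ := (AdjoinRoot.mkₐ f).toLinearMap.exists_rightInverse_of_surjective
    (LinearMap.range_eq_top.mpr AdjoinRoot.mk_surjective)
  have hψ : ∀ p, φ (σ (AdjoinRoot.mk f p)) = φ p := by
    intro p
    have h1 : AdjoinRoot.mk f (σ (AdjoinRoot.mk f p)) = AdjoinRoot.mk f p :=
      LinearMap.congr_fun hσ _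
    obtain ⟨q, hq⟩ := AdjoinRoot.mk_eq_mk.mp h1
    rw [← sub_eq_zero, ← map_sub, hq, hφ, mul_comm, map_mul, Module.End.mul_apply, hfr, map_zero]
  refine ⟨φ.comp σ, ?_, ?_⟩
  · rw [injective_iff_map_eq_zero]
    intro x hx
    by_contra hx0
    obtain ⟨p, rfl⟩ := AdjoinRoot.mk_surjective x
    -- If p(D) r = 0 with p invertible modulo f, an inverse q gives r = q(D) p(D) r = 0.
    obtain ⟨q, hq⟩ := AdjoinRoot.mk_surjective (AdjoinRoot.mk f p)⁻¹
    have h1 : AdjoinRoot.mk f (q * p) = AdjoinRoot.mk f 1 := by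
      rw [map_mul, hq, inv_mul_cancel₀ hx0, map_one]
    have h2 : φ (q * p) = φ 1 := by rw [← hψ, h1, hψ]
    rw [LinearMap.comp_apply, hψ, hφ] at hx
    rw [hφ, map_mul, Module.End.mul_apply, hx, map_zero, hφ, map_one] at h2
    exact hr h2.symm
  · intro x
    obtain ⟨p, rfl⟩ := AdjoinRoot.mk_surjective x
    rw [← AdjoinRoot.mk_X, ← map_mul, LinearMap.comp_apply φ, LinearMap.comp_apply φ, hψ, hψ, hφ, hφ,
      map_mul, aeval_X, Module.End.mul_apply]

variable (F) in
-- The map x ↦ x² + x takes the value 0 at both 0 and -1, so on a finite field it misses some c.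
-- With u = 1 and v = 1/c the quadratic is (λ² + λ - c)/c.
theorem exists_quadCond [Finite F] : ∃ u v : F, QuadCond u v := by
  have : ¬ Function.Surjective fun x : F => x ^ 2 + x := by
    rw [← Finite.injective_iff_surjective]
    intro h
    have := @h 0 (-1) (by simp)
    simp at this
  simp only [Function.Surjective, not_forall, not_exists] at this
  obtain ⟨c, hc⟩ := this
  have hc0 : c ≠ 0 := fun h => hc 0 (by simp [h])
  refine ⟨1, c⁻¹, inv_ne_zero hc0, fun l hl => hc l ?_⟩
  field_simp at hl
  linear_combination hl

variable (F) in
-- The map x ↦ x³ - x takes the value 0 at both 0 and 1, so it misses some c; the polynomial λ³ - λ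
-- - c then has no root.
theorem exists_cubicCond [Finite F] : ∃ α β γ : F, CubicCond α β γ := by
  have : ¬ Function.Surjective fun x : F => x ^ 3 - x := by
    rw [← Finite.injective_iff_surjective]
    intro h
    have := @h 0 1 (by simp)
    simp at this
  simp only [Function.Surjective, not_forall, not_exists] at this
  obtain ⟨c, hc⟩ := this
  exact ⟨-c, 1, 0, fun l hl => hc l (by linear_combination hl)⟩

/-! ### Linear independence of two and three vectors -/

section Indep

variable {M : Type*} [AddCommGroup M] [Module F M]

variable (F) in
/-- Linear independence of two vectors. -/
def Indep₂ (x y : M) : Prop := ∀ s t : F, s • x + t • y = 0 → s = 0 ∧ t = 0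

variable (F) in
/-- Linear independence of three vectors. -/
def Indep₃ (x y z : M) : Prop :=
  ∀ s t r : F, s • x + t • y + r • z = 0 → s = 0 ∧ t = 0 ∧ r = 0

theorem Indep₂.linearIndependent {x y : M} (h : Indep₂ F x y) : LinearIndependent F ![x, y] :=
  LinearIndependent.pair_iff.mpr h

theorem Indep₃.linearIndependent {x y z : M} (h : Indep₃ F x y z) :
    LinearIndependent F ![x, y, z] := by
  rw [Fintype.linearIndependent_iff]
  intro g hg
  simp only [Fin.sum_univ_three, Matrix.cons_val] at hg
  obtain ⟨h0, h1, h2⟩ := h _ _ _ hg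
  intro i
  fin_cases i <;> assumption

theorem Indep₂.ne_left {x y : M} (h : Indep₂ F x y) : x ≠ 0 := by
  rintro rfl
  simpa using h 1 0 (by simp)

theorem Indep₂.ne_right {x y : M} (h : Indep₂ F x y) : y ≠ 0 := by
  rintro rfl
  simpa using h 0 1 (by simp)

theorem Indep₂.symm {x y : M} (h : Indep₂ F x y) : Indep₂ F y x := fun s t hst =>
  (h t s (by rw [add_comm]; exact hst)).symm

theorem Indep₃.left {x y z : M} (h : Indep₃ F x y z) : Indep₂ F x y := fun s t hst =>
  ⟨(h s t 0 (by simpa using hst)).1, (h s t 0 (by simpa using hst)).2.1⟩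

theorem Indep₃.rotate {x y z : M} (h : Indep₃ F x y z) : Indep₃ F y z x := by
  intro s t r hst
  obtain ⟨h1, h2, h3⟩ := h r s t (by rw [← hst]; abel)
  exact ⟨h2, h3, h1⟩

theorem Indep₃.swap {x y z : M} (h : Indep₃ F x y z) : Indep₃ F y x z := by
  intro s t r hst
  obtain ⟨h1, h2, h3⟩ := h t s r (by rw [← hst]; abel)
  exact ⟨h2, h1, h3⟩

theorem indep₂_or {x : M} (hx : x ≠ 0) (y : M) : (∃ s : F, y = s • x) ∨ Indep₂ F x y := by
  by_contra! h
  exact h.2 (LinearIndependent.pair_iff.mp ((LinearIndependent.pair_iff' hx).mpr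
    fun s hs => h.1 s hs.symm))

theorem indep₃_or {x y : M} (hxy : Indep₂ F x y) (z : M) :
    (∃ s t : F, z = s • x + t • y) ∨ Indep₃ F x y z := by
  by_cases h : ∃ s t : F, z = s • x + t • y
  · exact Or.inl h
  · right
    intro s t r hst
    have hr : r = 0 := by
      by_contra hr
      apply h
      refine ⟨-s / r, -t / r, ?_⟩
      have : z = r⁻¹ • (r • z) := by rw [inv_smul_smul₀ hr]
      rw [this, show r • z = -(s • x) - t • y by rw [← sub_eq_zero, ← hst]; abel]
      module
    subst hr
    obtain ⟨h1, h2⟩ := hxy s t (by simpa using hst)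
    exact ⟨h1, h2, rfl⟩

theorem Indep₂.exists_eq {W : Submodule F M} (hW : Module.finrank F W = 2) {x y : M}
    (h : Indep₂ F x y) (hx : x ∈ W) (hy : y ∈ W) {z : M} (hz : z ∈ W) :
    ∃ s t : F, z = s • x + t • y := by
  refine (indep₃_or h z).resolve_right fun h3 => ?_
  have : FiniteDimensional F W := Module.finite_of_finrank_eq_succ hW
  have hli : LinearIndependent F ![(⟨x, hx⟩ : W), ⟨y, hy⟩, ⟨z, hz⟩] := by
    apply Indep₃.linearIndependent
    intro s t r hst
    exact h3 s t r (by simpa using congrArg Subtype.val hst)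
  simpa [hW] using hli.fintype_card_le_finrank

theorem Indep₃.exists_eq {W : Submodule F M} (hW : Module.finrank F W = 3) {x y z : M}
    (h : Indep₃ F x y z) (hx : x ∈ W) (hy : y ∈ W) (hz : z ∈ W) {w : M} (hw : w ∈ W) :
    ∃ s t r : F, w = s • x + t • y + r • z := by
  have : FiniteDimensional F W := Module.finite_of_finrank_eq_succ hW
  have hli : LinearIndependent F ![(⟨x, hx⟩ : W), ⟨y, hy⟩, ⟨z, hz⟩] := by
    apply Indep₃.linearIndependent
    intro s t r hst
    exact h s t r (by simpa using congrArg Subtype.val hst)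
  have hsp := hli.span_eq_top_of_card_eq_finrank' (by simp [hW])
  have hw' : (⟨w, hw⟩ : W) ∈ Submodule.span F (Set.range ![(⟨x, hx⟩ : W), ⟨y, hy⟩, ⟨z, hz⟩]) := by
    rw [hsp]; trivial
  obtain ⟨c, hc⟩ := (Submodule.mem_span_range_iff_exists_fun F).mp hw'
  refine ⟨c 0, c 1, c 2, ?_⟩
  simpa [Fin.sum_univ_three] using (congrArg Subtype.val hc).symm

theorem exists_mem_not_smul {W : Submodule F M} (hW : 1 < Module.finrank F W) (x : M) :
    ∃ y ∈ W, ∀ s : F, y ≠ s • x := by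
  by_contra! h
  have h1 : W ≤ Submodule.span F {x} := fun y hy =>
    let ⟨s, hs⟩ := h y hy
    Submodule.mem_span_singleton.mpr ⟨s, hs.symm⟩
  have := (Submodule.finrank_mono h1).trans (finrank_span_le_card _)
  simp at this
  omega

theorem exists_mem_not_add {W : Submodule F M} (hW : 2 < Module.finrank F W) (x y : M) :
    ∃ z ∈ W, ∀ s t : F, z ≠ s • x + t • y := by
  classical
  by_contra! h
  have h1 : W ≤ Submodule.span F (({x, y} : Finset M) : Set M) := fun z hz =>
    let ⟨s, t, hs⟩ := h z hz
    by
      rw [Finset.coe_pair]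
      exact Submodule.mem_span_pair.mpr ⟨s, t, hs.symm⟩
  have := (Submodule.finrank_mono h1).trans (finrank_span_finset_le_card _)
  have := this.trans Finset.card_le_two
  omega

end Indep

theorem exists_indep₂ {n : ℕ} {x : Fin n → F} (hx : x ≠ 0) (hn : 1 < n := by norm_num) :
    ∃ y, Indep₂ F x y := by
  obtain ⟨y, -, hy⟩ := exists_mem_not_smul (W := (⊤ : Submodule F (Fin n → F)))
    (by simpa) x
  exact ⟨y, (indep₂_or hx y).resolve_left fun ⟨s, hs⟩ => hy s hs⟩

theorem exists_indep₃ {x y : Fin 3 → F} (h : Indep₂ F x y) : ∃ z, Indep₃ F x y z := by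
  obtain ⟨z, -, hz⟩ := exists_mem_not_add (W := (⊤ : Submodule F (Fin 3 → F)))
    (by simp) x y
  exact ⟨z, (indep₃_or h z).resolve_left fun ⟨s, t, hs⟩ => hz s t hs⟩

theorem Indep₂.exists_eq_fin {x y : Fin 2 → F} (h : Indep₂ F x y) (z : Fin 2 → F) :
    ∃ s t : F, z = s • x + t • y :=
  Indep₂.exists_eq (W := ⊤) (by simp) h trivial trivial trivial

theorem Indep₃.exists_eq_fin {x y z : Fin 3 → F} (h : Indep₃ F x y z) (w : Fin 3 → F) :
    ∃ s t r : F, w = s • x + t • y + r • z :=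
  Indep₃.exists_eq (W := ⊤) (by simp) h trivial trivial trivial trivial

theorem indep₂_single : Indep₂ F (Pi.single 0 1 : Fin 2 → F) (Pi.single 1 1) := by
  intro s t h
  exact ⟨by simpa using congrFun h 0, by simpa using congrFun h 1⟩

/-! ### Coordinates of tensors with respect to a frame -/

/-- Gives every tensor two rows c, d relative to an arbitrary basis of F²; all the classification
arguments are computations with these rows. -/
theorem exists_eq_tmul_add_tmul {a a' : Fin 2 → F} (h : Indep₂ F a a') (w : V F) :
    ∃ c d : Fin 3 → F, w = a ⊗ₜ[F] c + a' ⊗ₜ[F] d := by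
  induction w using TensorProduct.induction_on with
  | zero => exact ⟨0, 0, by simp⟩
  | tmul p q =>
    obtain ⟨s, t, rfl⟩ := h.exists_eq_fin p
    exact ⟨s • q, t • q, by rw [TensorProduct.add_tmul, TensorProduct.smul_tmul,
      TensorProduct.smul_tmul]⟩
  | add v w hv hw =>
    obtain ⟨c, d, rfl⟩ := hv
    obtain ⟨c', d', rfl⟩ := hw
    exact ⟨c + c', d + d', by simp only [TensorProduct.tmul_add]; abel⟩

/-- Contraction of tensors by a linear form on the first factor. -/
def contract (f : (Fin 2 → F) →ₗ[F] F) : V F →ₗ[F] (Fin 3 → F) :=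
  (TensorProduct.lid F (Fin 3 → F)).toLinearMap ∘ₗ LinearMap.rTensor (Fin 3 → F) f

theorem contract_tmul (f : (Fin 2 → F) →ₗ[F] F) (a : Fin 2 → F) (b : Fin 3 → F) :
    contract f (a ⊗ₜ b) = f a • b := by
  simp [contract]

theorem Indep₂.exists_dual {a a' : Fin 2 → F} (h : Indep₂ F a a') :
    ∃ f : (Fin 2 → F) →ₗ[F] F, f a = 1 ∧ f a' = 0 := by
  let b := basisOfLinearIndependentOfCardEqFinrank h.linearIndependent (by simp)
  refine ⟨b.coord 0, ?_, ?_⟩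
  · have : a = b 0 := by simp [b]
    rw [this]; simp
  · have : a' = b 1 := by simp [b]
    rw [this]; simp

/-- The coordinates of tensors. -/
def coord (i : Fin 2) (j : Fin 3) : V F →ₗ[F] F :=
  LinearMap.proj j ∘ₗ contract (LinearMap.proj i)

theorem coord_tmul (i : Fin 2) (j : Fin 3) (a : Fin 2 → F) (b : Fin 3 → F) :
    coord i j (a ⊗ₜ b) = a i * b j := by
  simp [coord, contract_tmul]

theorem coord_tensor (i : Fin 2) (j : Fin 3) (m : Matrix (Fin 2) (Fin 3) F) :
    coord i j (tensor m) = m i j := by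
  simp only [tensor, map_add, map_smul, coord_tmul, Fin.sum_univ_two, Fin.sum_univ_three]
  fin_cases i <;> fin_cases j <;> simp

theorem tensor_coord (w : V F) : tensor (Matrix.of fun i j => coord i j w) = w := by
  induction w using TensorProduct.induction_on with
  | zero => simp [tensor]
  | tmul a b =>
    have ha : a = ∑ i, a i • (Pi.single i 1 : Fin 2 → F) := by
      ext i; simp [Finset.sum_apply, Pi.single_apply]
    have hb : b = ∑ j, b j • (Pi.single j 1 : Fin 3 → F) := by
      ext i; simp [Finset.sum_apply, Pi.single_apply]
    conv_rhs => rw [ha, hb]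
    simp only [tensor, Matrix.of_apply, coord_tmul, TensorProduct.sum_tmul, TensorProduct.tmul_sum,
      ← TensorProduct.smul_tmul', TensorProduct.tmul_smul]
    rw [Finset.sum_comm]
    simp only [Finset.smul_sum, smul_smul, mul_comm]
  | add v w hv hw =>
    conv_rhs => rw [← hv, ← hw]
    simp only [tensor, Matrix.of_apply, map_add, add_smul, Finset.sum_add_distrib]

variable (F) in
/-- The linear isomorphism between matrices and tensors. -/
def tensorEquiv : Matrix (Fin 2) (Fin 3) F ≃ₗ[F] V F where
  toFun := tensor
  map_add' m m' := by simp only [tensor, Matrix.add_apply, add_smul, Finset.sum_add_distrib]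
  map_smul' c m := by
    simp only [tensor, Matrix.smul_apply, smul_eq_mul, mul_smul, Finset.smul_sum, RingHom.id_apply]
  invFun w := Matrix.of fun i j => coord i j w
  left_inv m := by ext i j; simp [coord_tensor]
  right_inv w := tensor_coord w

theorem tensorEquiv_apply (m : Matrix (Fin 2) (Fin 3) F) : tensorEquiv F m = tensor m := rfl

/-- The tensor with a given coordinate matrix with respect to a frame. -/
def frameTensor (a a' : Fin 2 → F) (b₀ b₁ b₂ : Fin 3 → F) (m : Matrix (Fin 2) (Fin 3) F) : V F :=
  a ⊗ₜ (m 0 0 • b₀ + m 0 1 • b₁ + m 0 2 • b₂) + a' ⊗ₜ (m 1 0 • b₀ + m 1 1 • b₁ + m 1 2 • b₂)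

theorem exists_glMap {n : ℕ} {x : Fin n → Fin n → F} (hx : LinearIndependent F x) :
    ∃ g : GL (Fin n) F, ∀ i, g.1.mulVec (Pi.single i 1) = x i := by
  have h1 : IsUnit (Matrix.of x).transpose :=
    Matrix.linearIndependent_cols_iff_isUnit.mp hx
  obtain ⟨g, hg⟩ := h1
  refine ⟨g, fun i => ?_⟩
  rw [hg]
  ext j
  simp

theorem exists_tensorHom_frame {a a' : Fin 2 → F} {b₀ b₁ b₂ : Fin 3 → F} (ha : Indep₂ F a a')
    (hb : Indep₃ F b₀ b₁ b₂) :
    ∃ g h, ∀ m, tensorHom F (g, h) (tensor m) = frameTensor a a' b₀ b₁ b₂ m := by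
  obtain ⟨g, hg⟩ := exists_glMap ha.linearIndependent
  obtain ⟨h, hh⟩ := exists_glMap hb.linearIndependent
  refine ⟨g, h, fun m => ?_⟩
  simp only [tensor, map_add, map_smul, tensorHom_tmul, hg, hh, Fin.sum_univ_two,
    Fin.sum_univ_three, frameTensor, TensorProduct.tmul_add, TensorProduct.tmul_smul,
    Matrix.cons_val]

/-- The element g ⊗ h carrying the standard frame to the given one sends the span of S into W, and
equality follows from the dimensions. Only generators need checking, and only for membership in W.
-/
theorem mem_orbit_span {a a' : Fin 2 → F} {b₀ b₁ b₂ : Fin 3 → F} (ha : Indep₂ F a a')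
    (hb : Indep₃ F b₀ b₁ b₂) {S : Set (V F)} {W : Submodule F (V F)}
    (hW : Module.finrank F W = Module.finrank F (Submodule.span F S))
    (hS : ∀ t ∈ S, ∃ m, t = tensor m ∧ frameTensor a a' b₀ b₁ b₂ m ∈ W) :
    PG W ∈ MulAction.orbit (Hbar₂ F) (PG (Submodule.span F S)) := by
  obtain ⟨g, h, hgh⟩ := exists_tensorHom_frame ha hb
  rw [mem_orbit_iff]
  refine ⟨g, h, ?_⟩
  rw [smul_PG]
  congr 1
  symm
  apply Submodule.eq_of_le_of_finrank_eq
  · rw [Submodule.map_span, Submodule.span_le]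
    rintro _ ⟨t, ht, rfl⟩
    obtain ⟨m, rfl, hm⟩ := hS t ht
    rw [← hgh] at hm
    exact hm
  · rw [hW]
    exact LinearEquiv.finrank_map_eq _ _

/-! ### The representatives -/

variable (F) in
/-- The parametrized matrix of a point representative. -/
def PointType.mat : PointType → F → Matrix (Fin 2) (Fin 3) F
  | o1, x => !![x, 0, 0; 0, 0, 0]
  | o4, x => !![x, 0, 0; 0, x, 0]

/-- The parametrized matrix of a line representative. -/
def LineType.mat (u v : F) : LineType → F → F → Matrix (Fin 2) (Fin 3) F
  | o2, x, y => !![x, y, 0; 0, 0, 0]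
  | o4T, x, y => !![x, 0, 0; y, 0, 0]
  | o5, x, y => !![x, 0, 0; 0, y, 0]
  | o6, x, y => !![x, 0, 0; y, x, 0]
  | o7, x, y => !![x, y, 0; 0, 0, x]
  | o10, x, y => !![x, u * x + y, 0; v * y, x, 0]
  | o11, x, y => !![x, y, 0; 0, x, y]

/-- The parametrized matrix of a plane representative. -/
def PlaneType.mat (u v α β γ : F) : PlaneType → F → F → F → Matrix (Fin 2) (Fin 3) F
  | o3, x, y, z => !![x, y, z; 0, 0, 0]
  | o7T, x, y, z => !![z, 0, 0; x, y, 0]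
  | o8, x, y, z => !![x, 0, 0; 0, y, z]
  | o9, x, y, z => !![z, 0, 0; x, y, z]
  | o11T, x, y, z => !![x, y, 0; y, z, 0]
  | o12, x, y, z => !![x, y, 0; 0, z, x]
  | o13, x, y, z => !![x, y, 0; 0, x, z]
  | o14, x, y, z => !![x, y, 0; 0, y, z]
  | o15, x, y, z => !![x, u * x + y, z; v * y, x, 0]
  | o16, x, y, z => !![x, y, z; 0, x, y]
  | o17, x, y, z => !![x, y, z; α * z, x + β * z, y + γ * z]

/-- The space spanned by the tensors of a linearly independent family of matrices. -/
theorem span_range_tensor {n : ℕ} (L : (Fin n → F) →ₗ[F] Matrix (Fin 2) (Fin 3) F)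
    (hL : ∀ x, L x = 0 → x = 0) (S : Set (V F)) (hS : S = Set.range fun x => tensor (L x)) :
    (Submodule.span F S : Set (V F)) = S ∧ Module.finrank F (Submodule.span F S) = n := by
  have h1 : S = (LinearMap.range ((tensorEquiv F).toLinearMap ∘ₗ L) : Set (V F)) := by
    rw [hS]; rfl
  rw [h1, Submodule.span_eq]
  refine ⟨rfl, ?_⟩
  rw [LinearMap.finrank_range_of_inj]
  · simp
  · rw [injective_iff_map_eq_zero]
    intro x hx
    exact hL x ((tensorEquiv F).map_eq_zero_iff.mp hx)

theorem PointType.span_spec (o : PointType) :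
    (∀ t, t ∈ o.rep F ↔ ∃ x, t = tensor (o.mat F x)) ∧ Module.finrank F (o.rep F) = 1 := by
  let L : (Fin 1 → F) →ₗ[F] Matrix (Fin 2) (Fin 3) F :=
    { toFun := fun x => o.mat F (x 0)
      map_add' := fun x y => by cases o <;> simp [PointType.mat]
      map_smul' := fun c x => by cases o <;> simp [PointType.mat] }
  have hr : o.rep F = Submodule.span F {t | ∃ x, t = tensor (o.mat F x)} := by cases o <;> rfl
  have hL : ∀ x, L x = 0 → x = 0 := by
    intro x hx
    have h : o.mat F (x 0) = 0 := hx
    ext i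
    fin_cases i
    have h00 := congrFun (congrFun h 0) 0
    cases o <;> simpa [PointType.mat] using h00
  obtain ⟨h1, h2⟩ := span_range_tensor L hL {t | ∃ x, t = tensor (o.mat F x)} (by
    ext t
    constructor
    · rintro ⟨x, rfl⟩
      exact ⟨fun _ => x, rfl⟩
    · rintro ⟨x, rfl⟩
      exact ⟨x 0, rfl⟩)
  rw [hr]
  exact ⟨fun t => by rw [← SetLike.mem_coe, h1]; rfl, h2⟩

theorem LineType.mat_eq (u v : F) (o : LineType) (x y : F) :
    o.mat u v x y = x • o.mat u v 1 0 + y • o.mat u v 0 1 := by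
  ext i j
  cases o <;> fin_cases i <;> fin_cases j <;> simp [LineType.mat, mul_comm]

theorem LineType.eq_zero_of_mat_eq_zero {u v : F} (o : LineType) {x y : F}
    (h : o.mat u v x y = 0) : x = 0 ∧ y = 0 := by
  have h00 : o.mat u v x y 0 0 = 0 := by rw [h]; rfl
  have h01 : o.mat u v x y 0 1 = 0 := by rw [h]; rfl
  have h10 : o.mat u v x y 1 0 = 0 := by rw [h]; rfl
  have h11 : o.mat u v x y 1 1 = 0 := by rw [h]; rfl
  clear h
  cases o <;> simp [LineType.mat] at h00 h01 h10 h11 <;> simp_all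

theorem LineType.span_spec (u v : F) (o : LineType) :
    (∀ t, t ∈ o.rep u v ↔ ∃ x y, t = tensor (o.mat u v x y)) ∧
      Module.finrank F (o.rep u v) = 2 := by
  let L : (Fin 2 → F) →ₗ[F] Matrix (Fin 2) (Fin 3) F :=
    (LinearMap.proj 0).smulRight (o.mat u v 1 0) + (LinearMap.proj 1).smulRight (o.mat u v 0 1)
  have hLx : ∀ x, L x = o.mat u v (x 0) (x 1) := fun x => (o.mat_eq u v (x 0) (x 1)).symm
  have hr : o.rep u v = Submodule.span F {t | ∃ x y, t = tensor (o.mat u v x y)} := by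
    cases o <;> rfl
  have hL : ∀ x, L x = 0 → x = 0 := by
    intro x hx
    rw [hLx] at hx
    obtain ⟨h0, h1⟩ := o.eq_zero_of_mat_eq_zero hx
    ext i
    fin_cases i <;> assumption
  obtain ⟨h1, h2⟩ := span_range_tensor L hL {t | ∃ x y, t = tensor (o.mat u v x y)} (by
    ext t
    simp only [hLx]
    constructor
    · rintro ⟨x, y, rfl⟩
      exact ⟨![x, y], rfl⟩
    · rintro ⟨x, rfl⟩
      exact ⟨x 0, x 1, rfl⟩)
  rw [hr]
  exact ⟨fun t => by rw [← SetLike.mem_coe, h1]; rfl, h2⟩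

theorem PlaneType.mat_eq (u v α β γ : F) (o : PlaneType) (x y z : F) :
    o.mat u v α β γ x y z =
      x • o.mat u v α β γ 1 0 0 + y • o.mat u v α β γ 0 1 0 + z • o.mat u v α β γ 0 0 1 := by
  ext i j
  cases o <;> fin_cases i <;> fin_cases j <;> simp [PlaneType.mat, mul_comm]

theorem PlaneType.eq_zero_of_mat_eq_zero {u v α β γ : F} (o : PlaneType) {x y z : F}
    (h : o.mat u v α β γ x y z = 0) : x = 0 ∧ y = 0 ∧ z = 0 := by
  have h00 : o.mat u v α β γ x y z 0 0 = 0 := by rw [h]; rfl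
  have h01 : o.mat u v α β γ x y z 0 1 = 0 := by rw [h]; rfl
  have h02 : o.mat u v α β γ x y z 0 2 = 0 := by rw [h]; rfl
  have h10 : o.mat u v α β γ x y z 1 0 = 0 := by rw [h]; rfl
  have h11 : o.mat u v α β γ x y z 1 1 = 0 := by rw [h]; rfl
  have h12 : o.mat u v α β γ x y z 1 2 = 0 := by rw [h]; rfl
  clear h
  cases o <;> simp [PlaneType.mat] at h00 h01 h02 h10 h11 h12 <;> simp_all

theorem PlaneType.span_spec (u v α β γ : F) (o : PlaneType) :
    (∀ t, t ∈ o.rep u v α β γ ↔ ∃ x y z, t = tensor (o.mat u v α β γ x y z)) ∧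
      Module.finrank F (o.rep u v α β γ) = 3 := by
  let L : (Fin 3 → F) →ₗ[F] Matrix (Fin 2) (Fin 3) F :=
    (LinearMap.proj 0).smulRight (o.mat u v α β γ 1 0 0) +
      (LinearMap.proj 1).smulRight (o.mat u v α β γ 0 1 0) +
      (LinearMap.proj 2).smulRight (o.mat u v α β γ 0 0 1)
  have hLx : ∀ x, L x = o.mat u v α β γ (x 0) (x 1) (x 2) :=
    fun x => (o.mat_eq u v α β γ (x 0) (x 1) (x 2)).symm
  have hr : o.rep u v α β γ =
      Submodule.span F {t | ∃ x y z, t = tensor (o.mat u v α β γ x y z)} := by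
    cases o <;> rfl
  have hL : ∀ x, L x = 0 → x = 0 := by
    intro x hx
    rw [hLx] at hx
    obtain ⟨h0, h1, h2⟩ := o.eq_zero_of_mat_eq_zero hx
    ext i
    fin_cases i <;> assumption
  obtain ⟨h1, h2⟩ := span_range_tensor L hL {t | ∃ x y z, t = tensor (o.mat u v α β γ x y z)} (by
    ext t
    simp only [hLx]
    constructor
    · rintro ⟨x, y, z, rfl⟩
      exact ⟨![x, y, z], rfl⟩
    · rintro ⟨x, rfl⟩
      exact ⟨x 0, x 1, x 2, rfl⟩)
  rw [hr]
  exact ⟨fun t => by rw [← SetLike.mem_coe, h1]; rfl, h2⟩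

theorem frameTensor_add (a a' : Fin 2 → F) (b₀ b₁ b₂ : Fin 3 → F)
    (m m' : Matrix (Fin 2) (Fin 3) F) : frameTensor a a' b₀ b₁ b₂ (m + m') =
      frameTensor a a' b₀ b₁ b₂ m + frameTensor a a' b₀ b₁ b₂ m' := by
  simp only [frameTensor, Matrix.add_apply, TensorProduct.tmul_smul, TensorProduct.tmul_add]
  module

theorem frameTensor_smul (a a' : Fin 2 → F) (b₀ b₁ b₂ : Fin 3 → F) (c : F)
    (m : Matrix (Fin 2) (Fin 3) F) : frameTensor a a' b₀ b₁ b₂ (c • m) =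
      c • frameTensor a a' b₀ b₁ b₂ m := by
  simp only [frameTensor, Matrix.smul_apply, smul_eq_mul, TensorProduct.tmul_smul,
    TensorProduct.tmul_add]
  module

theorem PointType.mem_orbit (o : PointType) {W : Submodule F (V F)}
    (hW : Module.finrank F W = 1) {a a' : Fin 2 → F} {b₀ b₁ b₂ : Fin 3 → F}
    (ha : Indep₂ F a a') (hb : Indep₃ F b₀ b₁ b₂)
    (h₁ : frameTensor a a' b₀ b₁ b₂ (o.mat F 1) ∈ W) :
    PG W ∈ MulAction.orbit (Hbar₂ F) (PG (o.rep F)) := by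
  rw [← Submodule.span_eq (o.rep F)]
  refine mem_orbit_span ha hb (by rw [Submodule.span_eq, o.span_spec.2, hW]) fun t ht => ?_
  obtain ⟨x, rfl⟩ := (o.span_spec.1 t).mp ht
  refine ⟨_, rfl, ?_⟩
  have : frameTensor a a' b₀ b₁ b₂ (o.mat F x) = x • frameTensor a a' b₀ b₁ b₂ (o.mat F 1) := by
    cases o <;> simp [PointType.mat, frameTensor, TensorProduct.tmul_smul]
  rw [this]
  exact W.smul_mem _ h₁

theorem LineType.mem_orbit {u v : F} (o : LineType) {W : Submodule F (V F)}
    (hW : Module.finrank F W = 2) {a a' : Fin 2 → F} {b₀ b₁ b₂ : Fin 3 → F}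
    (ha : Indep₂ F a a') (hb : Indep₃ F b₀ b₁ b₂)
    (h₁ : frameTensor a a' b₀ b₁ b₂ (o.mat u v 1 0) ∈ W)
    (h₂ : frameTensor a a' b₀ b₁ b₂ (o.mat u v 0 1) ∈ W) :
    PG W ∈ MulAction.orbit (Hbar₂ F) (PG (o.rep u v)) := by
  rw [← Submodule.span_eq (o.rep u v)]
  refine mem_orbit_span ha hb (by rw [Submodule.span_eq, (o.span_spec u v).2, hW])
    fun t ht => ?_
  obtain ⟨x, y, rfl⟩ := ((o.span_spec u v).1 t).mp ht
  refine ⟨_, rfl, ?_⟩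
  rw [o.mat_eq, frameTensor_add, frameTensor_smul, frameTensor_smul]
  exact W.add_mem (W.smul_mem _ h₁) (W.smul_mem _ h₂)

theorem PlaneType.mem_orbit {u v α β γ : F} (o : PlaneType) {W : Submodule F (V F)}
    (hW : Module.finrank F W = 3) {a a' : Fin 2 → F} {b₀ b₁ b₂ : Fin 3 → F}
    (ha : Indep₂ F a a') (hb : Indep₃ F b₀ b₁ b₂)
    (h₁ : frameTensor a a' b₀ b₁ b₂ (o.mat u v α β γ 1 0 0) ∈ W)
    (h₂ : frameTensor a a' b₀ b₁ b₂ (o.mat u v α β γ 0 1 0) ∈ W)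
    (h₃ : frameTensor a a' b₀ b₁ b₂ (o.mat u v α β γ 0 0 1) ∈ W) :
    PG W ∈ MulAction.orbit (Hbar₂ F) (PG (o.rep u v α β γ)) := by
  rw [← Submodule.span_eq (o.rep u v α β γ)]
  refine mem_orbit_span ha hb (by rw [Submodule.span_eq, (o.span_spec u v α β γ).2, hW])
    fun t ht => ?_
  obtain ⟨x, y, z, rfl⟩ := ((o.span_spec u v α β γ).1 t).mp ht
  refine ⟨_, rfl, ?_⟩
  rw [o.mat_eq, frameTensor_add, frameTensor_add, frameTensor_smul, frameTensor_smul,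
    frameTensor_smul]
  exact W.add_mem (W.add_mem (W.smul_mem _ h₁) (W.smul_mem _ h₂)) (W.smul_mem _ h₃)

/-! ### Classification of points and lines -/

section Indep

variable {M : Type*} [AddCommGroup M] [Module F M]

theorem Indep₂.add_smul {x y : M} (h : Indep₂ F x y) (t : F) : Indep₂ F (x + t • y) y := by
  intro p q hpq
  obtain ⟨h1, h2⟩ := h p (p * t + q) (by rw [← hpq]; module)
  subst h1
  exact ⟨rfl, by simpa using h2⟩

theorem Indep₂.smul {x y : M} (h : Indep₂ F x y) {s t : F} (hs : s ≠ 0) (ht : t ≠ 0) :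
    Indep₂ F (s • x) (t • y) := by
  intro p q hpq
  obtain ⟨h1, h2⟩ := h (p * s) (q * t) (by rw [← hpq]; module)
  exact ⟨(mul_eq_zero.mp h1).resolve_right hs, (mul_eq_zero.mp h2).resolve_right ht⟩

theorem Indep₃.smul {x y z : M} (h : Indep₃ F x y z) {s t r : F} (hs : s ≠ 0) (ht : t ≠ 0)
    (hr : r ≠ 0) : Indep₃ F (s • x) (t • y) (r • z) := by
  intro p q w hpq
  obtain ⟨h1, h2, h3⟩ := h (p * s) (q * t) (w * r) (by rw [← hpq]; module)
  exact ⟨(mul_eq_zero.mp h1).resolve_right hs, (mul_eq_zero.mp h2).resolve_right ht,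
    (mul_eq_zero.mp h3).resolve_right hr⟩

end Indep

/-- A generator a ⊗ c + a' ⊗ d has either dependent rows, and is a pure tensor (o1), or independent
rows, which extend to a frame of F³ (o4). -/
theorem point_classification {W : Submodule F (V F)} (hW : Module.finrank F W = 1) :
    ∃ o : PointType, PG W ∈ MulAction.orbit (Hbar₂ F) (PG (o.rep F)) := by
  have hne : W ≠ ⊥ := by
    rintro rfl
    simp at hW
  obtain ⟨w, hw, hw0⟩ := W.ne_bot_iff.mp hne
  have ha := indep₂_single (F := F)
  -- The standard basis serves only as some independent pair, so its coordinates are forgotten.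
  generalize (Pi.single 0 1 : Fin 2 → F) = a at ha
  generalize (Pi.single 1 1 : Fin 2 → F) = a' at ha
  obtain ⟨c, d, rfl⟩ := exists_eq_tmul_add_tmul ha w
  have key : ∀ (x y : Fin 2 → F) (b : Fin 3 → F), Indep₂ F x y → b ≠ 0 → x ⊗ₜ[F] b ∈ W →
      ∃ o : PointType, PG W ∈ MulAction.orbit (Hbar₂ F) (PG (o.rep F)) := by
    intro x y b hxy hb hx
    obtain ⟨b', hb'⟩ := exists_indep₂ hb
    obtain ⟨b'', hb''⟩ := exists_indep₃ hb'
    exact ⟨.o1, PointType.mem_orbit .o1 hW hxy hb'' (by simpa [PointType.mat, frameTensor] using hx)⟩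
  by_cases hc : c = 0
  · subst hc
    refine key a' a d ha.symm ?_ (by simpa using hw)
    rintro rfl
    simp at hw0
  · rcases indep₂_or (F := F) hc d with ⟨s, rfl⟩ | hcd
    · refine key (a + s • a') a' c (ha.add_smul s) hc ?_
      rwa [TensorProduct.add_tmul, TensorProduct.smul_tmul]
    · obtain ⟨b'', hb''⟩ := exists_indep₃ hcd
      exact ⟨.o4, PointType.mem_orbit .o4 hW ha hb''
        (by simpa [PointType.mat, frameTensor] using hw)⟩

/-- A chain `r ↦ s ↦ p r + q s` without eigenvectors can be brought into the normal form of
`o10` without changing the first vector of `F^2`. -/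
theorem exists_quadratic_normal_form [Finite F] {u v : F} (huv : QuadCond u v) {p q : F}
    (hpq : ∀ x, x ^ 2 - q * x - p ≠ 0) (W : Submodule F (V F)) (a a' : Fin 2 → F)
    (r s : Fin 3 → F) (h1 : a ⊗ₜ[F] r + a' ⊗ₜ[F] s ∈ W)
    (h2 : a ⊗ₜ[F] s + a' ⊗ₜ[F] (p • r + q • s) ∈ W) :
    ∃ m n : F, n ≠ 0 ∧
      a ⊗ₜ[F] (s + u • v • (m • s + n • r)) + (n • a' - m • a) ⊗ₜ[F] (v • (m • s + n • r)) ∈ W ∧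
      a ⊗ₜ[F] (v • (m • s + n • r)) + (n • a' - m • a) ⊗ₜ[F] (v • s) ∈ W := by
  have hp : p ≠ 0 := fun h => hpq 0 (by simp [h])
  have hv := huv.1
  -- The two monic quadratics being compared are x² + (q/p)x - 1/p, whose roots would be reciprocals
  -- of roots of x² - qx - p, and x² - ux - 1/v, whose roots would be negatives of the λ excluded by
  -- the condition on u, v.
  obtain ⟨m, n, hn, e1, e2⟩ := exists_affine_quadratic (s := -q / p) (t := 1 / p) (u := u)
    (w := 1 / v) (by
      intro x hx
      have hx0 : x ≠ 0 := by
        rintro rfl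
        simp [hp] at hx
      apply hpq (1 / x)
      field_simp at hx ⊢
      linear_combination -hx) (by
      intro x hx
      apply huv.2 (-x)
      field_simp at hx
      linear_combination hx)
  refine ⟨m, n, hn, ?_, ?_⟩
  · have hy : v * n ^ 2 / p = 1 + u * v * m - m ^ 2 * v := by
      field_simp at e1 ⊢
      linear_combination e1
    have hx : u * v * n - m * n * v = v * n * m - v * n ^ 2 / p * q := by
      field_simp at e2 ⊢
      linear_combination -e2
    have key : a ⊗ₜ[F] (s + u • v • (m • s + n • r)) +
        (n • a' - m • a) ⊗ₜ[F] (v • (m • s + n • r)) =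
        (u * v * n - m * n * v) • (a ⊗ₜ[F] r + a' ⊗ₜ[F] s) +
          (v * n ^ 2 / p) • (a ⊗ₜ[F] s + a' ⊗ₜ[F] (p • r + q • s)) := by
      have hpp : v * n ^ 2 / p * p = v * n ^ 2 := by field_simp
      simp only [TensorProduct.tmul_add, TensorProduct.tmul_smul, TensorProduct.sub_tmul,
        ← TensorProduct.smul_tmul', smul_add, smul_smul, hpp]
      rw [show u * v * n - m * n * v = v * n * m - v * n ^ 2 / p * q from hx]
      have hx' : v * n * m - v * n ^ 2 / p * q = u * v * n - m * n * v := hx.symm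
      match_scalars
      · linear_combination -hy
      · linear_combination hx
      · ring
      · ring
    rw [key]
    exact W.add_mem (W.smul_mem _ h1) (W.smul_mem _ h2)
  · have key : a ⊗ₜ[F] (v • (m • s + n • r)) + (n • a' - m • a) ⊗ₜ[F] (v • s) =
        (v * n) • (a ⊗ₜ[F] r + a' ⊗ₜ[F] s) := by
      simp only [TensorProduct.tmul_add, TensorProduct.tmul_smul, TensorProduct.sub_tmul,
        ← TensorProduct.smul_tmul']
      module
    rw [key]
    exact W.smul_mem _ h1

theorem indep₂_quadratic_normal_form {n : F} (hn : n ≠ 0) (m : F) {a a' : Fin 2 → F}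
    (h : Indep₂ F a a') : Indep₂ F a (n • a' - m • a) := by
  intro p q hpq
  obtain ⟨h1, h2⟩ := h (p - q * m) (q * n) (by rw [← hpq]; module)
  have hq := (mul_eq_zero.mp h2).resolve_right hn
  subst hq
  exact ⟨by simpa using h1, rfl⟩

theorem indep₃_quadratic_normal_form {v m n : F} (hv : v ≠ 0) (hn : n ≠ 0) {r s e : Fin 3 → F}
    (h : Indep₃ F r s e) : Indep₃ F s (v • (m • s + n • r)) e := by
  intro p q w hpq
  obtain ⟨h1, h2, h3⟩ := h (q * v * n) (p + q * v * m) w (by rw [← hpq]; module)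
  have hq := (mul_eq_zero.mp ((mul_eq_zero.mp h1).resolve_right hn)).resolve_right hv
  subst hq
  exact ⟨by simpa using h2, rfl, h3⟩

/-- If e is independent of r and s, the chain is the o11 form. If e = pr + qs, a root x of x² - qx -
p would put the pure tensor (a + xa') ⊗ (s - (q - x)r) in W; so there is no root and the quadratic
normal form gives o10. -/
theorem line_classification_of_chain [Finite F] {u v : F} (huv : QuadCond u v)
    {W : Submodule F (V F)} (hW : Module.finrank F W = 2) {a a' : Fin 2 → F} (ha : Indep₂ F a a')
    (hfree : ∀ x y, x ≠ 0 → y ≠ 0 → x ⊗ₜ[F] y ∉ W) {r s e : Fin 3 → F} (hrs : Indep₂ F r s)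
    (h1 : a ⊗ₜ[F] r + a' ⊗ₜ[F] s ∈ W) (h2 : a ⊗ₜ[F] s + a' ⊗ₜ[F] e ∈ W) :
    ∃ o : LineType, PG W ∈ MulAction.orbit (Hbar₂ F) (PG (o.rep u v)) := by
  rcases indep₃_or hrs e with ⟨p, q, rfl⟩ | h3
  · obtain ⟨e, he⟩ := exists_indep₃ hrs
    obtain ⟨m, n, hn, h3, h4⟩ := exists_quadratic_normal_form huv (p := p) (q := q) (by
      intro x hx
      refine hfree (a + x • a') (s - (q - x) • r) (ha.add_smul x).ne_left ?_ ?_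
      · intro h0
        have := hrs (-(q - x)) 1 (by rw [← h0]; module)
        simp at this
      · have key : (a + x • a') ⊗ₜ[F] (s - (q - x) • r) =
            (a ⊗ₜ[F] s + a' ⊗ₜ[F] (p • r + q • s)) - (q - x) • (a ⊗ₜ[F] r + a' ⊗ₜ[F] s) := by
          simp only [TensorProduct.tmul_add, TensorProduct.tmul_smul, TensorProduct.add_tmul,
            TensorProduct.tmul_sub, ← TensorProduct.smul_tmul']
          match_scalars
          · ring
          · ring
          · ring
          · linear_combination hx
        rw [key]
        exact W.sub_mem h2 (W.smul_mem _ h1)) W a a' r s h1 h2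
    refine ⟨.o10, LineType.mem_orbit .o10 hW (indep₂_quadratic_normal_form hn m ha)
      (indep₃_quadratic_normal_form (m := m) huv.1 hn he) ?_ ?_⟩
    · simpa [LineType.mat, frameTensor] using h3
    · simpa [LineType.mat, frameTensor] using h4
  · refine ⟨.o11, LineType.mem_orbit .o11 hW ha h3 ?_ ?_⟩
    · simpa [LineType.mat, frameTensor] using h1
    · simpa [LineType.mat, frameTensor] using h2

/-- A tensor not of rank one has independent rows. -/
theorem indep₂_of_rank_ne_one {W : Submodule F (V F)} {a a' : Fin 2 → F} (ha : Indep₂ F a a')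
    (hfree : ∀ x y, x ≠ 0 → y ≠ 0 → x ⊗ₜ[F] y ∉ W) {c d : Fin 3 → F}
    (h : a ⊗ₜ[F] c + a' ⊗ₜ[F] d ∈ W) (hcd : c ≠ 0 ∨ d ≠ 0) : Indep₂ F c d := by
  by_cases hc : c = 0
  · subst hc
    have hd : d ≠ 0 := by simpa using hcd
    exact absurd (by simpa using h) (hfree a' d ha.ne_right hd)
  · refine (indep₂_or (F := F) hc d).resolve_left ?_
    rintro ⟨s, rfl⟩
    refine hfree (a + s • a') c (ha.add_smul s).ne_left hc ?_
    rwa [TensorProduct.add_tmul, TensorProduct.smul_tmul]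

/-- Split by rank-one points: a line of the second or first kind, two points with independent first
factors, a single point, or none. In the last case the line is a linear map from the span of the
first rows to the span of the second rows, both planes in F³. Two planes in F³ meet, so some second
row is again a first row; this starts a chain. -/
theorem line_classification [Finite F] {u v : F} (huv : QuadCond u v)
    {W : Submodule F (V F)} (hW : Module.finrank F W = 2) :
    ∃ o : LineType, PG W ∈ MulAction.orbit (Hbar₂ F) (PG (o.rep u v)) := by
  by_cases h1 : ∃ a b b', a ≠ 0 ∧ Indep₂ F b b' ∧ a ⊗ₜ[F] b ∈ W ∧ a ⊗ₜ[F] b' ∈ W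
  · obtain ⟨a, b, b', ha, hb, hw, hw'⟩ := h1
    obtain ⟨a', ha'⟩ := exists_indep₂ ha
    obtain ⟨c, hc⟩ := exists_indep₃ hb
    exact ⟨.o2, LineType.mem_orbit .o2 hW ha' hc (by simpa [LineType.mat, frameTensor] using hw)
      (by simpa [LineType.mat, frameTensor] using hw')⟩
  by_cases h2 : ∃ a a' b, Indep₂ F a a' ∧ b ≠ 0 ∧ a ⊗ₜ[F] b ∈ W ∧ a' ⊗ₜ[F] b ∈ W
  · obtain ⟨a, a', b, ha, hb, hw, hw'⟩ := h2
    obtain ⟨b', hb'⟩ := exists_indep₂ hb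
    obtain ⟨c, hc⟩ := exists_indep₃ hb'
    exact ⟨.o4T, LineType.mem_orbit .o4T hW ha hc (by simpa [LineType.mat, frameTensor] using hw)
      (by simpa [LineType.mat, frameTensor] using hw')⟩
  by_cases h3 : ∃ a a' b b', Indep₂ F a a' ∧ b ≠ 0 ∧ b' ≠ 0 ∧ a ⊗ₜ[F] b ∈ W ∧ a' ⊗ₜ[F] b' ∈ W
  · obtain ⟨a, a', b, b', ha, hb, hb', hw, hw'⟩ := h3
    rcases indep₂_or (F := F) hb b' with ⟨s, rfl⟩ | hbb
    · have hs : s ≠ 0 := by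
        rintro rfl
        simp at hb'
      rw [TensorProduct.tmul_smul, W.smul_mem_iff hs] at hw'
      exact absurd ⟨a, a', b, ha, hb, hw, hw'⟩ h2
    · obtain ⟨c, hc⟩ := exists_indep₃ hbb
      exact ⟨.o5, LineType.mem_orbit .o5 hW ha hc (by simpa [LineType.mat, frameTensor] using hw)
        (by simpa [LineType.mat, frameTensor] using hw')⟩
  by_cases h4 : ∃ a b, a ≠ 0 ∧ b ≠ 0 ∧ a ⊗ₜ[F] b ∈ W
  · obtain ⟨a, b, ha, hb, hw⟩ := h4
    obtain ⟨a', ha'⟩ := exists_indep₂ ha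
    obtain ⟨w, hw', hn⟩ := exists_mem_not_smul (W := W) (by omega) (a ⊗ₜ[F] b)
    obtain ⟨c, d, rfl⟩ := exists_eq_tmul_add_tmul ha' w
    by_cases hd : d = 0
    · subst hd
      simp only [TensorProduct.tmul_zero, add_zero] at hw' hn
      rcases indep₂_or (F := F) hb c with ⟨s, rfl⟩ | hbc
      · exact absurd (TensorProduct.tmul_smul s a b) (hn s)
      · exact absurd ⟨a, b, c, ha, hbc, hw, hw'⟩ h1
    -- With a ⊗ b the only rank-one point, the second row d of another element decides the type: d
    -- on ⟨b⟩ gives o6, d off ⟨b⟩ gives o7. The remaining positions of c would produce a second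
    -- rank-one point.
    rcases indep₂_or (F := F) hb d with ⟨s, rfl⟩ | hbd
    · have hs : s ≠ 0 := by
        rintro rfl
        simp at hd
      rcases indep₂_or (F := F) hb c with ⟨t, rfl⟩ | hbc
      · have hw2 : a' ⊗ₜ[F] (s • b) ∈ W := by
          have := W.sub_mem hw' (W.smul_mem t hw)
          rwa [TensorProduct.tmul_smul t, add_sub_cancel_left] at this
        exact absurd ⟨a, a', b, s • b, ha', hb, hd, hw, hw2⟩ h3
      · obtain ⟨e, he⟩ := exists_indep₃ hbc
        refine ⟨.o6, LineType.mem_orbit .o6 hW (ha'.smul one_ne_zero hs).symm he ?_ ?_⟩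
        · simpa [LineType.mat, frameTensor, ← TensorProduct.smul_tmul', add_comm] using hw'
        · simpa [LineType.mat, frameTensor] using hw
    · rcases indep₃_or hbd c with ⟨s, t, rfl⟩ | h5
      · have hw2 : (a' + t • a) ⊗ₜ[F] d ∈ W := by
          have := W.sub_mem hw' (W.smul_mem s hw)
          have key : (a' + t • a) ⊗ₜ[F] d =
              a ⊗ₜ[F] (s • b + t • d) + a' ⊗ₜ[F] d - s • a ⊗ₜ[F] b := by
            simp only [TensorProduct.tmul_add, TensorProduct.tmul_smul, TensorProduct.add_tmul,
              ← TensorProduct.smul_tmul']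
            module
          rwa [key]
        exact absurd ⟨a, a' + t • a, b, d, (ha'.symm.add_smul t).symm, hb, hd, hw, hw2⟩ h3
      · refine ⟨.o7, LineType.mem_orbit .o7 hW ha' h5.rotate.rotate ?_ ?_⟩
        · simpa [LineType.mat, frameTensor] using hw'
        · simpa [LineType.mat, frameTensor] using hw
  have hfree : ∀ x y, x ≠ 0 → y ≠ 0 → x ⊗ₜ[F] y ∉ W := fun x y hx hy hxy =>
    h4 ⟨x, y, hx, hy, hxy⟩
  have ha := indep₂_single (F := F)
  generalize (Pi.single 0 1 : Fin 2 → F) = a at ha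
  generalize (Pi.single 1 1 : Fin 2 → F) = a' at ha
  obtain ⟨w₁, hw₁, hw₁0⟩ := exists_mem_not_smul (W := W) (by omega) 0
  have hw₁0 : w₁ ≠ 0 := by simpa using hw₁0
  obtain ⟨w₂, hw₂, hw₂0⟩ := exists_mem_not_smul (W := W) (by omega) w₁
  obtain ⟨c₁, d₁, rfl⟩ := exists_eq_tmul_add_tmul ha w₁
  obtain ⟨c₂, d₂, rfl⟩ := exists_eq_tmul_add_tmul ha w₂
  have hcomb : ∀ s t : F,
      a ⊗ₜ[F] (s • c₁ + t • c₂) + a' ⊗ₜ[F] (s • d₁ + t • d₂) =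
        s • (a ⊗ₜ[F] c₁ + a' ⊗ₜ[F] d₁) + t • (a ⊗ₜ[F] c₂ + a' ⊗ₜ[F] d₂) := by
    intro s t
    simp only [TensorProduct.tmul_add, TensorProduct.tmul_smul]
    module
  have hcombW : ∀ s t : F,
      a ⊗ₜ[F] (s • c₁ + t • c₂) + a' ⊗ₜ[F] (s • d₁ + t • d₂) ∈ W := by
    intro s t
    rw [hcomb]
    exact W.add_mem (W.smul_mem _ hw₁) (W.smul_mem _ hw₂)
  have hwind : Indep₂ F (a ⊗ₜ[F] c₁ + a' ⊗ₜ[F] d₁) (a ⊗ₜ[F] c₂ + a' ⊗ₜ[F] d₂) :=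
    (indep₂_or (F := F) hw₁0 _).resolve_left fun ⟨s, hs⟩ => hw₂0 s hs
  -- A combination of the first rows that vanishes belongs to an element of W with dependent rows,
  -- hence to the zero tensor.
  have hc : Indep₂ F c₁ c₂ := by
    intro s t hst
    apply hwind
    rw [← hcomb]
    by_contra hne
    have h5 := indep₂_of_rank_ne_one ha hfree (hcombW s t) (by
      by_contra! h0
      simp [h0.1, h0.2] at hne)
    exact h5.ne_left hst
  have hcd : Indep₂ F c₁ d₁ := indep₂_of_rank_ne_one ha hfree hw₁ (Or.inl hc.ne_left)
  -- Either d₁ is itself a first row, and the chain starts at c₁; or c₁, c₂, d₁ form a basis, and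
  -- subtracting a multiple of the first tensor from the second removes the d₁ component of d₂, so
  -- that the new second row is a first row.
  rcases indep₃_or hc d₁ with ⟨s, t, hd⟩ | h5
  · refine line_classification_of_chain huv hW ha hfree hcd hw₁ (e := s • d₁ + t • d₂) ?_
    have := hcombW s t
    rwa [← hd] at this
  · obtain ⟨p, q, r, hd₂⟩ := h5.exists_eq_fin d₂
    have h6 : a ⊗ₜ[F] (c₂ - r • c₁) + a' ⊗ₜ[F] (p • c₁ + q • c₂) ∈ W := by
      have := hcombW (-r) 1
      rw [hd₂] at this
      convert this using 3 <;> module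
    have h7 : c₂ - r • c₁ ≠ 0 := by
      intro h0
      have := hc (-r) 1 (by rw [← h0]; module)
      simp at this
    exact line_classification_of_chain huv hW ha hfree
      (indep₂_of_rank_ne_one ha hfree h6 (Or.inl h7)) h6 (hcombW p q)

/-! ### Classification of planes -/

/-- `W` contains a line of the second kind. -/
def HasSecondKind (W : Submodule F (V F)) : Prop :=
  ∃ a b b', a ≠ 0 ∧ Indep₂ F b b' ∧ a ⊗ₜ[F] b ∈ W ∧ a ⊗ₜ[F] b' ∈ W

/-- `W` contains a line of the first kind. -/
def HasFirstKind (W : Submodule F (V F)) : Prop :=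
  ∃ a a' b, Indep₂ F a a' ∧ b ≠ 0 ∧ a ⊗ₜ[F] b ∈ W ∧ a' ⊗ₜ[F] b ∈ W

/-- `W` contains two points of rank one with different first factors. -/
def HasTwoFactors (W : Submodule F (V F)) : Prop :=
  ∃ a a' b b', Indep₂ F a a' ∧ b ≠ 0 ∧ b' ≠ 0 ∧ a ⊗ₜ[F] b ∈ W ∧ a' ⊗ₜ[F] b' ∈ W

theorem Indep₂.exists_basis_change {M : Type*} [AddCommGroup M] [Module F M] {x y : M}
    (h : Indep₂ F x y) {s t : F} (hst : s • x + t • y ≠ 0) :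
    ∃ p q : F, Indep₂ F (s • x + t • y) (p • x + q • y) := by
  by_cases hs : s = 0
  · subst hs
    have ht : t ≠ 0 := by
      rintro rfl
      simp at hst
    refine ⟨1, 0, fun p q hpq => ?_⟩
    obtain ⟨h1, h2⟩ := h q (p * t) (by rw [← hpq]; module)
    exact ⟨(mul_eq_zero.mp h2).resolve_right ht, h1⟩
  · refine ⟨0, 1, fun p q hpq => ?_⟩
    obtain ⟨h1, h2⟩ := h (p * s) (p * t + q) (by rw [← hpq]; module)
    have hp := (mul_eq_zero.mp h1).resolve_right hs
    subst hp
    exact ⟨rfl, by simpa using h2⟩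

/-- Modulo a ⊗ b and a ⊗ b' only a third generator a ⊗ c + a' ⊗ d matters. The case d = 0 gives o3.
If d lies in ⟨b, b'⟩, it can be taken as a basis vector there, and c modulo ⟨b, b'⟩ decides between
o7T and o9. If d lies outside, the generator reduces to a pure tensor (a' + ra) ⊗ d, giving o8. -/
theorem HasSecondKind.classification (u v α β γ : F) {W : Submodule F (V F)}
    (hW : Module.finrank F W = 3) (h : HasSecondKind W) :
    ∃ o : PlaneType, PG W ∈ MulAction.orbit (Hbar₂ F) (PG (o.rep u v α β γ)) := by
  obtain ⟨a, b, b', ha, hb, hw₁, hw₂⟩ := h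
  obtain ⟨a', ha'⟩ := exists_indep₂ ha
  obtain ⟨w, hw, hn⟩ := exists_mem_not_add (W := W) (by omega) (a ⊗ₜ[F] b) (a ⊗ₜ[F] b')
  obtain ⟨c, d, rfl⟩ := exists_eq_tmul_add_tmul ha' w
  by_cases hd : d = 0
  · subst hd
    simp only [TensorProduct.tmul_zero, add_zero] at hw hn
    have h3 : Indep₃ F b b' c := by
      refine (indep₃_or hb c).resolve_left ?_
      rintro ⟨s, t, rfl⟩
      exact hn s t (by simp only [TensorProduct.tmul_add, TensorProduct.tmul_smul])
    refine ⟨.o3, PlaneType.mem_orbit .o3 hW ha' h3 ?_ ?_ ?_⟩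
    · simpa [PlaneType.mat, frameTensor] using hw₁
    · simpa [PlaneType.mat, frameTensor] using hw₂
    · simpa [PlaneType.mat, frameTensor] using hw
  rcases indep₃_or hb d with ⟨s, t, rfl⟩ | h3
  · obtain ⟨p, q, hpq⟩ := hb.exists_basis_change hd
    have h4 : a ⊗ₜ[F] (s • b + t • b') ∈ W := by
      simp only [TensorProduct.tmul_add, TensorProduct.tmul_smul]
      exact W.add_mem (W.smul_mem _ hw₁) (W.smul_mem _ hw₂)
    have h5 : a ⊗ₜ[F] (p • b + q • b') ∈ W := by
      simp only [TensorProduct.tmul_add, TensorProduct.tmul_smul]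
      exact W.add_mem (W.smul_mem _ hw₁) (W.smul_mem _ hw₂)
    generalize s • b + t • b' = d at *
    generalize p • b + q • b' = d' at *
    rcases indep₃_or hpq c with ⟨s', t', rfl⟩ | h6
    · obtain ⟨e, he⟩ := exists_indep₃ hpq
      have h6 : a' ⊗ₜ[F] d ∈ W := by
        have := W.sub_mem hw (W.add_mem (W.smul_mem s' h4) (W.smul_mem t' h5))
        rwa [TensorProduct.tmul_add, TensorProduct.tmul_smul, TensorProduct.tmul_smul,
          add_sub_cancel_left] at this
      refine ⟨.o7T, PlaneType.mem_orbit .o7T hW ha'.symm he ?_ ?_ ?_⟩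
      · simpa [PlaneType.mat, frameTensor] using h4
      · simpa [PlaneType.mat, frameTensor] using h5
      · simpa [PlaneType.mat, frameTensor] using h6
    · refine ⟨.o9, PlaneType.mem_orbit .o9 hW ha'.symm h6 ?_ ?_ ?_⟩
      · simpa [PlaneType.mat, frameTensor] using h4
      · simpa [PlaneType.mat, frameTensor] using h5
      · simpa [PlaneType.mat, frameTensor, add_comm] using hw
  · obtain ⟨s, t, r, rfl⟩ := h3.exists_eq_fin c
    have h4 : (a' + r • a) ⊗ₜ[F] d ∈ W := by
      have := W.sub_mem hw (W.add_mem (W.smul_mem s hw₁) (W.smul_mem t hw₂))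
      have key : (a' + r • a) ⊗ₜ[F] d = a ⊗ₜ[F] (s • b + t • b' + r • d) + a' ⊗ₜ[F] d -
          (s • a ⊗ₜ[F] b + t • a ⊗ₜ[F] b') := by
        simp only [TensorProduct.tmul_add, TensorProduct.tmul_smul, TensorProduct.add_tmul,
          ← TensorProduct.smul_tmul']
        module
      rwa [key]
    refine ⟨.o8, PlaneType.mem_orbit .o8 hW (ha'.symm.add_smul r) h3.rotate.rotate ?_ ?_ ?_⟩
    · simpa [PlaneType.mat, frameTensor] using h4
    · simpa [PlaneType.mat, frameTensor] using hw₁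
    · simpa [PlaneType.mat, frameTensor] using hw₂

/-- Let a ⊗ c + a' ⊗ d be a third generator. If c and d are dependent modulo b, W contains a pure
tensor that shares its first factor with a point of the given line, hence a line of the second kind.
Otherwise b, c, d form a frame, which is the o12 form. -/
theorem HasFirstKind.classification (u v α β γ : F) {W : Submodule F (V F)}
    (hW : Module.finrank F W = 3) (h : HasFirstKind W) (h1 : ¬ HasSecondKind W) :
    ∃ o : PlaneType, PG W ∈ MulAction.orbit (Hbar₂ F) (PG (o.rep u v α β γ)) := by
  obtain ⟨a, a', b, ha, hb, hw₁, hw₂⟩ := h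
  obtain ⟨w, hw, hn⟩ := exists_mem_not_add (W := W) (by omega) (a ⊗ₜ[F] b) (a' ⊗ₜ[F] b)
  obtain ⟨c, d, rfl⟩ := exists_eq_tmul_add_tmul ha w
  rcases indep₂_or (F := F) hb c with ⟨s, rfl⟩ | hbc
  · exfalso
    rcases indep₂_or (F := F) hb d with ⟨t, rfl⟩ | hbd
    · exact hn s t (by simp only [TensorProduct.tmul_smul])
    · refine h1 ⟨a', b, d, ha.ne_right, hbd, hw₂, ?_⟩
      have := W.sub_mem hw (W.smul_mem s hw₁)
      rwa [TensorProduct.tmul_smul, add_sub_cancel_left] at this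
  rcases indep₃_or hbc d with ⟨s, t, rfl⟩ | h3
  · refine absurd ⟨a + t • a', b, c, (ha.add_smul t).ne_left, hbc, ?_, ?_⟩ h1
    · rw [TensorProduct.add_tmul, ← TensorProduct.smul_tmul']
      exact W.add_mem hw₁ (W.smul_mem _ hw₂)
    · have := W.sub_mem hw (W.smul_mem s hw₂)
      have key : (a + t • a') ⊗ₜ[F] c = a ⊗ₜ[F] c + a' ⊗ₜ[F] (s • b + t • c) - s • a' ⊗ₜ[F] b := by
        simp only [TensorProduct.tmul_add, TensorProduct.tmul_smul, TensorProduct.add_tmul,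
          ← TensorProduct.smul_tmul']
        module
      rwa [key]
  · refine ⟨.o12, PlaneType.mem_orbit .o12 hW ha h3.swap ?_ ?_ ?_⟩
    · simpa [PlaneType.mat, frameTensor] using hw
    · simpa [PlaneType.mat, frameTensor] using hw₁
    · simpa [PlaneType.mat, frameTensor] using hw₂

/-- The case of the two-point analysis in which only one row of the third generator leaves ⟨b, b'⟩.
The coefficient z cannot vanish, since then the third tensor would span a line of the second kind
with a ⊗ b; the frame xb' + ye, zb, b' gives o13. -/
theorem mem_orbit_o13 (u v α β γ : F) {W : Submodule F (V F)}
    (hW : Module.finrank F W = 3) (h1 : ¬ HasSecondKind W) {a a' : Fin 2 → F}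
    {b b' e : Fin 3 → F} (ha : Indep₂ F a a') (hb : Indep₃ F b b' e) (hw₁ : a ⊗ₜ[F] b ∈ W)
    (hw₂ : a' ⊗ₜ[F] b' ∈ W) {x y z : F} (hy : y ≠ 0)
    (hw : a ⊗ₜ[F] (x • b' + y • e) + z • a' ⊗ₜ[F] b ∈ W) :
    PG W ∈ MulAction.orbit (Hbar₂ F) (PG (PlaneType.o13.rep u v α β γ)) := by
  by_cases hz : z = 0
  · subst hz
    refine absurd ⟨a, b, x • b' + y • e, ha.ne_left, ?_, hw₁, by simpa using hw⟩ h1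
    intro p q hpq
    obtain ⟨h1, h2, h3⟩ := hb p (q * x) (q * y) (by rw [← hpq]; module)
    exact ⟨h1, (mul_eq_zero.mp h3).resolve_right hy⟩
  · have h3 : Indep₃ F (x • b' + y • e) (z • b) b' := by
      intro p q r hpq
      obtain ⟨h1, h2, h3⟩ := hb (q * z) (p * x + r) (p * y) (by rw [← hpq]; module)
      have hp := (mul_eq_zero.mp h3).resolve_right hy
      subst hp
      exact ⟨rfl, (mul_eq_zero.mp h1).resolve_right hz, by simpa using h2⟩
    refine PlaneType.mem_orbit .o13 hW ha h3 ?_ ?_ ?_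
    · simpa [PlaneType.mat, frameTensor] using hw
    · simpa [PlaneType.mat, frameTensor] using W.smul_mem z hw₁
    · simpa [PlaneType.mat, frameTensor] using hw₂

/-- Here b and b' are independent, since otherwise there is a line of the first kind. Complete them
by e and remove the a ⊗ b and a' ⊗ b' components of a third generator. The number of rows with a
nonzero e component, 0, 1 or 2, then gives o11T, o13 or o14. -/
theorem HasTwoFactors.classification (u v α β γ : F) {W : Submodule F (V F)}
    (hW : Module.finrank F W = 3) (h : HasTwoFactors W) (h1 : ¬ HasSecondKind W)
    (h2 : ¬ HasFirstKind W) :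
    ∃ o : PlaneType, PG W ∈ MulAction.orbit (Hbar₂ F) (PG (o.rep u v α β γ)) := by
  obtain ⟨a, a', b, b', ha, hb, hb', hw₁, hw₂⟩ := h
  rcases indep₂_or (F := F) hb b' with ⟨s, rfl⟩ | hbb
  · have hs : s ≠ 0 := by
      rintro rfl
      simp at hb'
    rw [TensorProduct.tmul_smul, W.smul_mem_iff hs] at hw₂
    exact absurd ⟨a, a', b, ha, hb, hw₁, hw₂⟩ h2
  obtain ⟨e, he⟩ := exists_indep₃ hbb
  obtain ⟨w, hw, hn⟩ := exists_mem_not_add (W := W) (by omega) (a ⊗ₜ[F] b) (a' ⊗ₜ[F] b')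
  obtain ⟨c, d, rfl⟩ := exists_eq_tmul_add_tmul ha w
  obtain ⟨c₁, c₂, c₃, rfl⟩ := he.exists_eq_fin c
  obtain ⟨d₁, d₂, d₃, rfl⟩ := he.exists_eq_fin d
  have hw' : a ⊗ₜ[F] (c₂ • b' + c₃ • e) + a' ⊗ₜ[F] (d₁ • b + d₃ • e) ∈ W := by
    have := W.sub_mem hw (W.add_mem (W.smul_mem c₁ hw₁) (W.smul_mem d₂ hw₂))
    convert this using 1
    simp only [TensorProduct.tmul_add, TensorProduct.tmul_smul]
    module
  by_cases hc₃ : c₃ = 0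
  · subst hc₃
    by_cases hd₃ : d₃ = 0
    · subst hd₃
      simp only [zero_smul, add_zero] at hw'
      by_cases hc₂ : c₂ = 0
      · subst hc₂
        by_cases hd₁ : d₁ = 0
        · subst hd₁
          refine absurd ?_ (hn c₁ d₂)
          simp [TensorProduct.tmul_smul]
        · refine absurd ⟨a', b, b', ha.ne_right, hbb, ?_, hw₂⟩ h1
          rw [← W.smul_mem_iff hd₁]
          simpa using hw'
      by_cases hd₁ : d₁ = 0
      · subst hd₁
        refine absurd ⟨a, b, b', ha.ne_left, hbb, hw₁, ?_⟩ h1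
        rw [← W.smul_mem_iff hc₂]
        simpa using hw'
      have h3 := he.smul hd₁ hc₂ one_ne_zero
      refine ⟨.o11T, PlaneType.mem_orbit .o11T hW ha h3 ?_ ?_ ?_⟩
      · simpa [PlaneType.mat, frameTensor] using W.smul_mem d₁ hw₁
      · simpa [PlaneType.mat, frameTensor] using hw'
      · simpa [PlaneType.mat, frameTensor] using W.smul_mem c₂ hw₂
    · refine ⟨.o13, mem_orbit_o13 u v α β γ hW h1 ha.symm he.swap hw₂ hw₁ hd₃ (x := d₁)
        (z := c₂) ?_⟩
      rw [add_comm]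
      simpa using hw'
  by_cases hd₃ : d₃ = 0
  · subst hd₃
    exact ⟨.o13, mem_orbit_o13 u v α β γ hW h1 ha he hw₁ hw₂ hc₃ (x := c₂) (z := d₁)
      (by simpa using hw')⟩
  · have h3 : Indep₃ F b ((d₁ / d₃) • b + (c₂ / c₃) • b' + e) b' := by
      intro p q r hpq
      obtain ⟨h1, h2, h3⟩ := he (p + q * (d₁ / d₃)) (q * (c₂ / c₃) + r) q (by
        rw [← hpq]; module)
      subst h3
      exact ⟨by simpa using h1, rfl, by simpa using h2⟩
    refine ⟨.o14, PlaneType.mem_orbit .o14 hW (ha.smul hc₃ hd₃) h3 ?_ ?_ ?_⟩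
    · simpa [PlaneType.mat, frameTensor, ← TensorProduct.smul_tmul'] using W.smul_mem c₃ hw₁
    · have := W.add_mem hw' (W.add_mem (W.smul_mem (c₃ * (d₁ / d₃)) hw₁)
        (W.smul_mem (d₃ * (c₂ / c₃)) hw₂))
      have e1 : c₃ * (c₂ / c₃) = c₂ := by field_simp
      have e2 : d₃ * (d₁ / d₃) = d₁ := by field_simp
      convert this using 1
      simp only [PlaneType.mat, frameTensor, Matrix.of_apply, Matrix.cons_val, one_smul, zero_smul,
        zero_add, add_zero, TensorProduct.tmul_add, TensorProduct.tmul_smul,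
        ← TensorProduct.smul_tmul', smul_smul]
      match_scalars <;> first | linear_combination e1 | linear_combination e2 | ring
    · simpa [PlaneType.mat, frameTensor, ← TensorProduct.smul_tmul'] using W.smul_mem d₃ hw₂

/-- A three-dimensional space meeting `⟨a'⟩ ⊗ F^3` trivially is the graph of an endomorphism. -/
theorem exists_graph {W : Submodule F (V F)} (hW : Module.finrank F W = 3) {a a' : Fin 2 → F}
    (ha : Indep₂ F a a') (hinj : ∀ d, a' ⊗ₜ[F] d ∈ W → d = 0) :
    ∃ C : Module.End F (Fin 3 → F), ∀ c, a ⊗ₜ[F] c + a' ⊗ₜ[F] C c ∈ W := by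
  obtain ⟨f, hf, hf'⟩ := ha.exists_dual
  obtain ⟨g, hg, hg'⟩ := ha.symm.exists_dual
  -- Projection to the first row; its kernel consists of the tensors a' ⊗ d in W, so it is
  -- injective, and by dimension bijective. Composing its inverse with the second row gives C.
  let κ : W →ₗ[F] (Fin 3 → F) := (contract f).domRestrict W
  have hκ : Function.Injective κ := by
    rw [injective_iff_map_eq_zero]
    rintro ⟨w, hw⟩ h0
    obtain ⟨c, d, rfl⟩ := exists_eq_tmul_add_tmul ha w
    have hc : c = 0 := by simpa [κ, contract_tmul, hf, hf'] using h0
    subst hc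
    have hd := hinj d (by simpa using hw)
    subst hd
    simp
  have hsurj : Function.Surjective κ := by
    rw [← LinearMap.range_eq_top]
    apply Submodule.eq_top_of_finrank_eq
    rw [LinearMap.finrank_range_of_inj hκ, hW]
    simp
  let e := LinearEquiv.ofBijective κ ⟨hκ,
    hsurj⟩
  refine ⟨contract g ∘ₗ W.subtype ∘ₗ e.symm.toLinearMap, fun c => ?_⟩
  obtain ⟨⟨w, hw⟩, rfl⟩ := e.surjective c
  obtain ⟨c, d, rfl⟩ := exists_eq_tmul_add_tmul ha w
  have h1 : e ⟨_, hw⟩ = c := by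
    change κ ⟨_, hw⟩ = c
    simp [κ, contract_tmul, hf, hf']
  rw [LinearMap.comp_apply, LinearMap.comp_apply, LinearEquiv.coe_coe, e.symm_apply_apply, h1]
  simpa [contract_tmul, hg, hg'] using hw

/-- This turns eigenvectors of C into rank-one points, so restrictions on the rank-one points of W
become restrictions on the spectrum of C. -/
theorem smul_add_tmul_mem {W : Submodule F (V F)} {a a' : Fin 2 → F}
    {C : Module.End F (Fin 3 → F)} (hC : ∀ c, a ⊗ₜ[F] c + a' ⊗ₜ[F] C c ∈ W) {l : F}
    {c : Fin 3 → F} (hc : C c = l • c) : (a + l • a') ⊗ₜ[F] c ∈ W := by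
  have := hC c
  rwa [hc, ← TensorProduct.smul_tmul, ← TensorProduct.add_tmul] at this

/-- The hypotheses leave ⟨a ⊗ b⟩ as the only rank-one point, so the eigenvectors of C are the
nonzero multiples of b, with eigenvalue 0. If b lies in the image of C, then C is a single nilpotent
Jordan block and a chain y, Cy, C²y gives o16. If not, F³ is the direct sum of the image and ⟨b⟩, C
has no eigenvector in the image, and the quadratic normal form there gives o15. -/
theorem singlePoint_classification [Finite F] {u v : F} (huv : QuadCond u v) (α β γ : F)
    {W : Submodule F (V F)} (hW : Module.finrank F W = 3) {a : Fin 2 → F} {b : Fin 3 → F}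
    (ha : a ≠ 0) (hb : b ≠ 0) (hab : a ⊗ₜ[F] b ∈ W) (h1 : ¬ HasSecondKind W)
    (h2 : ¬ HasTwoFactors W) :
    ∃ o : PlaneType, PG W ∈ MulAction.orbit (Hbar₂ F) (PG (o.rep u v α β γ)) := by
  obtain ⟨a', ha'⟩ := exists_indep₂ ha
  have hinj : ∀ d, a' ⊗ₜ[F] d ∈ W → d = 0 := by
    intro d hd
    by_contra hd0
    exact h2 ⟨a, a', b, d, ha', hb, hd0, hab, hd⟩
  obtain ⟨C, hC⟩ := exists_graph hW ha' hinj
  have hCb : C b = 0 := hinj _ (by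
    have := W.sub_mem (hC b) hab
    rwa [add_sub_cancel_left] at this)
  have heig : ∀ (l : F) (c : Fin 3 → F), c ≠ 0 → C c = l • c → l = 0 ∧ ∃ s : F, c = s • b := by
    intro l c hc hCc
    have h3 := smul_add_tmul_mem hC hCc
    have hl : l = 0 := by
      by_contra hl
      refine h2 ⟨a, a + l • a', b, c, ?_, hb, hc, hab, h3⟩
      intro p q hpq
      obtain ⟨e1, e2⟩ := ha' (p + q) (q * l) (by rw [← hpq]; module)
      have hq := (mul_eq_zero.mp e2).resolve_right hl
      subst hq
      exact ⟨by simpa using e1, rfl⟩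
    subst hl
    refine ⟨rfl, (indep₂_or hb c).resolve_right fun hbc => ?_⟩
    exact h1 ⟨a, b, c, ha, hbc, hab, by simpa using h3⟩
  obtain ⟨x, hbx⟩ := exists_indep₂ hb
  obtain ⟨y, hbxy⟩ := exists_indep₃ hbx
  by_cases hrange : ∃ x', C x' = b
  · obtain ⟨x, hx⟩ := hrange
    have hbx : Indep₂ F b x := (indep₂_or hb x).resolve_left (by
      rintro ⟨s, rfl⟩
      rw [map_smul, hCb, smul_zero] at hx
      exact hb hx.symm)
    obtain ⟨y, hbxy⟩ := exists_indep₃ hbx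
    obtain ⟨s, t, r, hCy⟩ := hbxy.exists_eq_fin (C y)
    have hCCy : C (C y) = t • b + r • C y := by
      conv_lhs => rw [hCy]
      simp only [map_add, map_smul, hCb, hx, smul_zero, zero_add]
    have hr : r = 0 := by
      by_contra hr
      -- Since C(Cy) = tb + r Cy, this vector would be an eigenvector with the nonzero eigenvalue r.
      refine hr (heig r (C y + (t / r) • b) ?_ ?_).1
      · intro h0
        rw [hCy] at h0
        have := hbxy (s + t / r) t r (by rw [← h0]; module)
        exact hr this.2.2
      · rw [map_add, map_smul, hCCy, hCb, smul_add, smul_smul, mul_div_cancel₀ _ hr]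
        module
    subst hr
    have ht : t ≠ 0 := by
      rintro rfl
      -- With r = t = 0 one has Cy = sb = C(sx), so y - sx would be a kernel vector outside ⟨b⟩.
      have h0 : C (y - s • x) = (0 : F) • (y - s • x) := by
        rw [map_sub, map_smul, hx, hCy]; module
      obtain ⟨-, k, hk⟩ := heig 0 (y - s • x) (by
        intro h0
        have := hbxy 0 (-s) 1 (by rw [← h0]; module)
        simp at this) h0
      have := hbxy (-k) (-s) 1 (by rw [sub_eq_iff_eq_add] at hk; rw [hk]; module)
      simp at this
    have h3 : Indep₃ F y (C y) (t • b) := by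
      intro p q w hpq
      rw [hCy] at hpq
      obtain ⟨e1, e2, e3⟩ := hbxy (q * s + w * t) (q * t) p (by rw [← hpq]; module)
      have hq := (mul_eq_zero.mp e2).resolve_right ht
      subst hq
      exact ⟨e3, rfl, by simpa [ht] using e1⟩
    refine ⟨.o16, PlaneType.mem_orbit .o16 hW ha' h3 ?_ ?_ ?_⟩
    · simpa [PlaneType.mat, frameTensor] using hC y
    · have := hC (C y)
      rw [hCCy] at this
      simpa [PlaneType.mat, frameTensor] using this
    · simpa [PlaneType.mat, frameTensor] using W.smul_mem t hab
  · have hxy : Indep₃ F (C x) (C y) b := by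
      have h4 : Indep₂ F (C x) (C y) := by
        intro p q hpq
        by_contra hne
        have hne' : p • x + q • y ≠ 0 := fun h0 => by
          have := hbxy 0 p q (by rw [← h0]; module)
          exact hne ⟨this.2.1, this.2.2⟩
        obtain ⟨-, k, hk⟩ := heig 0 (p • x + q • y) hne' (by
          rw [map_add, map_smul, map_smul, hpq, zero_smul])
        have := hbxy (-k) p q (by rw [add_assoc, hk]; module)
        exact hne ⟨this.2.1, this.2.2⟩
      refine (indep₃_or h4 b).resolve_left ?_
      rintro ⟨s, t, h5⟩
      exact hrange ⟨s • x + t • y, by rw [map_add, map_smul, map_smul, ← h5]⟩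
    have himg : ∀ c, ∃ s t : F, C c = s • C x + t • C y := by
      intro c
      obtain ⟨k, s, t, rfl⟩ := hbxy.exists_eq_fin c
      exact ⟨s, t, by simp only [map_add, map_smul, hCb, smul_zero, zero_add]⟩
    have hnoeig : ∀ (l : F) (c : Fin 3 → F), c ≠ 0 → (∃ s t : F, c = s • C x + t • C y) →
        C c ≠ l • c := by
      rintro l c hc ⟨s, t, hst⟩ hCc
      obtain ⟨-, k, hk⟩ := heig l c hc hCc
      have hk0 : -k = 0 := (hxy s t (-k) (by rw [← hst, hk]; module)).2.2
      have : k = 0 := by simpa using hk0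
      subst this
      exact hc (by simpa using hk)
    set r := C x with hr
    have hr0 : r ≠ 0 := hxy.left.ne_left
    have hrs : Indep₂ F r (C r) := by
      refine (indep₂_or hr0 _).resolve_left ?_
      rintro ⟨l, hl⟩
      exact hnoeig l r hr0 ⟨1, 0, by simp⟩ hl
    obtain ⟨s₁, s₂, hs⟩ := himg r
    have hs₂ : s₂ ≠ 0 := by
      rintro rfl
      have := hrs (-s₁) 1 (by rw [hs]; module)
      simp at this
    have hCy : C y = (1 / s₂) • (C r - s₁ • r) := by
      rw [hs, add_sub_cancel_left, smul_smul, one_div_mul_cancel hs₂, one_smul]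
    obtain ⟨p, q, hpq⟩ : ∃ p q : F, C (C r) = p • r + q • C r := by
      obtain ⟨t₁, t₂, ht⟩ := himg (C r)
      refine ⟨t₁ - t₂ * s₁ / s₂, t₂ / s₂, ?_⟩
      rw [ht, hCy]
      module
    have hroot : ∀ l, l ^ 2 - q * l - p ≠ 0 := by
      intro l hl
      -- A root l of the quadratic factors C² - qC - p on r, and this vector of the image would be
      -- an eigenvector with eigenvalue l.
      refine hnoeig l (C r - (q - l) • r) ?_ ⟨s₁ - (q - l), s₂, ?_⟩ ?_
      · intro h0
        have := hrs (-(q - l)) 1 (by rw [← h0]; module)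
        simp at this
      · rw [hs]; module
      · rw [map_sub, map_smul, hpq]
        match_scalars
        · linear_combination -hl
        · ring
    have h3 : Indep₃ F r (C r) b := by
      intro e₁ e₂ e₃ he
      rw [hs] at he
      obtain ⟨g1, g2, g3⟩ := hxy (e₁ + e₂ * s₁) (e₂ * s₂) e₃ (by rw [← he]; module)
      have he₂ := (mul_eq_zero.mp g2).resolve_right hs₂
      subst he₂
      exact ⟨by simpa using g1, rfl, g3⟩
    obtain ⟨m, n, hn, h4, h5⟩ := exists_quadratic_normal_form huv hroot W a a' r (C r) (hC r)
      (by rw [← hpq]; exact hC (C r))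
    refine ⟨.o15, PlaneType.mem_orbit .o15 hW (indep₂_quadratic_normal_form hn m ha')
      (indep₃_quadratic_normal_form (m := m) huv.1 hn h3) ?_ ?_ ?_⟩
    · simpa [PlaneType.mat, frameTensor] using h4
    · simpa [PlaneType.mat, frameTensor] using h5
    · simpa [PlaneType.mat, frameTensor] using hab

theorem CubicCond.ne_zero {α β γ : F} (h : CubicCond α β γ) (x : F) :
    x ^ 3 - γ * x ^ 2 - β * x - α ≠ 0 := fun hx => h (-x) (by linear_combination -hx)

open Polynomial in
-- C has no eigenvalue, so its cubic characteristic polynomial is irreducible and F³ becomes a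
-- one-dimensional space over K = F[C], with C acting as multiplication by θ. The prescribed cubic,
-- after a sign change of the variable, has a root η in K. A change of frame of F² replaces θ by the
-- fractional linear expression η of θ, and in the basis 1, η, η² multiplication by η has the o17
-- form.
theorem free_classification [Finite F] (u v : F) {α β γ : F} (habc : CubicCond α β γ)
    {W : Submodule F (V F)} (hW : Module.finrank F W = 3)
    (hfree : ∀ x y, x ≠ 0 → y ≠ 0 → x ⊗ₜ[F] y ∉ W) :
    ∃ o : PlaneType, PG W ∈ MulAction.orbit (Hbar₂ F) (PG (o.rep u v α β γ)) := by
  have ha := indep₂_single (F := F)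
  generalize (Pi.single 0 1 : Fin 2 → F) = a at ha
  generalize (Pi.single 1 1 : Fin 2 → F) = a' at ha
  obtain ⟨C, hC⟩ := exists_graph hW ha fun d hd => by
    by_contra hd0
    exact hfree _ _ ha.ne_right hd0 hd
  have heig : ∀ (l : F) (c : Fin 3 → F), c ≠ 0 → C c ≠ l • c := fun l c hc hl =>
    hfree _ _ (ha.add_smul l).ne_left hc (smul_add_tmul_mem hC hl)
  have hdeg : C.charpoly.natDegree = 3 := by
    rw [LinearMap.charpoly_natDegree]; simp
  have hirr : Irreducible C.charpoly := by
    apply irreducible_of_degree_le_three_of_not_isRoot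
    · rw [hdeg]; simp
    · intro l hl
      rw [← Module.End.hasEigenvalue_iff_isRoot_charpoly] at hl
      obtain ⟨c, hc⟩ := hl.exists_hasEigenvector
      exact heig l c hc.2 hc.apply_eq_smul
  obtain ⟨r, hr⟩ := exists_ne (0 : Fin 3 → F)
  obtain ⟨ψ, hψ, hψC⟩ := exists_linearMap_adjoinRoot C hirr hr (by
    rw [LinearMap.aeval_self_charpoly]; simp)
  have : Fact (Irreducible C.charpoly) := ⟨hirr⟩
  have hK := finrank_adjoinRoot hirr.ne_zero
  rw [hdeg] at hK
  have : FiniteDimensional F (AdjoinRoot C.charpoly) := Module.finite_of_finrank_eq_succ hK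
  set θ := AdjoinRoot.root C.charpoly
  have hg := irreducible_cubic habc.ne_zero
  obtain ⟨η, hη⟩ := exists_root_of_natDegree_eq_finrank (K := AdjoinRoot C.charpoly) hg
    (by rw [natDegree_cubic, hK])
  have hη3 : η ^ 3 = γ • η ^ 2 + β • η + α • 1 := by
    simp only [map_sub, map_pow, map_mul, aeval_X, aeval_C] at hη
    simp only [Algebra.smul_def]
    linear_combination hη
  -- A quadratic relation for η would be divisible by its irreducible cubic, so 1, η, η² are
  -- independent.
  have hpoly : ∀ s t w : F, s • (1 : AdjoinRoot C.charpoly) + t • η + w • η ^ 2 = 0 →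
      s = 0 ∧ t = 0 ∧ w = 0 := by
    intro s t w h0
    have h1 : aeval η (Polynomial.C s + Polynomial.C t * X + Polynomial.C w * X ^ 2) = 0 := by
      simpa [Algebra.smul_def] using h0
    rw [hg.dvd_iff_aeval_eq_zero hη] at h1
    have h2 : (Polynomial.C s + Polynomial.C t * X + Polynomial.C w * X ^ 2 : F[X]) = 0 := by
      by_contra hne
      have h3 := natDegree_le_of_dvd h1 hne
      rw [natDegree_cubic] at h3
      have h4 : (Polynomial.C s + Polynomial.C t * X + Polynomial.C w * X ^ 2 : F[X]).natDegree
          ≤ 2 := by compute_degree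
      omega
    have h3 := fun n => congrArg (fun p : F[X] => p.coeff n) h2
    refine ⟨?_, ?_, ?_⟩
    · simpa using h3 0
    · simpa [coeff_X, coeff_C] using h3 1
    · simpa [coeff_X, coeff_C] using h3 2
  have hη' : ∀ x, η ≠ algebraMap F _ x := by
    intro x hx
    have := hpoly (-x) 1 0 (by rw [hx, Algebra.algebraMap_eq_smul_one]; module)
    simp at this
  have hθ' : ∀ x, θ ≠ algebraMap F _ x := by
    intro x hx
    refine heig x (ψ 1) (fun h => one_ne_zero (hψ (h.trans (map_zero ψ).symm))) ?_
    rw [← hψC, ← map_smul]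
    congr 1
    rw [← Algebra.algebraMap_eq_smul_one, ← hx, mul_one]
  obtain ⟨t₀, t₁, s₀, s₁, hdet, hmoeb⟩ := exists_moebius hK hθ' hη'
  set D := t₀ * s₁ - t₁ * s₀ with hD
  have hne : algebraMap F (AdjoinRoot C.charpoly) t₀ + algebraMap F _ t₁ * θ ≠ 0 := by
    intro h0
    have ht₁ : t₁ = 0 := by
      by_contra ht₁
      apply hθ' (-t₀ / t₁)
      have : algebraMap F (AdjoinRoot C.charpoly) t₁ ≠ 0 := by simpa using ht₁
      rw [map_div₀, map_neg]
      field_simp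
      linear_combination h0
    subst ht₁
    have ht₀ : t₀ = 0 := by simpa using h0
    subst ht₀
    simp [hD] at hdet
  -- The two new vectors of F² come from inverting the matrix of the fractional linear map: for x =
  -- (t₀ + t₁θ)y one has ηx = -(s₀ + s₁θ)y, the mixed terms cancel, and the sum is a ⊗ ψ(y) + a' ⊗ C
  -- ψ(y).
  have key : ∀ x : AdjoinRoot C.charpoly, (D⁻¹ • (s₁ • a - s₀ • a')) ⊗ₜ[F] ψ x +
      (D⁻¹ • (t₁ • a - t₀ • a')) ⊗ₜ[F] ψ (η * x) ∈ W := by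
    intro x
    obtain ⟨y, rfl⟩ : ∃ y, x = (algebraMap F _ t₀ + algebraMap F _ t₁ * θ) * y :=
      ⟨(algebraMap F _ t₀ + algebraMap F _ t₁ * θ)⁻¹ * x, by rw [mul_inv_cancel_left₀ hne]⟩
    have e1 : (algebraMap F _ t₀ + algebraMap F _ t₁ * θ) * y = t₀ • y + t₁ • (θ * y) := by
      simp only [Algebra.smul_def]; ring
    have e2 : η * ((algebraMap F _ t₀ + algebraMap F _ t₁ * θ) * y) =
        -(s₀ • y + s₁ • (θ * y)) := by
      simp only [Algebra.smul_def]
      linear_combination y * hmoeb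
    rw [e2, e1, map_neg, map_add, map_add, map_smul, map_smul, map_smul, map_smul, hψC]
    have e3 : D⁻¹ * (t₀ * s₁ - t₁ * s₀) = 1 := inv_mul_cancel₀ hdet
    convert hC (ψ y) using 1
    simp only [TensorProduct.tmul_add, TensorProduct.tmul_smul, TensorProduct.sub_tmul,
      TensorProduct.tmul_neg, ← TensorProduct.smul_tmul']
    match_scalars
    · linear_combination e3
    · ring
    · ring
    · linear_combination e3
  have ha2 : Indep₂ F (D⁻¹ • (s₁ • a - s₀ • a')) (D⁻¹ • (t₁ • a - t₀ • a')) := by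
    intro p q hpq
    obtain ⟨e1, e2⟩ := ha (D⁻¹ * (p * s₁ + q * t₁)) (-D⁻¹ * (p * s₀ + q * t₀))
      (by rw [← hpq]; module)
    have hD' := inv_ne_zero hdet
    have e1 := (mul_eq_zero.mp e1).resolve_left hD'
    have e2 := (mul_eq_zero.mp e2).resolve_left (neg_ne_zero.mpr hD')
    constructor
    · apply (mul_eq_zero.mp _).resolve_right hdet
      linear_combination t₀ * e1 - t₁ * e2
    · apply (mul_eq_zero.mp _).resolve_right hdet
      linear_combination s₁ * e2 - s₀ * e1
  have hb : Indep₃ F (ψ 1) (ψ η) (ψ (η ^ 2)) := by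
    intro s t w h0
    rw [← map_smul, ← map_smul, ← map_smul, ← map_add, ← map_add] at h0
    exact hpoly s t w (hψ (h0.trans (map_zero ψ).symm))
  refine ⟨.o17, PlaneType.mem_orbit .o17 hW ha2 hb ?_ ?_ ?_⟩
  · have := key 1
    rw [mul_one] at this
    simpa only [PlaneType.mat, frameTensor, Matrix.of_apply, Matrix.cons_val, one_smul, zero_smul,
      zero_add, add_zero, mul_zero] using this
  · have := key η
    rw [← sq] at this
    simpa only [PlaneType.mat, frameTensor, Matrix.of_apply, Matrix.cons_val, one_smul, zero_smul,
      zero_add, add_zero, mul_zero] using this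
  · have := key (η ^ 2)
    rw [← pow_succ', hη3, map_add, map_add, map_smul, map_smul, map_smul] at this
    have e : γ • ψ (η ^ 2) + β • ψ η + α • ψ 1 = α • ψ 1 + β • ψ η + γ • ψ (η ^ 2) := by abel
    rw [e] at this
    simpa only [PlaneType.mat, frameTensor, Matrix.of_apply, Matrix.cons_val, one_smul, zero_smul,
      zero_add, add_zero, mul_zero, mul_one] using this

theorem plane_classification [Finite F] {u v α β γ : F} (huv : QuadCond u v)
    (habc : CubicCond α β γ) {W : Submodule F (V F)} (hW : Module.finrank F W = 3) :
    ∃ o : PlaneType, PG W ∈ MulAction.orbit (Hbar₂ F) (PG (o.rep u v α β γ)) := by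
  by_cases h1 : HasSecondKind W
  · exact h1.classification u v α β γ hW
  by_cases h2 : HasFirstKind W
  · exact h2.classification u v α β γ hW h1
  by_cases h3 : HasTwoFactors W
  · exact h3.classification u v α β γ hW h1 h2
  by_cases h4 : ∃ a b, a ≠ 0 ∧ b ≠ 0 ∧ a ⊗ₜ[F] b ∈ W
  · obtain ⟨a, b, ha, hb, hab⟩ := h4
    exact singlePoint_classification huv α β γ hW ha hb hab h1 h3
  · exact free_classification u v habc hW fun x y hx hy hxy => h4 ⟨x, y, hx, hy, hxy⟩

/-! ### Points of rank one in a subspace -/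

theorem mem_PG_inter_segreVariety {W : Submodule F (V F)} {p : ℙ F (V F)} :
    p ∈ PG W ∩ segreVariety F ↔ ∃ (a : Fin 2 → F) (b : Fin 3 → F) (ha : a ≠ 0) (hb : b ≠ 0),
      a ⊗ₜ[F] b ∈ W ∧ p = .mk F (a ⊗ₜ b) (tmul_ne_zero ha hb) := by
  rw [Set.mem_inter_iff, mem_segreVariety]
  constructor
  · rintro ⟨hp, a, b, ha, hb, rfl⟩
    exact ⟨a, b, ha, hb, hp, rfl⟩
  · rintro ⟨a, b, ha, hb, hW, rfl⟩
    exact ⟨hW, a, b, ha, hb, rfl⟩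

theorem tmul_eq_iff {a : Fin 2 → F} {b : Fin 3 → F} {w : V F} :
    a ⊗ₜ[F] b = w ↔ ∀ i j, a i * b j = coord i j w := by
  rw [← (tensorEquiv F).symm.injective.eq_iff, ← Matrix.ext_iff]
  refine forall_congr' fun i => forall_congr' fun j => ?_
  change coord i j (a ⊗ₜ[F] b) = coord i j w ↔ _
  rw [coord_tmul]

theorem mk_tmul_eq {a a' : Fin 2 → F} {b b' : Fin 3 → F} (ha : a ≠ 0) (hb : b ≠ 0) (ha' : a' ≠ 0)
    (hb' : b' ≠ 0) (h : ∃ s : F, a = s • a') (h' : ∃ t : F, b = t • b') :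
    Projectivization.mk F (a ⊗ₜ[F] b) (tmul_ne_zero ha hb) =
      .mk F (a' ⊗ₜ[F] b') (tmul_ne_zero ha' hb') := by
  obtain ⟨s, rfl⟩ := h
  obtain ⟨t, rfl⟩ := h'
  rw [Projectivization.mk_eq_mk_iff']
  exact ⟨t * s, by rw [TensorProduct.tmul_smul, ← TensorProduct.smul_tmul', smul_smul]⟩

theorem mk_tmul_inj {a a' : Fin 2 → F} {b b' : Fin 3 → F} (ha : a ≠ 0) (hb : b ≠ 0) (ha' : a' ≠ 0)
    (hb' : b' ≠ 0) (h : Projectivization.mk F (a ⊗ₜ[F] b) (tmul_ne_zero ha hb) =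
      .mk F (a' ⊗ₜ[F] b') (tmul_ne_zero ha' hb')) : (∃ s : F, a = s • a') ∧ ∃ t : F, b = t • b' := by
  rw [Projectivization.mk_eq_mk_iff'] at h
  obtain ⟨c, hc⟩ := h
  exact exists_smul_of_tmul_eq hc.symm ha hb

theorem Indep₂.ne_smul {M : Type*} [AddCommGroup M] [Module F M] {x y : M} (h : Indep₂ F x y)
    (s : F) : x ≠ s • y := fun hxy => by
  have := h 1 (-s) (by rw [hxy]; module)
  simp at this

theorem not_indep₂_of_smul {M : Type*} [AddCommGroup M] [Module F M] {x y z : M} {s t : F}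
    (hx : x = s • z) (hy : y = t • z) : ¬ Indep₂ F x y := fun h => by
  have h1 := h t (-s) (by rw [hx, hy]; module)
  have hs : s = 0 := by simpa using h1.2
  exact h.ne_left (by rw [hx, hs, zero_smul])

/-- The points of rank one of `PG(W)` are the `n` points `⟨a k ⊗ b k⟩`, with pairwise independent
factors. -/
structure RankOnePoints (W : Submodule F (V F)) {n : ℕ} (a : Fin n → Fin 2 → F)
    (b : Fin n → Fin 3 → F) : Prop where
  left_ne : ∀ k, a k ≠ 0
  right_ne : ∀ k, b k ≠ 0
  left_indep : ∀ k l, k ≠ l → Indep₂ F (a k) (a l)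
  right_indep : ∀ k l, k ≠ l → Indep₂ F (b k) (b l)
  mem : ∀ k, a k ⊗ₜ[F] b k ∈ W
  eq : ∀ x y, x ≠ 0 → y ≠ 0 → x ⊗ₜ[F] y ∈ W →
    ∃ k, (∃ s : F, x = s • a k) ∧ ∃ t : F, y = t • b k

section

variable {W : Submodule F (V F)} {n : ℕ} {a : Fin n → Fin 2 → F} {b : Fin n → Fin 3 → F}

theorem RankOnePoints.ncard (h : RankOnePoints W a b) : (PG W ∩ segreVariety F).ncard = n := by
  have h1 : PG W ∩ segreVariety F = Set.range fun k =>
      Projectivization.mk F (a k ⊗ₜ[F] b k) (tmul_ne_zero (h.left_ne k) (h.right_ne k)) := by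
    ext p
    rw [mem_PG_inter_segreVariety]
    constructor
    · rintro ⟨x, y, hx, hy, hW, rfl⟩
      obtain ⟨k, hk, hk'⟩ := h.eq x y hx hy hW
      exact ⟨k, (mk_tmul_eq hx hy (h.left_ne k) (h.right_ne k) hk hk').symm⟩
    · rintro ⟨k, rfl⟩
      exact ⟨a k, b k, h.left_ne k, h.right_ne k, h.mem k, rfl⟩
  rw [h1, Set.ncard_range_of_injective]
  · simp
  · intro k l hkl
    by_contra hne
    obtain ⟨⟨s, hs⟩, -⟩ := mk_tmul_inj (h.left_ne k) (h.right_ne k) (h.left_ne l) (h.right_ne l) hkl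
    exact (h.left_indep k l hne).ne_smul s hs

theorem RankOnePoints.inter_eq_empty {a : Fin 0 → Fin 2 → F} {b : Fin 0 → Fin 3 → F}
    (h : RankOnePoints W a b) : PG W ∩ segreVariety F = ∅ := by
  rw [Set.eq_empty_iff_forall_notMem]
  intro p hp
  obtain ⟨x, y, hx, hy, hW, rfl⟩ := mem_PG_inter_segreVariety.mp hp
  exact (h.eq x y hx hy hW).choose.elim0

/-- Two points on a line of the second kind share their first factor, hence have the same index k,
and their second factors are then proportional. -/
theorem RankOnePoints.not_hasSecondKind (h : RankOnePoints W a b) : ¬ HasSecondKind W := by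
  rintro ⟨x, y, y', hx, hy, hw, hw'⟩
  obtain ⟨k, ⟨s, hs⟩, t, ht⟩ := h.eq x y hx hy.ne_left hw
  obtain ⟨l, ⟨s', hs'⟩, t', ht'⟩ := h.eq x y' hx hy.ne_right hw'
  by_cases hkl : k = l
  · subst hkl
    exact not_indep₂_of_smul ht ht' hy
  · obtain ⟨e1, -⟩ := h.left_indep k l hkl s (-s') (by rw [← hs, neg_smul, ← hs']; abel)
    exact hx (by rw [hs, e1, zero_smul])

theorem RankOnePoints.not_hasFirstKind (h : RankOnePoints W a b) : ¬ HasFirstKind W := by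
  rintro ⟨x, x', y, hx, hy, hw, hw'⟩
  obtain ⟨k, ⟨s, hs⟩, t, ht⟩ := h.eq x y hx.ne_left hy hw
  obtain ⟨l, ⟨s', hs'⟩, t', ht'⟩ := h.eq x' y hx.ne_right hy hw'
  by_cases hkl : k = l
  · subst hkl
    exact not_indep₂_of_smul hs hs' hx
  · obtain ⟨e1, -⟩ := h.right_indep k l hkl t (-t') (by rw [← ht, neg_smul, ← ht']; abel)
    exact hy (by rw [ht, e1, zero_smul])

theorem isFirstKindLine_inter {b₀ : Fin 3 → F} (hb₀ : b₀ ≠ 0)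
    (hmem : ∀ x, x ⊗ₜ[F] b₀ ∈ W)
    (heq : ∀ x y, x ≠ 0 → y ≠ 0 → x ⊗ₜ[F] y ∈ W → ∃ t : F, y = t • b₀) :
    IsFirstKindLine (PG W ∩ segreVariety F) := by
  refine ⟨.mk F b₀ hb₀, ?_⟩
  ext p
  rw [mem_PG_inter_segreVariety]
  constructor
  · rintro ⟨x, y, hx, hy, hW, rfl⟩
    exact ⟨.mk F x hx, by
      simp only [segre_mk]
      exact (mk_tmul_eq hx hy hx hb₀ ⟨1, (one_smul _ _).symm⟩ (heq x y hx hy hW)).symm⟩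
  · rintro ⟨x, rfl⟩
    induction x with | h x hx =>
    exact ⟨x, b₀, hx, hb₀, hmem x, segre_mk _ _⟩

end

theorem finrank_span_pair {M : Type*} [AddCommGroup M] [Module F M] {x y : M}
    (h : Indep₂ F x y) : Module.finrank F (Submodule.span F {x, y}) = 2 := by
  have := finrank_span_eq_card h.linearIndependent
  rw [Matrix.range_cons_cons_empty] at this
  simpa using this

/-- The line of the second kind `PG(⟨a⟩ ⊗ ⟨b, b'⟩)`. -/
def secondKindLine {a : Fin 2 → F} (ha : a ≠ 0) (b b' : Fin 3 → F) : Set (ℙ F (V F)) :=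
  segre (.mk F a ha) '' PG (Submodule.span F {b, b'})

theorem isSecondKindLine_secondKindLine {a : Fin 2 → F} (ha : a ≠ 0) {b b' : Fin 3 → F}
    (hb : Indep₂ F b b') : IsSecondKindLine (secondKindLine ha b b') :=
  ⟨_, _, ⟨_, finrank_span_pair hb, rfl⟩, rfl⟩

theorem mem_secondKindLine {a : Fin 2 → F} (ha : a ≠ 0) {b b' : Fin 3 → F} {p : ℙ F (V F)} :
    p ∈ secondKindLine ha b b' ↔ ∃ (s t : F) (h : s • b + t • b' ≠ 0),
      p = .mk F (a ⊗ₜ (s • b + t • b')) (tmul_ne_zero ha h) := by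
  constructor
  · rintro ⟨y, hy, rfl⟩
    induction y with | h y hy0 =>
    obtain ⟨s, t, rfl⟩ := Submodule.mem_span_pair.mp hy
    exact ⟨s, t, hy0, segre_mk _ _⟩
  · rintro ⟨s, t, h, rfl⟩
    exact ⟨.mk F _ h, Submodule.mem_span_pair.mpr ⟨s, t, rfl⟩, segre_mk _ _⟩

theorem mk_mem_secondKindLine {a x : Fin 2 → F} (ha : a ≠ 0) {b b' y : Fin 3 → F} (hx : x ≠ 0)
    (hy : y ≠ 0) (h : ∃ s : F, x = s • a) (h' : ∃ s t : F, y = s • b + t • b') :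
    Projectivization.mk F (x ⊗ₜ[F] y) (tmul_ne_zero hx hy) ∈ secondKindLine ha b b' := by
  obtain ⟨s, t, rfl⟩ := h'
  rw [mem_secondKindLine]
  exact ⟨s, t, hy, mk_tmul_eq hx hy ha hy h ⟨1, (one_smul _ _).symm⟩⟩

theorem secondKindLine_subset {W : Submodule F (V F)} {a : Fin 2 → F} (ha : a ≠ 0)
    {b b' : Fin 3 → F} (h : a ⊗ₜ[F] b ∈ W) (h' : a ⊗ₜ[F] b' ∈ W) :
    secondKindLine ha b b' ⊆ PG W ∩ segreVariety F := by
  intro p hp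
  obtain ⟨s, t, h0, rfl⟩ := (mem_secondKindLine ha).mp hp
  refine mem_PG_inter_segreVariety.mpr ⟨_, _, ha, h0, ?_, rfl⟩
  rw [TensorProduct.tmul_add, TensorProduct.tmul_smul, TensorProduct.tmul_smul]
  exact W.add_mem (W.smul_mem _ h) (W.smul_mem _ h')

theorem isSecondKindLine_inter {W : Submodule F (V F)} {a : Fin 2 → F} (ha : a ≠ 0)
    {b b' : Fin 3 → F} (hb : Indep₂ F b b') (h : a ⊗ₜ[F] b ∈ W) (h' : a ⊗ₜ[F] b' ∈ W)
    (heq : ∀ x y, x ≠ 0 → y ≠ 0 → x ⊗ₜ[F] y ∈ W →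
      (∃ s : F, x = s • a) ∧ ∃ s t : F, y = s • b + t • b') :
    IsSecondKindLine (PG W ∩ segreVariety F) := by
  have : PG W ∩ segreVariety F = secondKindLine ha b b' := by
    refine Set.Subset.antisymm ?_ (secondKindLine_subset ha h h')
    intro p hp
    obtain ⟨x, y, hx, hy, hW, rfl⟩ := mem_PG_inter_segreVariety.mp hp
    exact mk_mem_secondKindLine ha hx hy (heq x y hx hy hW).1 (heq x y hx hy hW).2
  rw [this]
  exact isSecondKindLine_secondKindLine ha hb

/-! ### Minimal Segre varieties -/

/-- The coordinate subspace spanned by the basis vectors with index in `J`. -/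
def stdSub (F : Type*) [Field F] {n : ℕ} (J : Finset (Fin n)) : Submodule F (Fin n → F) :=
  Submodule.span F (Set.range fun j : J => (Pi.single j.1 1 : Fin n → F))

theorem finrank_stdSub {n : ℕ} (J : Finset (Fin n)) : Module.finrank F (stdSub F J) = J.card := by
  have h := (Pi.basisFun F (Fin n)).linearIndependent.comp (fun j : J => j.1)
    Subtype.val_injective
  have h2 : (fun j : J => (Pi.single j.1 1 : Fin n → F)) =
      (Pi.basisFun F (Fin n)) ∘ fun j : J => j.1 := by
    ext j; simp
  rw [stdSub, h2, finrank_span_eq_card h, Fintype.card_coe]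

theorem stdSub_le {n : ℕ} {J : Finset (Fin n)} {B : Submodule F (Fin n → F)} :
    stdSub F J ≤ B ↔ ∀ j ∈ J, Pi.single j 1 ∈ B := by
  rw [stdSub, Submodule.span_le, Set.range_subset_iff]
  simp

theorem single_mem_stdSub {n : ℕ} {J : Finset (Fin n)} {j : Fin n} (hj : j ∈ J) :
    Pi.single j 1 ∈ stdSub F J := stdSub_le.mp le_rfl j hj

theorem PG_subset_iff {W W' : Submodule F (V F)} : PG W ⊆ PG W' ↔ W ≤ W' := by
  constructor
  · intro h w hw
    by_cases h0 : w = 0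
    · rw [h0]; exact W'.zero_mem
    · exact (mk_mem_PG h0).mp (h ((mk_mem_PG h0).mpr hw))
  · intro h p hp
    exact mem_PG.mpr (h (mem_PG.mp hp))

/-- The condition is linear in w, and for a pure tensor a ⊗ b the row is aᵢ b. -/
theorem row_mem_of_mem_tensorSub {A : Submodule F (Fin 2 → F)} {B : Submodule F (Fin 3 → F)}
    {w : V F} (hw : w ∈ tensorSub A B) (i : Fin 2) : (fun j => coord i j w) ∈ B := by
  have h : tensorSub A B ≤ B.comap (LinearMap.pi fun j => coord i j) := by
    rw [Submodule.map₂_le]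
    intro a _ b hb
    have : (LinearMap.pi fun j => coord i j) (a ⊗ₜ[F] b) = a i • b := by
      ext j; simp [coord_tmul]
    rw [Submodule.mem_comap, TensorProduct.mk_apply, this]
    exact B.smul_mem _ hb
  exact h hw

theorem col_mem_of_mem_tensorSub {A : Submodule F (Fin 2 → F)} {B : Submodule F (Fin 3 → F)}
    {w : V F} (hw : w ∈ tensorSub A B) (j : Fin 3) : (fun i => coord i j w) ∈ A := by
  have h : tensorSub A B ≤ A.comap (LinearMap.pi fun i => coord i j) := by
    rw [Submodule.map₂_le]
    intro a ha b _
    have : (LinearMap.pi fun i => coord i j) (a ⊗ₜ[F] b) = b j • a := by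
      ext i; simp [coord_tmul, mul_comm]
    rw [Submodule.mem_comap, TensorProduct.mk_apply, this]
    exact A.smul_mem _ ha
  exact h hw

/-- The smallest A and B are spanned by the columns and the rows of the elements of W. For the
representatives these are coordinate subspaces: zero entries bound them from above, and unit vectors
occurring as columns or rows bound them from below. -/
theorem hasMinSegre_PG {ι : Type*} {W : Submodule F (V F)} {M : ι → Matrix (Fin 2) (Fin 3) F}
    (hM : ∀ t, t ∈ W ↔ ∃ p, t = tensor (M p)) (I : Finset (Fin 2)) (J : Finset (Fin 3))
    (h0 : ∀ p i j, i ∉ I ∨ j ∉ J → M p i j = 0)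
    (hI : ∀ i ∈ I, ∃ p j, ∀ i', M p i' j = Pi.single (M := fun _ => F) i 1 i')
    (hJ : ∀ j ∈ J, ∃ p i, ∀ j', M p i j' = Pi.single (M := fun _ => F) j 1 j') :
    HasMinSegre (PG W) (I.card, J.card) := by
  refine ⟨stdSub F I, stdSub F J, finrank_stdSub I, finrank_stdSub J, ?_, ?_⟩
  · rw [PG_subset_iff]
    intro w hw
    obtain ⟨p, rfl⟩ := (hM w).mp hw
    rw [tensor]
    refine Submodule.sum_mem _ fun i _ => Submodule.sum_mem _ fun j _ => ?_
    by_cases hij : i ∈ I ∧ j ∈ J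
    · exact Submodule.smul_mem _ _ (Submodule.apply_mem_map₂ _ (single_mem_stdSub hij.1)
        (single_mem_stdSub hij.2))
    · rw [h0 p i j (by tauto), zero_smul]
      exact Submodule.zero_mem _
  · intro A' B' hW
    have hW' : W ≤ tensorSub A' B' := PG_subset_iff.mp hW
    rw [stdSub_le, stdSub_le]
    constructor
    · intro i hi
      obtain ⟨p, j, hp⟩ := hI i hi
      convert col_mem_of_mem_tensorSub (hW' ((hM _).mpr ⟨p, rfl⟩)) j using 1
      ext i'
      rw [coord_tensor, hp]
    · intro j hj
      obtain ⟨p, i, hp⟩ := hJ j hj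
      convert row_mem_of_mem_tensorSub (hW' ((hM _).mpr ⟨p, rfl⟩)) i using 1
      ext j'
      rw [coord_tensor, hp]

/-! ### Minimal Segre varieties of the representatives -/

theorem PointType.hasMinSegre_rep (o : PointType) : HasMinSegre (PG (o.rep F)) o.minDims := by
  have hM := (o.span_spec (F := F)).1
  cases o
  · refine hasMinSegre_PG hM {0} {0} ?_ ?_ ?_ <;>
      simp only [Finset.mem_singleton, forall_eq]
    · simp [Fin.forall_fin_succ, mat]
    · exact ⟨1, 0, by simp [mat, Fin.forall_fin_succ]⟩
    · exact ⟨1, 0, by simp [mat, Fin.forall_fin_succ]⟩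
  · refine hasMinSegre_PG hM {0, 1} {0, 1} ?_ ?_ ?_ <;>
      simp only [Finset.mem_insert, Finset.mem_singleton, forall_eq_or_imp, forall_eq]
    · simp [Fin.forall_fin_succ, mat]
    · exact ⟨⟨1, 0, by simp [mat, Fin.forall_fin_succ]⟩,
        ⟨1, 1, by simp [mat, Fin.forall_fin_succ]⟩⟩
    · exact ⟨⟨1, 0, by simp [mat, Fin.forall_fin_succ]⟩,
        ⟨1, 1, by simp [mat, Fin.forall_fin_succ]⟩⟩

theorem LineType.hasMinSegre_rep {u v : F} (hv : v ≠ 0) (o : LineType) :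
    HasMinSegre (PG (o.rep u v)) o.minDims := by
  have hM : ∀ t, t ∈ o.rep u v ↔ ∃ p : F × F, t = tensor (o.mat u v p.1 p.2) := fun t => by
    rw [(o.span_spec u v).1, Prod.exists]
  cases o
  · refine hasMinSegre_PG hM {0} {0, 1} ?_ ?_ ?_ <;>
      simp only [Finset.mem_insert, Finset.mem_singleton, forall_eq_or_imp, forall_eq]
    · simp [Fin.forall_fin_succ, mat]
    · exact ⟨(1, 0), 0, by simp [mat, Fin.forall_fin_succ]⟩
    · exact ⟨⟨(1, 0), 0, by simp [mat, Fin.forall_fin_succ]⟩,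
        ⟨(0, 1), 0, by simp [mat, Fin.forall_fin_succ]⟩⟩
  · refine hasMinSegre_PG hM {0, 1} {0} ?_ ?_ ?_ <;>
      simp only [Finset.mem_insert, Finset.mem_singleton, forall_eq_or_imp, forall_eq]
    · simp [Fin.forall_fin_succ, mat]
    · exact ⟨⟨(1, 0), 0, by simp [mat, Fin.forall_fin_succ]⟩,
        ⟨(0, 1), 0, by simp [mat, Fin.forall_fin_succ]⟩⟩
    · exact ⟨(1, 0), 0, by simp [mat, Fin.forall_fin_succ]⟩
  · refine hasMinSegre_PG hM {0, 1} {0, 1} ?_ ?_ ?_ <;>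
      simp only [Finset.mem_insert, Finset.mem_singleton, forall_eq_or_imp, forall_eq]
    · simp [Fin.forall_fin_succ, mat]
    · exact ⟨⟨(1, 0), 0, by simp [mat, Fin.forall_fin_succ]⟩,
        ⟨(0, 1), 1, by simp [mat, Fin.forall_fin_succ]⟩⟩
    · exact ⟨⟨(1, 0), 0, by simp [mat, Fin.forall_fin_succ]⟩,
        ⟨(0, 1), 1, by simp [mat, Fin.forall_fin_succ]⟩⟩
  · refine hasMinSegre_PG hM {0, 1} {0, 1} ?_ ?_ ?_ <;>
      simp only [Finset.mem_insert, Finset.mem_singleton, forall_eq_or_imp, forall_eq]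
    · simp [Fin.forall_fin_succ, mat]
    · exact ⟨⟨(1, 0), 0, by simp [mat, Fin.forall_fin_succ]⟩,
        ⟨(0, 1), 0, by simp [mat, Fin.forall_fin_succ]⟩⟩
    · exact ⟨⟨(1, 0), 0, by simp [mat, Fin.forall_fin_succ]⟩,
        ⟨(1, 0), 1, by simp [mat, Fin.forall_fin_succ]⟩⟩
  · refine hasMinSegre_PG hM {0, 1} {0, 1, 2} ?_ ?_ ?_ <;>
      simp only [Finset.mem_insert, Finset.mem_singleton, forall_eq_or_imp, forall_eq]
    · simp [Fin.forall_fin_succ, mat]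
    · exact ⟨⟨(1, 0), 0, by simp [mat, Fin.forall_fin_succ]⟩,
        ⟨(1, 0), 2, by simp [mat, Fin.forall_fin_succ]⟩⟩
    · exact ⟨⟨(1, 0), 0, by simp [mat, Fin.forall_fin_succ]⟩,
        ⟨(0, 1), 0, by simp [mat, Fin.forall_fin_succ]⟩,
        ⟨(1, 0), 1, by simp [mat, Fin.forall_fin_succ]⟩⟩
  · refine hasMinSegre_PG hM {0, 1} {0, 1} ?_ ?_ ?_ <;>
      simp only [Finset.mem_insert, Finset.mem_singleton, forall_eq_or_imp, forall_eq]
    · simp [Fin.forall_fin_succ, mat]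
    -- The parameter y = v⁻¹ normalises the entry vy to 1; this needs v ≠ 0.
    · exact ⟨⟨(0, 1), 1, by simp [mat, Fin.forall_fin_succ]⟩,
        ⟨(0, v⁻¹), 0, by simp [mat, Fin.forall_fin_succ, hv]⟩⟩
    · exact ⟨⟨(0, v⁻¹), 1, by simp [mat, Fin.forall_fin_succ, hv]⟩,
        ⟨(0, 1), 0, by simp [mat, Fin.forall_fin_succ]⟩⟩
  · refine hasMinSegre_PG hM {0, 1} {0, 1, 2} ?_ ?_ ?_ <;>
      simp only [Finset.mem_insert, Finset.mem_singleton, forall_eq_or_imp, forall_eq]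
    · simp [Fin.forall_fin_succ, mat]
    · exact ⟨⟨(1, 0), 0, by simp [mat, Fin.forall_fin_succ]⟩,
        ⟨(1, 0), 1, by simp [mat, Fin.forall_fin_succ]⟩⟩
    · exact ⟨⟨(1, 0), 0, by simp [mat, Fin.forall_fin_succ]⟩,
        ⟨(1, 0), 1, by simp [mat, Fin.forall_fin_succ]⟩,
        ⟨(0, 1), 1, by simp [mat, Fin.forall_fin_succ]⟩⟩

theorem PlaneType.hasMinSegre_rep {u v : F} (hv : v ≠ 0) (α β γ : F) (o : PlaneType) :
    HasMinSegre (PG (o.rep u v α β γ)) o.minDims := by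
  have hM : ∀ t, t ∈ o.rep u v α β γ ↔
      ∃ p : F × F × F, t = tensor (o.mat u v α β γ p.1 p.2.1 p.2.2) := fun t => by
    simp only [(o.span_spec u v α β γ).1, Prod.exists]
  cases o
  · refine hasMinSegre_PG hM {0} {0, 1, 2} ?_ ?_ ?_ <;>
      simp only [Finset.mem_insert, Finset.mem_singleton, forall_eq_or_imp, forall_eq]
    · simp [Fin.forall_fin_succ, mat]
    · exact ⟨(1, 0, 0), 0, by simp [mat, Fin.forall_fin_succ]⟩
    · exact ⟨⟨(1, 0, 0), 0, by simp [mat, Fin.forall_fin_succ]⟩,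
        ⟨(0, 1, 0), 0, by simp [mat, Fin.forall_fin_succ]⟩,
        ⟨(0, 0, 1), 0, by simp [mat, Fin.forall_fin_succ]⟩⟩
  · refine hasMinSegre_PG hM {0, 1} {0, 1} ?_ ?_ ?_ <;>
      simp only [Finset.mem_insert, Finset.mem_singleton, forall_eq_or_imp, forall_eq]
    · simp [Fin.forall_fin_succ, mat]
    · exact ⟨⟨(0, 0, 1), 0, by simp [mat, Fin.forall_fin_succ]⟩,
        ⟨(1, 0, 0), 0, by simp [mat, Fin.forall_fin_succ]⟩⟩
    · exact ⟨⟨(0, 0, 1), 0, by simp [mat, Fin.forall_fin_succ]⟩,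
        ⟨(0, 1, 0), 1, by simp [mat, Fin.forall_fin_succ]⟩⟩
  · refine hasMinSegre_PG hM {0, 1} {0, 1, 2} ?_ ?_ ?_ <;>
      simp only [Finset.mem_insert, Finset.mem_singleton, forall_eq_or_imp, forall_eq]
    · simp [Fin.forall_fin_succ, mat]
    · exact ⟨⟨(1, 0, 0), 0, by simp [mat, Fin.forall_fin_succ]⟩,
        ⟨(0, 1, 0), 1, by simp [mat, Fin.forall_fin_succ]⟩⟩
    · exact ⟨⟨(1, 0, 0), 0, by simp [mat, Fin.forall_fin_succ]⟩,
        ⟨(0, 1, 0), 1, by simp [mat, Fin.forall_fin_succ]⟩,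
        ⟨(0, 0, 1), 1, by simp [mat, Fin.forall_fin_succ]⟩⟩
  · refine hasMinSegre_PG hM {0, 1} {0, 1, 2} ?_ ?_ ?_ <;>
      simp only [Finset.mem_insert, Finset.mem_singleton, forall_eq_or_imp, forall_eq]
    · simp [Fin.forall_fin_succ, mat]
    · exact ⟨⟨(0, 0, 1), 0, by simp [mat, Fin.forall_fin_succ]⟩,
        ⟨(1, 0, 0), 0, by simp [mat, Fin.forall_fin_succ]⟩⟩
    · exact ⟨⟨(0, 0, 1), 0, by simp [mat, Fin.forall_fin_succ]⟩,
        ⟨(0, 1, 0), 1, by simp [mat, Fin.forall_fin_succ]⟩,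
        ⟨(0, 0, 1), 1, by simp [mat, Fin.forall_fin_succ]⟩⟩
  · refine hasMinSegre_PG hM {0, 1} {0, 1} ?_ ?_ ?_ <;>
      simp only [Finset.mem_insert, Finset.mem_singleton, forall_eq_or_imp, forall_eq]
    · simp [Fin.forall_fin_succ, mat]
    · exact ⟨⟨(1, 0, 0), 0, by simp [mat, Fin.forall_fin_succ]⟩,
        ⟨(0, 0, 1), 1, by simp [mat, Fin.forall_fin_succ]⟩⟩
    · exact ⟨⟨(1, 0, 0), 0, by simp [mat, Fin.forall_fin_succ]⟩,
        ⟨(0, 0, 1), 1, by simp [mat, Fin.forall_fin_succ]⟩⟩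
  · refine hasMinSegre_PG hM {0, 1} {0, 1, 2} ?_ ?_ ?_ <;>
      simp only [Finset.mem_insert, Finset.mem_singleton, forall_eq_or_imp, forall_eq]
    · simp [Fin.forall_fin_succ, mat]
    · exact ⟨⟨(1, 0, 0), 0, by simp [mat, Fin.forall_fin_succ]⟩,
        ⟨(0, 0, 1), 1, by simp [mat, Fin.forall_fin_succ]⟩⟩
    · exact ⟨⟨(1, 0, 0), 0, by simp [mat, Fin.forall_fin_succ]⟩,
        ⟨(0, 1, 0), 0, by simp [mat, Fin.forall_fin_succ]⟩,
        ⟨(1, 0, 0), 1, by simp [mat, Fin.forall_fin_succ]⟩⟩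
  · refine hasMinSegre_PG hM {0, 1} {0, 1, 2} ?_ ?_ ?_ <;>
      simp only [Finset.mem_insert, Finset.mem_singleton, forall_eq_or_imp, forall_eq]
    · simp [Fin.forall_fin_succ, mat]
    · exact ⟨⟨(1, 0, 0), 0, by simp [mat, Fin.forall_fin_succ]⟩,
        ⟨(0, 0, 1), 2, by simp [mat, Fin.forall_fin_succ]⟩⟩
    · exact ⟨⟨(1, 0, 0), 0, by simp [mat, Fin.forall_fin_succ]⟩,
        ⟨(0, 1, 0), 0, by simp [mat, Fin.forall_fin_succ]⟩,
        ⟨(0, 0, 1), 1, by simp [mat, Fin.forall_fin_succ]⟩⟩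
  · refine hasMinSegre_PG hM {0, 1} {0, 1, 2} ?_ ?_ ?_ <;>
      simp only [Finset.mem_insert, Finset.mem_singleton, forall_eq_or_imp, forall_eq]
    · simp [Fin.forall_fin_succ, mat]
    · exact ⟨⟨(1, 0, 0), 0, by simp [mat, Fin.forall_fin_succ]⟩,
        ⟨(0, 0, 1), 2, by simp [mat, Fin.forall_fin_succ]⟩⟩
    · exact ⟨⟨(1, 0, 0), 0, by simp [mat, Fin.forall_fin_succ]⟩,
        ⟨(0, 1, 0), 0, by simp [mat, Fin.forall_fin_succ]⟩,
        ⟨(0, 0, 1), 1, by simp [mat, Fin.forall_fin_succ]⟩⟩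
  · refine hasMinSegre_PG hM {0, 1} {0, 1, 2} ?_ ?_ ?_ <;>
      simp only [Finset.mem_insert, Finset.mem_singleton, forall_eq_or_imp, forall_eq]
    · simp [Fin.forall_fin_succ, mat]
    · exact ⟨⟨(0, 0, 1), 2, by simp [mat, Fin.forall_fin_succ]⟩,
        ⟨(0, v⁻¹, 0), 0, by simp [mat, Fin.forall_fin_succ, hv]⟩⟩
    · exact ⟨⟨(0, v⁻¹, 0), 1, by simp [mat, Fin.forall_fin_succ, hv]⟩,
        ⟨(0, 1, 0), 0, by simp [mat, Fin.forall_fin_succ]⟩,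
        ⟨(0, 0, 1), 0, by simp [mat, Fin.forall_fin_succ]⟩⟩
  · refine hasMinSegre_PG hM {0, 1} {0, 1, 2} ?_ ?_ ?_ <;>
      simp only [Finset.mem_insert, Finset.mem_singleton, forall_eq_or_imp, forall_eq]
    · simp [Fin.forall_fin_succ, mat]
    · exact ⟨⟨(1, 0, 0), 0, by simp [mat, Fin.forall_fin_succ]⟩,
        ⟨(1, 0, 0), 1, by simp [mat, Fin.forall_fin_succ]⟩⟩
    · exact ⟨⟨(1, 0, 0), 0, by simp [mat, Fin.forall_fin_succ]⟩,
        ⟨(0, 1, 0), 0, by simp [mat, Fin.forall_fin_succ]⟩,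
        ⟨(0, 0, 1), 0, by simp [mat, Fin.forall_fin_succ]⟩⟩
  · refine hasMinSegre_PG hM {0, 1} {0, 1, 2} ?_ ?_ ?_ <;>
      simp only [Finset.mem_insert, Finset.mem_singleton, forall_eq_or_imp, forall_eq]
    · simp [Fin.forall_fin_succ, mat]
    · exact ⟨⟨(1, 0, 0), 0, by simp [mat, Fin.forall_fin_succ]⟩,
        ⟨(1, 0, 0), 1, by simp [mat, Fin.forall_fin_succ]⟩⟩
    · exact ⟨⟨(1, 0, 0), 0, by simp [mat, Fin.forall_fin_succ]⟩,
        ⟨(0, 1, 0), 0, by simp [mat, Fin.forall_fin_succ]⟩,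
        ⟨(0, 0, 1), 0, by simp [mat, Fin.forall_fin_succ]⟩⟩

/-! ### Points of rank one of the representatives -/

theorem tmul_eq_tensor_iff {a : Fin 2 → F} {b : Fin 3 → F} {m : Matrix (Fin 2) (Fin 3) F} :
    a ⊗ₜ[F] b = tensor m ↔ (a 0 * b 0 = m 0 0 ∧ a 0 * b 1 = m 0 1 ∧ a 0 * b 2 = m 0 2) ∧
      a 1 * b 0 = m 1 0 ∧ a 1 * b 1 = m 1 1 ∧ a 1 * b 2 = m 1 2 := by
  rw [tmul_eq_iff]
  simp [coord_tensor, Fin.forall_fin_succ]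

theorem PointType.tmul_mem_rep (o : PointType) {a : Fin 2 → F} {b : Fin 3 → F} :
    a ⊗ₜ[F] b ∈ o.rep F ↔ ∃ x,
      (a 0 * b 0 = o.mat F x 0 0 ∧ a 0 * b 1 = o.mat F x 0 1 ∧ a 0 * b 2 = o.mat F x 0 2) ∧
      a 1 * b 0 = o.mat F x 1 0 ∧ a 1 * b 1 = o.mat F x 1 1 ∧ a 1 * b 2 = o.mat F x 1 2 := by
  simp only [o.span_spec.1, tmul_eq_tensor_iff]

theorem LineType.tmul_mem_rep (u v : F) (o : LineType) {a : Fin 2 → F} {b : Fin 3 → F} :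
    a ⊗ₜ[F] b ∈ o.rep u v ↔ ∃ x y,
      (a 0 * b 0 = o.mat u v x y 0 0 ∧ a 0 * b 1 = o.mat u v x y 0 1 ∧
        a 0 * b 2 = o.mat u v x y 0 2) ∧
      a 1 * b 0 = o.mat u v x y 1 0 ∧ a 1 * b 1 = o.mat u v x y 1 1 ∧
        a 1 * b 2 = o.mat u v x y 1 2 := by
  simp only [(o.span_spec u v).1, tmul_eq_tensor_iff]

theorem PlaneType.tmul_mem_rep (u v α β γ : F) (o : PlaneType) {a : Fin 2 → F} {b : Fin 3 → F} :
    a ⊗ₜ[F] b ∈ o.rep u v α β γ ↔ ∃ x y z,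
      (a 0 * b 0 = o.mat u v α β γ x y z 0 0 ∧ a 0 * b 1 = o.mat u v α β γ x y z 0 1 ∧
        a 0 * b 2 = o.mat u v α β γ x y z 0 2) ∧
      a 1 * b 0 = o.mat u v α β γ x y z 1 0 ∧ a 1 * b 1 = o.mat u v α β γ x y z 1 1 ∧
        a 1 * b 2 = o.mat u v α β γ x y z 1 2 := by
  simp only [(o.span_spec u v α β γ).1, tmul_eq_tensor_iff]

theorem eq_zero_fin_two {a : Fin 2 → F} (h0 : a 0 = 0) (h1 : a 1 = 0) : a = 0 := by
  ext i; fin_cases i <;> assumption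

theorem eq_zero_fin_three {b : Fin 3 → F} (h0 : b 0 = 0) (h1 : b 1 = 0) (h2 : b 2 = 0) :
    b = 0 := by
  ext i; fin_cases i <;> assumption

theorem ne_zero_fin_two {a : Fin 2 → F} (ha : a ≠ 0) : a 0 ≠ 0 ∨ a 0 = 0 ∧ a 1 ≠ 0 := by
  by_contra! h
  exact ha (eq_zero_fin_two h.1 (h.2 h.1))

theorem not_all_zero {b : Fin 3 → F} (hb : b ≠ 0) : ¬ (b 0 = 0 ∧ b 1 = 0 ∧ b 2 = 0) :=
  fun h => hb (eq_zero_fin_three h.1 h.2.1 h.2.2)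

theorem exists_eq_smul₀ {a : Fin 2 → F} (h : a 1 = 0) : ∃ s : F, a = s • ![1, 0] :=
  ⟨a 0, by ext i; fin_cases i <;> simp [h]⟩

theorem exists_eq_smul₁ {a : Fin 2 → F} (h : a 0 = 0) : ∃ s : F, a = s • ![0, 1] :=
  ⟨a 1, by ext i; fin_cases i <;> simp [h]⟩

theorem exists_eq_smul₀₁ {a : Fin 2 → F} (h : a 0 = a 1) : ∃ s : F, a = s • ![1, 1] :=
  ⟨a 0, by ext i; fin_cases i <;> simp [h]⟩

theorem exists_eq_smul₀' {b : Fin 3 → F} (h : b 1 = 0) (h' : b 2 = 0) :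
    ∃ s : F, b = s • ![1, 0, 0] :=
  ⟨b 0, by ext i; fin_cases i <;> simp [h, h']⟩

theorem exists_eq_smul₁' {b : Fin 3 → F} (h : b 0 = 0) (h' : b 2 = 0) :
    ∃ s : F, b = s • ![0, 1, 0] :=
  ⟨b 1, by ext i; fin_cases i <;> simp [h, h']⟩

theorem exists_eq_smul₂' {b : Fin 3 → F} (h : b 0 = 0) (h' : b 1 = 0) :
    ∃ s : F, b = s • ![0, 0, 1] :=
  ⟨b 2, by ext i; fin_cases i <;> simp [h, h']⟩

theorem exists_eq_smul_add₀₁ {b : Fin 3 → F} (h : b 2 = 0) :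
    ∃ s t : F, b = s • ![1, 0, 0] + t • ![0, 1, 0] :=
  ⟨b 0, b 1, by ext i; fin_cases i <;> simp [h]⟩

theorem exists_eq_smul_add₁₂ {b : Fin 3 → F} (h : b 0 = 0) :
    ∃ s t : F, b = s • ![0, 1, 0] + t • ![0, 0, 1] :=
  ⟨b 1, b 2, by ext i; fin_cases i <;> simp [h]⟩

theorem indep₂_of_minor {n : ℕ} {x y : Fin n → F} (i j : Fin n) (h : x i * y j - x j * y i ≠ 0) :
    Indep₂ F x y := by
  intro s t hst
  have hi : s * x i + t * y i = 0 := congrFun hst i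
  have hj : s * x j + t * y j = 0 := congrFun hst j
  constructor
  · refine (mul_eq_zero.mp (?_ : s * (x i * y j - x j * y i) = 0)).resolve_right h
    linear_combination y j * hi - y i * hj
  · refine (mul_eq_zero.mp (?_ : t * (x i * y j - x j * y i) = 0)).resolve_right h
    linear_combination x i * hj - x j * hi

section

variable {W : Submodule F (V F)}

theorem rankOnePoints_empty (h : ∀ x y, x ≠ 0 → y ≠ 0 → x ⊗ₜ[F] y ∉ W) :
    RankOnePoints W ![] ![] where
  left_ne k := k.elim0
  right_ne k := k.elim0
  left_indep k := k.elim0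
  right_indep k := k.elim0
  mem k := k.elim0
  eq x y hx hy hW := (h x y hx hy hW).elim

theorem rankOnePoints_singleton {a : Fin 2 → F} {b : Fin 3 → F} (ha : a ≠ 0) (hb : b ≠ 0)
    (hmem : a ⊗ₜ[F] b ∈ W)
    (h : ∀ x y, x ≠ 0 → y ≠ 0 → x ⊗ₜ[F] y ∈ W → (∃ s : F, x = s • a) ∧ ∃ t : F, y = t • b) :
    RankOnePoints W ![a] ![b] where
  left_ne k := by simpa [Subsingleton.elim k 0]
  right_ne k := by simpa [Subsingleton.elim k 0]
  left_indep k l hkl := (hkl (Subsingleton.elim k l)).elim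
  right_indep k l hkl := (hkl (Subsingleton.elim k l)).elim
  mem k := by simpa [Subsingleton.elim k 0]
  eq x y hx hy hW := ⟨0, h x y hx hy hW⟩

theorem pairwise_indep₂_pair {n : ℕ} {a a' : Fin n → F} (h : Indep₂ F a a') (k l : Fin 2)
    (hkl : k ≠ l) : Indep₂ F (![a, a'] k) (![a, a'] l) := by
  fin_cases k <;> fin_cases l
  exacts [(hkl rfl).elim, h, h.symm, (hkl rfl).elim]

theorem rankOnePoints_pair {a a' : Fin 2 → F} {b b' : Fin 3 → F} (ha : Indep₂ F a a')
    (hb : Indep₂ F b b') (hmem : a ⊗ₜ[F] b ∈ W) (hmem' : a' ⊗ₜ[F] b' ∈ W)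
    (h : ∀ x y, x ≠ 0 → y ≠ 0 → x ⊗ₜ[F] y ∈ W →
      ((∃ s : F, x = s • a) ∧ ∃ t : F, y = t • b) ∨
        (∃ s : F, x = s • a') ∧ ∃ t : F, y = t • b') :
    RankOnePoints W ![a, a'] ![b, b'] where
  left_ne k := by
    fin_cases k
    exacts [ha.ne_left, ha.ne_right]
  right_ne k := by
    fin_cases k
    exacts [hb.ne_left, hb.ne_right]
  left_indep := pairwise_indep₂_pair ha
  right_indep := pairwise_indep₂_pair hb
  mem k := by
    fin_cases k
    exacts [hmem, hmem']
  eq x y hx hy hW := (h x y hx hy hW).elim (fun h => ⟨0, h⟩) fun h => ⟨1, h⟩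

theorem pairwise_indep₂_triple {n : ℕ} {a a' a'' : Fin n → F} (h : Indep₂ F a a')
    (h' : Indep₂ F a a'') (h'' : Indep₂ F a' a'') (k l : Fin 3) (hkl : k ≠ l) :
    Indep₂ F (![a, a', a''] k) (![a, a', a''] l) := by
  fin_cases k <;> fin_cases l
  exacts [(hkl rfl).elim, h, h', h.symm, (hkl rfl).elim, h'', h'.symm, h''.symm, (hkl rfl).elim]

end

theorem PointType.rankOnePoints_o1 : RankOnePoints (PointType.rep F .o1) ![![1, 0]] ![![1, 0, 0]] := by
  refine rankOnePoints_singleton (by simp) (by simp) ?_ fun a b ha hb h => ?_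
  · rw [tmul_mem_rep]
    exact ⟨1, by simp [mat]⟩
  · have hb' := not_all_zero hb
    rw [tmul_mem_rep] at h
    obtain ⟨x, h⟩ := h
    simp [mat] at h
    have : a 1 = 0 ∧ b 1 = 0 ∧ b 2 = 0 := by
      rcases ne_zero_fin_two ha with h0 | ⟨h0, h1⟩ <;> grind
    exact ⟨exists_eq_smul₀ this.1, exists_eq_smul₀' this.2.1 this.2.2⟩

theorem PointType.rankOnePoints_o4 : RankOnePoints (PointType.rep F .o4) ![] ![] := by
  refine rankOnePoints_empty fun a b ha hb h => not_all_zero hb ?_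
  rw [tmul_mem_rep] at h
  obtain ⟨x, h⟩ := h
  simp [mat] at h
  rcases ne_zero_fin_two ha with h0 | ⟨h0, h1⟩ <;> grind

/-! ### Rank one tensors of the line representatives -/

namespace LineType

variable {u v : F} {a : Fin 2 → F} {b : Fin 3 → F}

/-- As in the analogous lemmas below, the six entries aᵢ bⱼ are matched with the matrix and the
resulting equations are solved according to whether a 0 vanishes. -/
theorem coords_o2 (ha : a ≠ 0) (hb : b ≠ 0) (h : a ⊗ₜ[F] b ∈ o2.rep u v) : a 1 = 0 ∧ b 2 = 0 := by
  have hb' := not_all_zero hb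
  obtain ⟨x, y, h⟩ := (tmul_mem_rep ..).mp h
  simp [mat] at h
  rcases ne_zero_fin_two ha with h0 | ⟨h0, h1⟩ <;> grind

theorem coords_o4T (ha : a ≠ 0) (h : a ⊗ₜ[F] b ∈ o4T.rep u v) : b 1 = 0 ∧ b 2 = 0 := by
  obtain ⟨x, y, h⟩ := (tmul_mem_rep ..).mp h
  simp [mat] at h
  rcases ne_zero_fin_two ha with h0 | ⟨h0, h1⟩ <;> grind

theorem coords_o5 (ha : a ≠ 0) (hb : b ≠ 0) (h : a ⊗ₜ[F] b ∈ o5.rep u v) :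
    (a 1 = 0 ∧ b 1 = 0 ∧ b 2 = 0) ∨ (a 0 = 0 ∧ b 0 = 0 ∧ b 2 = 0) := by
  have hb' := not_all_zero hb
  obtain ⟨x, y, h⟩ := (tmul_mem_rep ..).mp h
  simp [mat] at h
  rcases ne_zero_fin_two ha with h0 | ⟨h0, h1⟩ <;> grind

theorem coords_o6 (ha : a ≠ 0) (hb : b ≠ 0) (h : a ⊗ₜ[F] b ∈ o6.rep u v) :
    a 0 = 0 ∧ b 1 = 0 ∧ b 2 = 0 := by
  have hb' := not_all_zero hb
  obtain ⟨x, y, h⟩ := (tmul_mem_rep ..).mp h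
  simp [mat] at h
  rcases ne_zero_fin_two ha with h0 | ⟨h0, h1⟩ <;> grind

theorem coords_o7 (ha : a ≠ 0) (hb : b ≠ 0) (h : a ⊗ₜ[F] b ∈ o7.rep u v) :
    a 1 = 0 ∧ b 0 = 0 ∧ b 2 = 0 := by
  have hb' := not_all_zero hb
  obtain ⟨x, y, h⟩ := (tmul_mem_rep ..).mp h
  simp [mat] at h
  rcases ne_zero_fin_two ha with h0 | ⟨h0, h1⟩ <;> grind

end LineType

/-- The quadratic form `vy² + uvxy - x²` is anisotropic. -/
theorem QuadCond.eq_zero {u v x y : F} (h : QuadCond u v) (hxy : x * x = (u * x + y) * (v * y)) :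
    x = 0 ∧ y = 0 := by
  by_cases hx : x = 0
  · subst hx
    refine ⟨rfl, ?_⟩
    simpa [h.1] using hxy
  -- Dividing by x² turns the form into the quadratic polynomial evaluated at λ = y/x.
  · refine (h.2 (y / x) ?_).elim
    field_simp
    linear_combination -hxy

namespace LineType

variable {u v : F} {a : Fin 2 → F} {b : Fin 3 → F}

/-- A pure tensor has vanishing left 2 × 2 minor, which here is the anisotropic form in x and y. -/
theorem rankOnePoints_o10 (huv : QuadCond u v) : RankOnePoints (o10.rep u v) ![] ![] := by
  refine rankOnePoints_empty fun a b ha hb h => not_all_zero hb ?_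
  obtain ⟨x, y, h⟩ := (tmul_mem_rep ..).mp h
  simp [mat] at h
  obtain ⟨rfl, rfl⟩ := huv.eq_zero (x := x) (y := y) (by
    rw [← h.1.2.1, ← h.2.1]
    linear_combination -x * h.1.1 - a 0 * b 0 * h.2.2.1)
  rcases ne_zero_fin_two ha with h0 | ⟨h0, h1⟩ <;> grind

theorem rankOnePoints_o11 : RankOnePoints (o11.rep u v) ![] ![] := by
  refine rankOnePoints_empty fun a b ha hb h => not_all_zero hb ?_
  obtain ⟨x, y, h⟩ := (tmul_mem_rep ..).mp h
  simp [mat] at h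
  rcases ne_zero_fin_two ha with h0 | ⟨h0, h1⟩ <;> grind

theorem rankOnePoints_o6 : RankOnePoints (o6.rep u v) ![![0, 1]] ![![1, 0, 0]] := by
  refine rankOnePoints_singleton (by simp) (by simp) ?_ fun a b ha hb h => ?_
  · rw [tmul_mem_rep]
    exact ⟨0, 1, by simp [mat]⟩
  · obtain ⟨h0, h1, h2⟩ := coords_o6 ha hb h
    exact ⟨exists_eq_smul₁ h0, exists_eq_smul₀' h1 h2⟩

theorem rankOnePoints_o7 : RankOnePoints (o7.rep u v) ![![1, 0]] ![![0, 1, 0]] := by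
  refine rankOnePoints_singleton (by simp) (by simp) ?_ fun a b ha hb h => ?_
  · rw [tmul_mem_rep]
    exact ⟨0, 1, by simp [mat]⟩
  · obtain ⟨h0, h1, h2⟩ := coords_o7 ha hb h
    exact ⟨exists_eq_smul₀ h0, exists_eq_smul₁' h1 h2⟩

theorem rankOnePoints_o5 :
    RankOnePoints (o5.rep u v) ![![1, 0], ![0, 1]] ![![1, 0, 0], ![0, 1, 0]] := by
  refine rankOnePoints_pair (indep₂_of_minor 0 1 (by simp)) (indep₂_of_minor 0 1 (by simp))
    ?_ ?_ fun a b ha hb h => ?_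
  · rw [tmul_mem_rep]
    exact ⟨1, 0, by simp [mat]⟩
  · rw [tmul_mem_rep]
    exact ⟨0, 1, by simp [mat]⟩
  · refine (coords_o5 ha hb h).imp ?_ ?_
    · rintro ⟨h0, h1, h2⟩
      exact ⟨exists_eq_smul₀ h0, exists_eq_smul₀' h1 h2⟩
    · rintro ⟨h0, h1, h2⟩
      exact ⟨exists_eq_smul₁ h0, exists_eq_smul₁' h1 h2⟩

theorem intersection_rep (huv : QuadCond u v) (o : LineType) :
    o.Intersection (PG (o.rep u v)) := by
  cases o
  · refine isSecondKindLine_inter (a := ![1, 0]) (b := ![1, 0, 0]) (b' := ![0, 1, 0]) (by simp)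
      (indep₂_of_minor 0 1 (by simp)) ?_ ?_ fun a b ha hb h => ?_
    · rw [tmul_mem_rep]
      exact ⟨1, 0, by simp [mat]⟩
    · rw [tmul_mem_rep]
      exact ⟨0, 1, by simp [mat]⟩
    · obtain ⟨h0, h1⟩ := coords_o2 ha hb h
      exact ⟨exists_eq_smul₀ h0, exists_eq_smul_add₀₁ h1⟩
  · refine isFirstKindLine_inter (b₀ := ![1, 0, 0]) (by simp) (fun a => ?_)
      fun a b ha hb h => ?_
    · rw [tmul_mem_rep]
      exact ⟨a 0, a 1, by simp [mat]⟩
    · obtain ⟨h0, h1⟩ := coords_o4T ha h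
      exact exists_eq_smul₀' h0 h1
  · exact rankOnePoints_o5.ncard
  · exact rankOnePoints_o6.ncard
  · exact rankOnePoints_o7.ncard
  · exact (rankOnePoints_o10 huv).inter_eq_empty
  · exact rankOnePoints_o11.inter_eq_empty

end LineType

theorem PointType.intersection_rep (o : PointType) : o.Intersection (PG (o.rep F)) := by
  cases o
  · exact rankOnePoints_o1.ncard
  · exact rankOnePoints_o4.inter_eq_empty

/-! ### Rank one tensors of the plane representatives -/

namespace PlaneType

variable {u v α β γ : F} {a : Fin 2 → F} {b : Fin 3 → F}

theorem coords_o7T (ha : a ≠ 0) (h : a ⊗ₜ[F] b ∈ o7T.rep u v α β γ) :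
    (b 1 = 0 ∧ b 2 = 0) ∨ (a 0 = 0 ∧ b 2 = 0) := by
  obtain ⟨x, y, z, h⟩ := (tmul_mem_rep ..).mp h
  simp [mat] at h
  rcases ne_zero_fin_two ha with h0 | ⟨h0, h1⟩ <;> grind

theorem coords_o8 (ha : a ≠ 0) (hb : b ≠ 0) (h : a ⊗ₜ[F] b ∈ o8.rep u v α β γ) :
    (a 1 = 0 ∧ b 1 = 0 ∧ b 2 = 0) ∨ (a 0 = 0 ∧ b 0 = 0) := by
  have hb_ := not_all_zero hb
  obtain ⟨x, y, z, h⟩ := (tmul_mem_rep ..).mp h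
  simp [mat] at h
  rcases ne_zero_fin_two ha with h0 | ⟨h0, h1⟩ <;> grind

theorem coords_o9 (ha : a ≠ 0) (hb : b ≠ 0) (h : a ⊗ₜ[F] b ∈ o9.rep u v α β γ) :
    a 0 = 0 ∧ b 2 = 0 := by
  have hb_ := not_all_zero hb
  obtain ⟨x, y, z, h⟩ := (tmul_mem_rep ..).mp h
  simp [mat] at h
  rcases ne_zero_fin_two ha with h0 | ⟨h0, h1⟩ <;> grind

theorem coords_o12 (ha : a ≠ 0) (h : a ⊗ₜ[F] b ∈ o12.rep u v α β γ) :
    b 0 = 0 ∧ b 2 = 0 := by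
  obtain ⟨x, y, z, h⟩ := (tmul_mem_rep ..).mp h
  simp [mat] at h
  rcases ne_zero_fin_two ha with h0 | ⟨h0, h1⟩ <;> grind

theorem coords_o13 (ha : a ≠ 0) (hb : b ≠ 0) (h : a ⊗ₜ[F] b ∈ o13.rep u v α β γ) :
    (a 1 = 0 ∧ b 0 = 0 ∧ b 2 = 0) ∨ (a 0 = 0 ∧ b 0 = 0 ∧ b 1 = 0) := by
  have hb_ := not_all_zero hb
  obtain ⟨x, y, z, h⟩ := (tmul_mem_rep ..).mp h
  simp [mat] at h
  rcases ne_zero_fin_two ha with h0 | ⟨h0, h1⟩ <;> grind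

theorem coords_o14 (ha : a ≠ 0) (hb : b ≠ 0) (h : a ⊗ₜ[F] b ∈ o14.rep u v α β γ) :
    (a 1 = 0 ∧ b 1 = 0 ∧ b 2 = 0) ∨ (a 0 = 0 ∧ b 0 = 0 ∧ b 1 = 0) ∨
      (a 0 = a 1 ∧ b 0 = 0 ∧ b 2 = 0) := by
  have hb_ := not_all_zero hb
  obtain ⟨x, y, z, h⟩ := (tmul_mem_rep ..).mp h
  simp [mat] at h
  rcases ne_zero_fin_two ha with h0 | ⟨h0, h1⟩ <;> grind

theorem coords_o16 (ha : a ≠ 0) (hb : b ≠ 0) (h : a ⊗ₜ[F] b ∈ o16.rep u v α β γ) :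
    a 1 = 0 ∧ b 0 = 0 ∧ b 1 = 0 := by
  have hb_ := not_all_zero hb
  obtain ⟨x, y, z, h⟩ := (tmul_mem_rep ..).mp h
  simp [mat] at h
  rcases ne_zero_fin_two ha with h0 | ⟨h0, h1⟩ <;> grind

theorem coords_o15 (huv : QuadCond u v) (ha : a ≠ 0) (hb : b ≠ 0)
    (h : a ⊗ₜ[F] b ∈ o15.rep u v α β γ) : a 1 = 0 ∧ b 0 = 0 ∧ b 1 = 0 := by
  have hb_ := not_all_zero hb
  obtain ⟨x, y, z, h⟩ := (tmul_mem_rep ..).mp h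
  simp [mat] at h
  obtain ⟨rfl, rfl⟩ := huv.eq_zero (x := x) (y := y) (by
    rw [← h.1.2.1, ← h.2.1]
    linear_combination -x * h.1.1 - a 0 * b 0 * h.2.2.1)
  rcases ne_zero_fin_two ha with h0 | ⟨h0, h1⟩ <;> grind

/-- For a 0 ≠ 0 the second row is m times the first, with m = a 1 / a 0, so m is an eigenvalue of a
companion matrix. Eliminating b 0 and b 1 leaves b 2 times the cubic at λ = -m. For a 0 = 0 the
first row, and with it x, y, z, vanishes. -/
theorem rankOnePoints_o17 (habc : CubicCond α β γ) :
    RankOnePoints (o17.rep u v α β γ) ![] ![] := by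
  refine rankOnePoints_empty fun a b ha hb h => not_all_zero hb ?_
  obtain ⟨x, y, z, ⟨rfl, rfl, rfl⟩, h0, h1, h2⟩ := (tmul_mem_rep ..).mp h
  simp only [mat] at h0 h1 h2
  simp at h0 h1 h2
  rcases ne_zero_fin_two ha with ha0 | ⟨ha0, ha1⟩
  · obtain ⟨m, hm⟩ : ∃ m, a 1 = a 0 * m := ⟨a 1 / a 0, by field_simp⟩
    rw [hm] at h0 h1 h2
    have e0 : m * b 0 = α * b 2 := mul_left_cancel₀ ha0 (by linear_combination h0)
    have e1 : m * b 1 = b 0 + β * b 2 := mul_left_cancel₀ ha0 (by linear_combination h1)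
    have e2 : m * b 2 = b 1 + γ * b 2 := mul_left_cancel₀ ha0 (by linear_combination h2)
    have hb2 : b 2 = 0 := by
      refine (mul_eq_zero.mp (?_ : ((-m) ^ 3 + γ * (-m) ^ 2 - β * (-m) + α) * b 2 = 0)).resolve_left
        (habc (-m))
      linear_combination -e0 - m * e1 - m ^ 2 * e2
    have hb1 : b 1 = 0 := by simpa [hb2] using e2.symm
    exact ⟨by simpa [hb2, hb1] using e1.symm, hb1, hb2⟩
  · simpa [ha0, ha1] using And.intro h0 (And.intro h1 h2)

theorem rankOnePoints_o15 (huv : QuadCond u v) :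
    RankOnePoints (o15.rep u v α β γ) ![![1, 0]] ![![0, 0, 1]] := by
  refine rankOnePoints_singleton (by simp) (by simp) ?_ fun a b ha hb h => ?_
  · rw [tmul_mem_rep]
    exact ⟨0, 0, 1, by simp [mat]⟩
  · obtain ⟨h0, h1, h2⟩ := coords_o15 huv ha hb h
    exact ⟨exists_eq_smul₀ h0, exists_eq_smul₂' h1 h2⟩

theorem rankOnePoints_o16 :
    RankOnePoints (o16.rep u v α β γ) ![![1, 0]] ![![0, 0, 1]] := by
  refine rankOnePoints_singleton (by simp) (by simp) ?_ fun a b ha hb h => ?_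
  · rw [tmul_mem_rep]
    exact ⟨0, 0, 1, by simp [mat]⟩
  · obtain ⟨h0, h1, h2⟩ := coords_o16 ha hb h
    exact ⟨exists_eq_smul₀ h0, exists_eq_smul₂' h1 h2⟩

theorem rankOnePoints_o13 :
    RankOnePoints (o13.rep u v α β γ) ![![1, 0], ![0, 1]] ![![0, 1, 0], ![0, 0, 1]] := by
  refine rankOnePoints_pair (indep₂_of_minor 0 1 (by simp)) (indep₂_of_minor 1 2 (by simp))
    ?_ ?_ fun a b ha hb h => ?_
  · rw [tmul_mem_rep]
    exact ⟨0, 1, 0, by simp [mat]⟩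
  · rw [tmul_mem_rep]
    exact ⟨0, 0, 1, by simp [mat]⟩
  · refine (coords_o13 ha hb h).imp ?_ ?_
    · rintro ⟨h0, h1, h2⟩
      exact ⟨exists_eq_smul₀ h0, exists_eq_smul₁' h1 h2⟩
    · rintro ⟨h0, h1, h2⟩
      exact ⟨exists_eq_smul₁ h0, exists_eq_smul₂' h1 h2⟩

theorem rankOnePoints_o14 :
    RankOnePoints (o14.rep u v α β γ) ![![1, 0], ![0, 1], ![1, 1]]
      ![![1, 0, 0], ![0, 0, 1], ![0, 1, 0]] where
  left_ne k := by fin_cases k <;> simp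
  right_ne k := by fin_cases k <;> simp
  left_indep := pairwise_indep₂_triple (indep₂_of_minor 0 1 (by simp))
    (indep₂_of_minor 0 1 (by simp)) (indep₂_of_minor 0 1 (by simp))
  right_indep := pairwise_indep₂_triple (indep₂_of_minor 0 2 (by simp))
    (indep₂_of_minor 0 1 (by simp)) (indep₂_of_minor 1 2 (by simp))
  mem k := by
    rw [tmul_mem_rep]
    fin_cases k
    exacts [⟨1, 0, 0, by simp [mat]⟩, ⟨0, 0, 1, by simp [mat]⟩, ⟨0, 1, 0, by simp [mat]⟩]
  eq a b ha hb h := by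
    rcases coords_o14 ha hb h with ⟨h0, h1, h2⟩ | ⟨h0, h1, h2⟩ | ⟨h0, h1, h2⟩
    · exact ⟨0, exists_eq_smul₀ h0, exists_eq_smul₀' h1 h2⟩
    · exact ⟨1, exists_eq_smul₁ h0, exists_eq_smul₂' h1 h2⟩
    · exact ⟨2, exists_eq_smul₀₁ h0, exists_eq_smul₁' h1 h2⟩

end PlaneType

/-- The determinant of the left `2 × 2` block, as a quadratic form on `F^2 ⊗ F^3`. -/
def blockDet (F : Type*) [Field F] : QuadraticForm F (V F) :=
  QuadraticMap.linMulLin (coord 0 0) (coord 1 1) - QuadraticMap.linMulLin (coord 0 1) (coord 1 0)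

theorem blockDet_apply (w : V F) :
    blockDet F w = coord 0 0 w * coord 1 1 w - coord 0 1 w * coord 1 0 w := rfl

namespace PlaneType

variable {u v α β γ : F}

theorem isProjSubspace_o3 : IsProjSubspace 2 (PG (o3.rep u v α β γ) ∩ segreVariety F) := by
  refine ⟨o3.rep u v α β γ, (o3.span_spec u v α β γ).2, Set.inter_eq_left.mpr fun p hp => ?_⟩
  induction p with | h w hw =>
  obtain ⟨x, y, z, rfl⟩ := ((o3.span_spec u v α β γ).1 w).mp hp
  have h : (![1, 0] : Fin 2 → F) ⊗ₜ[F] ![x, y, z] = tensor (o3.mat u v α β γ x y z) := by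
    rw [tmul_eq_tensor_iff]
    simp [mat]
  have h0 : (![x, y, z] : Fin 3 → F) ≠ 0 := by
    intro h0
    exact hw (by rw [← h, h0, TensorProduct.tmul_zero])
  exact mem_segreVariety.mpr ⟨![1, 0], _, by simp, h0, by simp only [h]⟩

theorem lines_o7T : ∃ l m, IsFirstKindLine l ∧ IsSecondKindLine m ∧
    PG (o7T.rep u v α β γ) ∩ segreVariety F = l ∪ m := by
  have hb₀ : (![1, 0, 0] : Fin 3 → F) ≠ 0 := by simp
  have ha₁ : (![0, 1] : Fin 2 → F) ≠ 0 := by simp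
  refine ⟨_, secondKindLine ha₁ ![1, 0, 0] ![0, 1, 0], ⟨.mk F _ hb₀, rfl⟩,
    isSecondKindLine_secondKindLine _ (indep₂_of_minor 0 1 (by simp)),
    Set.Subset.antisymm ?_ (Set.union_subset ?_ (secondKindLine_subset _ ?_ ?_))⟩
  · intro p hp
    obtain ⟨a, b, ha, hb, hW, rfl⟩ := mem_PG_inter_segreVariety.mp hp
    rcases coords_o7T ha hW with ⟨h0, h1⟩ | ⟨h0, h1⟩
    · refine .inl ⟨.mk F a ha, ?_⟩
      simp only [segre_mk]
      exact mk_tmul_eq ha hb₀ ha hb ⟨1, (one_smul _ _).symm⟩ (by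
        obtain ⟨s, hs⟩ := exists_eq_smul₀' h0 h1
        have hs0 : s ≠ 0 := by
          rintro rfl
          exact hb (by rw [hs, zero_smul])
        exact ⟨s⁻¹, by rw [hs, smul_smul, inv_mul_cancel₀ hs0, one_smul]⟩)
    · exact .inr (mk_mem_secondKindLine ha₁ ha hb (exists_eq_smul₁ h0) (exists_eq_smul_add₀₁ h1))
  · rintro p ⟨a, rfl⟩
    induction a with | h a ha =>
    refine mem_PG_inter_segreVariety.mpr ⟨a, _, ha, hb₀, ?_, segre_mk _ _⟩
    rw [tmul_mem_rep]
    exact ⟨a 1, 0, a 0, by simp [mat]⟩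
  · rw [tmul_mem_rep]
    exact ⟨1, 0, 0, by simp [mat]⟩
  · rw [tmul_mem_rep]
    exact ⟨0, 1, 0, by simp [mat]⟩

theorem lineAndPoint_o8 : ∃ l p, IsSecondKindLine l ∧ p ∉ l ∧
    PG (o8.rep u v α β γ) ∩ segreVariety F = l ∪ {p} := by
  have hb₀ : (![1, 0, 0] : Fin 3 → F) ≠ 0 := by simp
  have ha₀ : (![1, 0] : Fin 2 → F) ≠ 0 := by simp
  have ha₁ : (![0, 1] : Fin 2 → F) ≠ 0 := by simp
  refine ⟨secondKindLine ha₁ ![0, 1, 0] ![0, 0, 1], .mk F _ (tmul_ne_zero ha₀ hb₀),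
    isSecondKindLine_secondKindLine _ (indep₂_of_minor 1 2 (by simp)), ?_,
    Set.Subset.antisymm ?_ (Set.union_subset (secondKindLine_subset _ ?_ ?_) ?_)⟩
  · intro h
    obtain ⟨s, t, h0, h⟩ := (mem_secondKindLine ha₁).mp h
    obtain ⟨⟨c, hc⟩, -⟩ := mk_tmul_inj ha₀ hb₀ ha₁ h0 h
    simpa using congrFun hc 0
  · intro p hp
    obtain ⟨a, b, ha, hb, hW, rfl⟩ := mem_PG_inter_segreVariety.mp hp
    rcases coords_o8 ha hb hW with ⟨h0, h1, h2⟩ | ⟨h0, h1⟩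
    · exact .inr (mk_tmul_eq ha hb ha₀ hb₀ (exists_eq_smul₀ h0) (exists_eq_smul₀' h1 h2))
    · exact .inl (mk_mem_secondKindLine ha₁ ha hb (exists_eq_smul₁ h0) (exists_eq_smul_add₁₂ h1))
  · rw [tmul_mem_rep]
    exact ⟨0, 1, 0, by simp [mat]⟩
  · rw [tmul_mem_rep]
    exact ⟨0, 0, 1, by simp [mat]⟩
  · rintro p rfl
    refine mem_PG_inter_segreVariety.mpr ⟨_, _, ha₀, hb₀, ?_, rfl⟩
    rw [tmul_mem_rep]
    exact ⟨1, 0, 0, by simp [mat]⟩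

theorem isConic_o11T : IsConic (PG (o11T.rep u v α β γ) ∩ segreVariety F) := by
  have hmem := (o11T.span_spec u v α β γ).1
  refine ⟨o11T.rep u v α β γ, blockDet F, (o11T.span_spec u v α β γ).2, ?_, ?_⟩
  · intro w hw hQ hpolar
    obtain ⟨x, y, z, rfl⟩ := (hmem w).mp hw
    -- On this plane the form is xz - y². Polarising against the two diagonal generators isolates z
    -- and x. The coordinate y must come from Q = 0, since in characteristic 2 the polar form does
    -- not see it.
    have h1 := hpolar _ ((hmem _).mpr ⟨1, 0, 0, rfl⟩)
    have h2 := hpolar _ ((hmem _).mpr ⟨0, 0, 1, rfl⟩)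
    simp [QuadraticMap.polar, blockDet_apply, coord_tensor, mat] at h1 h2 hQ
    have hz : z = 0 := by linear_combination h1
    have hx : x = 0 := by linear_combination h2
    have hy : y = 0 := by simpa [hx] using hQ
    rw [hx, hy, hz, ← tensorEquiv_apply, LinearEquiv.map_eq_zero_iff]
    ext i j
    fin_cases i <;> fin_cases j <;> rfl
  · ext p
    rw [Set.mem_inter_iff, Set.mem_ofPred_eq]
    refine and_congr_right fun hp => ?_
    rw [mem_segreVariety]
    constructor
    · rintro ⟨a, b, ha, hb, rfl⟩
      rw [apply_rep_eq_zero_iff, blockDet_apply]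
      simp only [coord_tmul]
      ring
    · intro hQ
      induction p with | h w hw =>
      rw [apply_rep_eq_zero_iff, blockDet_apply] at hQ
      obtain ⟨x, y, z, rfl⟩ := (hmem w).mp hp
      simp [coord_tensor, mat] at hQ
      -- A symmetric block with xz = y² is factored explicitly: for x ≠ 0 its second row is y/x
      -- times the first, and for x = 0 only the entry z remains.
      obtain ⟨a, b, hab⟩ : ∃ a b, a ⊗ₜ[F] b = tensor (o11T.mat u v α β γ x y z) := by
        by_cases hx : x = 0
        · have hy : y = 0 := by simpa [hx] using hQ
          exact ⟨![0, 1], ![0, z, 0], by rw [tmul_eq_tensor_iff]; simp [mat, hx, hy]⟩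
        · refine ⟨![x, y], ![1, y / x, 0], ?_⟩
          rw [tmul_eq_tensor_iff]
          simp [mat]
          field_simp
          exact ⟨trivial, by linear_combination -hQ⟩
      have ha : a ≠ 0 := by
        rintro rfl
        exact hw (by rw [← hab, TensorProduct.zero_tmul])
      have hb : b ≠ 0 := by
        rintro rfl
        exact hw (by rw [← hab, TensorProduct.tmul_zero])
      exact ⟨a, b, ha, hb, by simp only [hab]⟩

theorem intersection_rep (huv : QuadCond u v) (habc : CubicCond α β γ) (o : PlaneType) :
    o.Intersection u v (PG (o.rep u v α β γ)) := by
  cases o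
  · exact isProjSubspace_o3
  · exact lines_o7T
  · exact lineAndPoint_o8
  · refine isSecondKindLine_inter (a := ![0, 1]) (b := ![1, 0, 0]) (b' := ![0, 1, 0]) (by simp)
      (indep₂_of_minor 0 1 (by simp)) ?_ ?_ fun a b ha hb h => ?_
    · rw [tmul_mem_rep]
      exact ⟨1, 0, 0, by simp [mat]⟩
    · rw [tmul_mem_rep]
      exact ⟨0, 1, 0, by simp [mat]⟩
    · obtain ⟨h0, h1⟩ := coords_o9 ha hb h
      exact ⟨exists_eq_smul₁ h0, exists_eq_smul_add₀₁ h1⟩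
  · exact isConic_o11T
  · refine isFirstKindLine_inter (b₀ := ![0, 1, 0]) (by simp) (fun a => ?_)
      fun a b ha hb h => ?_
    · rw [tmul_mem_rep]
      exact ⟨0, a 0, a 1, by simp [mat]⟩
    · obtain ⟨h0, h1⟩ := coords_o12 ha h
      exact exists_eq_smul₁' h0 h1
  · exact rankOnePoints_o13.ncard
  · exact rankOnePoints_o14.ncard
  · refine ⟨(rankOnePoints_o15 huv).ncard, _, MulAction.mem_orbit_self _, PG_subset_iff.mpr ?_⟩
    intro t ht
    obtain ⟨x, y, rfl⟩ := ((LineType.o10.span_spec u v).1 t).mp ht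
    exact ((o15.span_spec u v α β γ).1 _).mpr ⟨x, y, 0, rfl⟩
  · refine ⟨rankOnePoints_o16.ncard, _, MulAction.mem_orbit_self _, PG_subset_iff.mpr ?_⟩
    intro t ht
    obtain ⟨x, y, rfl⟩ := ((LineType.o11.span_spec u v).1 t).mp ht
    exact ((o16.span_spec u v α β γ).1 _).mpr ⟨x, y, 0, rfl⟩
  · exact (rankOnePoints_o17 habc).inter_eq_empty

end PlaneType

/-! ### Invariance along orbits -/

theorem smul_mem_orbit {U X : Set (ℙ F (V F))} (hU : U ∈ MulAction.orbit (Hbar₂ F) X)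
    (g : GL (Fin 2) F) (h : GL (Fin 3) F) :
    tensorHom F (g, h) • U ∈ MulAction.orbit (Hbar₂ F) X := by
  rw [mem_orbit_iff] at hU ⊢
  obtain ⟨g', h', rfl⟩ := hU
  exact ⟨g * g', h * h', by rw [smul_smul, ← map_mul]; rfl⟩

theorem HasMinSegre.of_mem_orbit {U X : Set (ℙ F (V F))} {d : ℕ × ℕ}
    (hU : U ∈ MulAction.orbit (Hbar₂ F) X) (hX : HasMinSegre X d) : HasMinSegre U d := by
  obtain ⟨g, h, rfl⟩ := mem_orbit_iff.mp hU
  exact hX.smul g h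

theorem ncard_inter_eq_of_mem_orbit {U X : Set (ℙ F (V F))}
    (hU : U ∈ MulAction.orbit (Hbar₂ F) X) :
    (U ∩ segreVariety F).ncard = (X ∩ segreVariety F).ncard := by
  obtain ⟨g, h, rfl⟩ := mem_orbit_iff.mp hU
  rw [smul_inter_segreVariety, smul_ncard]

theorem inter_eq_empty_of_mem_orbit {U X : Set (ℙ F (V F))}
    (hU : U ∈ MulAction.orbit (Hbar₂ F) X) (hX : X ∩ segreVariety F = ∅) :
    U ∩ segreVariety F = ∅ := by
  obtain ⟨g, h, rfl⟩ := mem_orbit_iff.mp hU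
  rw [smul_inter_segreVariety, hX, Set.smul_set_empty]

theorem PointType.Intersection.of_mem_orbit {o : PointType} {U X : Set (ℙ F (V F))}
    (hU : U ∈ MulAction.orbit (Hbar₂ F) X) (hX : o.Intersection X) : o.Intersection U := by
  cases o
  · exact (ncard_inter_eq_of_mem_orbit hU).trans hX
  · exact inter_eq_empty_of_mem_orbit hU hX

theorem LineType.Intersection.of_mem_orbit {o : LineType} {U X : Set (ℙ F (V F))}
    (hU : U ∈ MulAction.orbit (Hbar₂ F) X) (hX : o.Intersection X) : o.Intersection U := by
  obtain ⟨g, h, rfl⟩ := mem_orbit_iff.mp hU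
  cases o
  · simpa only [Intersection, smul_inter_segreVariety] using IsSecondKindLine.smul hX g h
  · simpa only [Intersection, smul_inter_segreVariety] using IsFirstKindLine.smul hX g h
  · exact (ncard_inter_eq_of_mem_orbit hU).trans hX
  · exact (ncard_inter_eq_of_mem_orbit hU).trans hX
  · exact (ncard_inter_eq_of_mem_orbit hU).trans hX
  · exact inter_eq_empty_of_mem_orbit hU hX
  · exact inter_eq_empty_of_mem_orbit hU hX

theorem PlaneType.Intersection.of_mem_orbit {u v : F} {o : PlaneType} {U X : Set (ℙ F (V F))}
    (hU : U ∈ MulAction.orbit (Hbar₂ F) X) (hX : o.Intersection u v X) :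
    o.Intersection u v U := by
  obtain ⟨g, h, rfl⟩ := mem_orbit_iff.mp hU
  cases o
  · simpa only [Intersection, smul_inter_segreVariety] using IsProjSubspace.smul hX _
  · obtain ⟨l, m, hl, hm, hlm⟩ := hX
    exact ⟨_, _, hl.smul g h, hm.smul g h, by
      rw [smul_inter_segreVariety, hlm, Set.smul_set_union]⟩
  · obtain ⟨l, p, hl, hp, hlp⟩ := hX
    exact ⟨_, tensorHom F (g, h) • p, hl.smul g h, by rwa [Set.smul_mem_smul_set_iff], by
      rw [smul_inter_segreVariety, hlp, Set.smul_set_union, Set.smul_set_singleton]⟩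
  · simpa only [Intersection, smul_inter_segreVariety] using IsSecondKindLine.smul hX g h
  · simpa only [Intersection, smul_inter_segreVariety] using IsConic.smul hX _
  · simpa only [Intersection, smul_inter_segreVariety] using IsFirstKindLine.smul hX g h
  · exact (ncard_inter_eq_of_mem_orbit hU).trans hX
  · exact (ncard_inter_eq_of_mem_orbit hU).trans hX
  · obtain ⟨h1, l, hl, hlX⟩ := hX
    exact ⟨(ncard_inter_eq_of_mem_orbit hU).trans h1, _, smul_mem_orbit hl g h,
      Set.smul_set_mono hlX⟩
  · obtain ⟨h1, l, hl, hlX⟩ := hX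
    exact ⟨(ncard_inter_eq_of_mem_orbit hU).trans h1, _, smul_mem_orbit hl g h,
      Set.smul_set_mono hlX⟩
  · exact inter_eq_empty_of_mem_orbit hU hX

theorem exists_map_eq_of_mem_orbit {W W' : Submodule F (V F)}
    (h : PG W ∈ MulAction.orbit (Hbar₂ F) (PG W')) :
    ∃ (g : GL (Fin 2) F) (h : GL (Fin 3) F), ∀ (a : Fin 2 → F) (b : Fin 3 → F),
      a ⊗ₜ[F] b ∈ W' → g.1.mulVec a ⊗ₜ[F] h.1.mulVec b ∈ W := by
  obtain ⟨g, h, hW⟩ := mem_orbit_iff.mp h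
  rw [smul_PG] at hW
  refine ⟨g, h, fun a b hab => ?_⟩
  rw [← tensorHom_tmul]
  exact PG_subset_iff.mp hW.ge (Submodule.mem_map_of_mem hab)

theorem Indep₂.mulVec {n : ℕ} {x y : Fin n → F} (h : Indep₂ F x y) (g : GL (Fin n) F) :
    Indep₂ F (g.1.mulVec x) (g.1.mulVec y) := by
  intro s t hst
  refine h s t (Matrix.mulVec_injective_of_isUnit g.isUnit ?_)
  rw [Matrix.mulVec_zero, ← hst, Matrix.mulVec_add, Matrix.mulVec_smul, Matrix.mulVec_smul]

theorem mulVec_ne_zero {n : ℕ} {x : Fin n → F} (h : x ≠ 0) (g : GL (Fin n) F) :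
    g.1.mulVec x ≠ 0 := fun h0 =>
  h (Matrix.mulVec_injective_of_isUnit g.isUnit (by rw [h0, Matrix.mulVec_zero]))

section

variable {W W' : Submodule F (V F)}

theorem HasSecondKind.of_mem_orbit (hW : PG W ∈ MulAction.orbit (Hbar₂ F) (PG W'))
    (h : HasSecondKind W') : HasSecondKind W := by
  obtain ⟨g, k, hgk⟩ := exists_map_eq_of_mem_orbit hW
  obtain ⟨a, b, b', ha, hb, h1, h2⟩ := h
  exact ⟨_, _, _, mulVec_ne_zero ha g, hb.mulVec k, hgk _ _ h1, hgk _ _ h2⟩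

theorem HasFirstKind.of_mem_orbit (hW : PG W ∈ MulAction.orbit (Hbar₂ F) (PG W'))
    (h : HasFirstKind W') : HasFirstKind W := by
  obtain ⟨g, k, hgk⟩ := exists_map_eq_of_mem_orbit hW
  obtain ⟨a, a', b, ha, hb, h1, h2⟩ := h
  exact ⟨_, _, _, ha.mulVec g, mulVec_ne_zero hb k, hgk _ _ h1, hgk _ _ h2⟩

theorem HasTwoFactors.of_mem_orbit (hW : PG W ∈ MulAction.orbit (Hbar₂ F) (PG W'))
    (h : HasTwoFactors W') : HasTwoFactors W := by
  obtain ⟨g, k, hgk⟩ := exists_map_eq_of_mem_orbit hW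
  obtain ⟨a, a', b, b', ha, hb, hb', h1, h2⟩ := h
  exact ⟨_, _, _, _, ha.mulVec g, mulVec_ne_zero hb k, mulVec_ne_zero hb' k, hgk _ _ h1,
    hgk _ _ h2⟩

end

/-! ### The representatives lie in different orbits -/

/-- A line without rank-one points avoids the point x = y = 0 of the o16 plane, so x and y are
coordinates on it. The rows (1, 0, z), (0, 1, 0) and (0, 0, 1) that then occur span F³, whereas an
o10 line lies in a space A ⊗ B with dim B = 2. -/
theorem LineType.not_mem_orbit_of_subset_o16 {u v α β γ : F} (huv : QuadCond u v)
    {l : Set (ℙ F (V F))} (hl : l ∈ MulAction.orbit (Hbar₂ F) (PG (o10.rep u v))) :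
    ¬ l ⊆ PG (PlaneType.o16.rep u v α β γ) := by
  intro hsub
  obtain ⟨L, hL, rfl⟩ : IsProjSubspace 1 l := by
    obtain ⟨g, h, rfl⟩ := mem_orbit_iff.mp hl
    exact IsProjSubspace.smul ⟨_, (o10.span_spec u v).2, rfl⟩ _
  have hempty := inter_eq_empty_of_mem_orbit hl (rankOnePoints_o10 huv).inter_eq_empty
  obtain ⟨A, B, -, hB, hAB, -⟩ := (o10.hasMinSegre_rep huv.1).of_mem_orbit hl
  rw [PG_subset_iff] at hsub hAB
  have hmat : ∀ w ∈ L, ∃ x y z, w = tensor (PlaneType.o16.mat u v α β γ x y z) := fun w hw =>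
    ((PlaneType.o16.span_spec u v α β γ).1 w).mp (hsub hw)
  -- The projection to (x, y) is injective because its kernel consists of multiples of the pure
  -- tensor e₁ ⊗ e₃ lying in L, and bijective by dimension.
  let f : L →ₗ[F] F × F := ((coord 0 0).prod (coord 0 1)).comp L.subtype
  have hf : Function.Injective f := by
    rw [injective_iff_map_eq_zero]
    rintro ⟨w, hw⟩ h0
    obtain ⟨x, y, z, rfl⟩ := hmat w hw
    simp [f, coord_tensor, PlaneType.mat] at h0
    obtain ⟨rfl, rfl⟩ := h0
    by_contra hne
    have hz : (![0, 0, z] : Fin 3 → F) ≠ 0 := by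
      intro h0
      have hz0 : z = 0 := congrFun h0 2
      refine hne (Subtype.ext ?_)
      change tensor (PlaneType.o16.mat u v α β γ 0 0 z) = 0
      rw [hz0, ← tensorEquiv_apply, LinearEquiv.map_eq_zero_iff]
      ext i j
      fin_cases i <;> fin_cases j <;> rfl
    have ha : (![1, 0] : Fin 2 → F) ≠ 0 := by simp
    have ht : (![1, 0] : Fin 2 → F) ⊗ₜ[F] ![0, 0, z] =
        tensor (PlaneType.o16.mat u v α β γ 0 0 z) := by
      rw [tmul_eq_tensor_iff]
      simp [PlaneType.mat]
    have := mem_PG_inter_segreVariety.mpr ⟨_, _, ha, hz, ht ▸ hw, rfl⟩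
    rw [hempty] at this
    exact this
  have hsurj : Function.Surjective f := by
    rw [← LinearMap.range_eq_top]
    refine Submodule.eq_top_of_finrank_eq ?_
    rw [LinearMap.finrank_range_of_inj hf, hL, Module.finrank_prod, Module.finrank_self]
  have hrow : ∀ x y, ∃ z, ![x, y, z] ∈ B ∧ ![0, x, y] ∈ B := fun x y => by
    obtain ⟨⟨w, hw⟩, hxy⟩ := hsurj (x, y)
    obtain ⟨x', y', z, rfl⟩ := hmat w hw
    simp [f, coord_tensor, PlaneType.mat] at hxy
    obtain ⟨rfl, rfl⟩ := hxy
    refine ⟨z, ?_, ?_⟩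
    · convert row_mem_of_mem_tensorSub (hAB hw) 0 using 1
      ext j
      fin_cases j <;> simp [coord_tensor, PlaneType.mat]
    · convert row_mem_of_mem_tensorSub (hAB hw) 1 using 1
      ext j
      fin_cases j <;> simp [coord_tensor, PlaneType.mat]
  obtain ⟨z, hz, h1⟩ := hrow 1 0
  obtain ⟨-, -, h2⟩ := hrow 0 1
  have hB' : B = ⊤ := by
    rw [eq_top_iff]
    intro b _
    have : b = b 0 • ![1, 0, z] + b 1 • ![0, 1, 0] + (b 2 - b 0 * z) • ![0, 0, 1] := by
      ext i
      fin_cases i <;> simp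
    rw [this]
    exact B.add_mem (B.add_mem (B.smul_mem _ hz) (B.smul_mem _ h1)) (B.smul_mem _ h2)
  rw [hB', finrank_top] at hB
  simp [minDims] at hB

theorem PointType.eq_of_mem_orbit {o o' : PointType}
    (h : PG (o.rep F) ∈ MulAction.orbit (Hbar₂ F) (PG (o'.rep F))) : o = o' := by
  have hmin := o.hasMinSegre_rep.unique (o'.hasMinSegre_rep.of_mem_orbit h)
  cases o <;> cases o' <;> first | rfl | simp [minDims] at hmin

/-- Min isolates o2 and o4T. Among the types with Min 2 × 2 the numbers of rank-one points are 2, 1,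
0 for o5, o6, o10; among those with Min 2 × 3 they are 1, 0 for o7, o11. -/
theorem LineType.eq_of_mem_orbit {u v : F} (huv : QuadCond u v) {o o' : LineType}
    (h : PG (o.rep u v) ∈ MulAction.orbit (Hbar₂ F) (PG (o'.rep u v))) : o = o' := by
  have hmin := (o.hasMinSegre_rep huv.1).unique ((o'.hasMinSegre_rep huv.1).of_mem_orbit h)
  have hcard := ncard_inter_eq_of_mem_orbit h
  have h5 := (rankOnePoints_o5 (u := u) (v := v)).ncard
  have h6 := (rankOnePoints_o6 (u := u) (v := v)).ncard
  have h7 := (rankOnePoints_o7 (u := u) (v := v)).ncard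
  have h10 := (rankOnePoints_o10 huv).ncard
  have h11 := (rankOnePoints_o11 (u := u) (v := v)).ncard
  cases o <;> cases o' <;> first | rfl | (simp [minDims] at hmin; done) | omega

namespace PlaneType

variable {u v α β γ : F}

/-- Symmetry of the block forces (b 0, b 1) to be proportional to a, while b 2 = 0. So the first
factor determines the second up to a scalar. -/
theorem not_hasSecondKind_o11T : ¬ HasSecondKind (o11T.rep u v α β γ) := by
  rintro ⟨a, b, b', ha, hb, h, h'⟩
  obtain ⟨x, y, z, h⟩ := (tmul_mem_rep ..).mp h
  obtain ⟨x', y', z', h'⟩ := (tmul_mem_rep ..).mp h'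
  simp [mat] at h h'
  have h1 : a 0 * b 1 = a 1 * b 0 := by rw [h.1.2.1, h.2.1]
  have h1' : a 0 * b' 1 = a 1 * b' 0 := by rw [h'.1.2.1, h'.2.1]
  have h2 : b 2 = 0 := by rcases ne_zero_fin_two ha with h0 | ⟨h0, h1⟩ <;> grind
  have h2' : b' 2 = 0 := by rcases ne_zero_fin_two ha with h0 | ⟨h0, h1⟩ <;> grind
  have hdet : b 0 * b' 1 = b 1 * b' 0 := by
    rcases ne_zero_fin_two ha with h0 | ⟨h0, h0'⟩
    · exact mul_left_cancel₀ h0 (by linear_combination b 0 * h1' - b' 0 * h1)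
    · exact mul_left_cancel₀ h0' (by linear_combination b 1 * h1' - b' 1 * h1)
  have e0 := hb (b' 0) (-b 0) (by
    ext i
    fin_cases i
    · simp; ring
    · simp; linear_combination -hdet
    · simp [h2, h2'])
  have e1 := hb (b' 1) (-b 1) (by
    ext i
    fin_cases i
    · simp; linear_combination hdet
    · simp; ring
    · simp [h2, h2'])
  exact hb.ne_right (eq_zero_fin_three e0.1 e1.1 h2')

theorem not_hasSecondKind_o12 : ¬ HasSecondKind (o12.rep u v α β γ) := by
  rintro ⟨a, b, b', ha, hb, h, h'⟩
  obtain ⟨s, hs⟩ := exists_eq_smul₁' (coords_o12 ha h).1 (coords_o12 ha h).2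
  obtain ⟨t, ht⟩ := exists_eq_smul₁' (coords_o12 ha h').1 (coords_o12 ha h').2
  exact not_indep₂_of_smul hs ht hb

theorem hasSecondKind_o3 : HasSecondKind (o3.rep u v α β γ) := by
  refine ⟨![1, 0], ![1, 0, 0], ![0, 1, 0], by simp, indep₂_of_minor 0 1 (by simp), ?_, ?_⟩
  · exact (tmul_mem_rep ..).mpr ⟨1, 0, 0, by simp [mat]⟩
  · exact (tmul_mem_rep ..).mpr ⟨0, 1, 0, by simp [mat]⟩

theorem hasSecondKind_o7T : HasSecondKind (o7T.rep u v α β γ) := by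
  refine ⟨![0, 1], ![1, 0, 0], ![0, 1, 0], by simp, indep₂_of_minor 0 1 (by simp), ?_, ?_⟩
  · exact (tmul_mem_rep ..).mpr ⟨1, 0, 0, by simp [mat]⟩
  · exact (tmul_mem_rep ..).mpr ⟨0, 1, 0, by simp [mat]⟩

theorem hasSecondKind_o8 : HasSecondKind (o8.rep u v α β γ) := by
  refine ⟨![0, 1], ![0, 1, 0], ![0, 0, 1], by simp, indep₂_of_minor 1 2 (by simp), ?_, ?_⟩
  · exact (tmul_mem_rep ..).mpr ⟨0, 1, 0, by simp [mat]⟩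
  · exact (tmul_mem_rep ..).mpr ⟨0, 0, 1, by simp [mat]⟩

theorem hasSecondKind_o9 : HasSecondKind (o9.rep u v α β γ) := by
  refine ⟨![0, 1], ![1, 0, 0], ![0, 1, 0], by simp, indep₂_of_minor 0 1 (by simp), ?_, ?_⟩
  · exact (tmul_mem_rep ..).mpr ⟨1, 0, 0, by simp [mat]⟩
  · exact (tmul_mem_rep ..).mpr ⟨0, 1, 0, by simp [mat]⟩

theorem hasFirstKind_o12 : HasFirstKind (o12.rep u v α β γ) := by
  refine ⟨![1, 0], ![0, 1], ![0, 1, 0], indep₂_of_minor 0 1 (by simp), by simp, ?_, ?_⟩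
  · exact (tmul_mem_rep ..).mpr ⟨0, 1, 0, by simp [mat]⟩
  · exact (tmul_mem_rep ..).mpr ⟨0, 0, 1, by simp [mat]⟩

theorem hasTwoFactors_o8 : HasTwoFactors (o8.rep u v α β γ) := by
  refine ⟨![1, 0], ![0, 1], ![1, 0, 0], ![0, 1, 0], indep₂_of_minor 0 1 (by simp), by simp,
    by simp, ?_, ?_⟩
  · exact (tmul_mem_rep ..).mpr ⟨1, 0, 0, by simp [mat]⟩
  · exact (tmul_mem_rep ..).mpr ⟨0, 1, 0, by simp [mat]⟩

theorem not_hasTwoFactors_o9 : ¬ HasTwoFactors (o9.rep u v α β γ) := by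
  rintro ⟨a, a', b, b', ha, hb, hb', h, h'⟩
  obtain ⟨s, hs⟩ := exists_eq_smul₁ (coords_o9 ha.ne_left hb h).1
  obtain ⟨t, ht⟩ := exists_eq_smul₁ (coords_o9 ha.ne_right hb' h').1
  exact not_indep₂_of_smul hs ht ha

theorem o16_not_mem_orbit_o15 (huv : QuadCond u v) (habc : CubicCond α β γ) :
    PG (o16.rep u v α β γ) ∉ MulAction.orbit (Hbar₂ F) (PG (o15.rep u v α β γ)) := fun h => by
  obtain ⟨-, l, hl, hsub⟩ := (intersection_rep huv habc o15).of_mem_orbit h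
  exact LineType.not_mem_orbit_of_subset_o16 huv hl hsub

/-- Whether a representative contains a line of the second kind. -/
def secondKind : PlaneType → Bool
  | o3 | o7T | o8 | o9 => true
  | _ => false

/-- The number of points of rank one, for the types with pairwise independent ones. -/
def pointCount : PlaneType → Option ℕ
  | o13 => some 2
  | o14 => some 3
  | o15 => some 1
  | o16 => some 1
  | o17 => some 0
  | _ => none

theorem exists_rankOnePoints (huv : QuadCond u v) (habc : CubicCond α β γ) {o : PlaneType} {n : ℕ}
    (h : o.pointCount = some n) :
    ∃ (a : Fin n → Fin 2 → F) (b : Fin n → Fin 3 → F), RankOnePoints (o.rep u v α β γ) a b := by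
  cases o <;> cases h
  exacts [⟨_, _, rankOnePoints_o13⟩, ⟨_, _, rankOnePoints_o14⟩, ⟨_, _, rankOnePoints_o15 huv⟩,
    ⟨_, _, rankOnePoints_o16⟩, ⟨_, _, rankOnePoints_o17 habc⟩]

theorem hasSecondKind_rep_iff (huv : QuadCond u v) (habc : CubicCond α β γ) (o : PlaneType) :
    HasSecondKind (o.rep u v α β γ) ↔ o.secondKind = true := by
  have hn : ∀ {o : PlaneType} {n : ℕ}, o.pointCount = some n → o.secondKind = false →
      (HasSecondKind (o.rep u v α β γ) ↔ o.secondKind = true) := fun {o n} h h' => by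
    obtain ⟨a, b, hab⟩ := exists_rankOnePoints huv habc h
    exact iff_of_false hab.not_hasSecondKind (by simp [h'])
  cases o
  · exact iff_of_true hasSecondKind_o3 rfl
  · exact iff_of_true hasSecondKind_o7T rfl
  · exact iff_of_true hasSecondKind_o8 rfl
  · exact iff_of_true hasSecondKind_o9 rfl
  · exact iff_of_false not_hasSecondKind_o11T Bool.false_ne_true
  · exact iff_of_false not_hasSecondKind_o12 Bool.false_ne_true
  all_goals exact hn rfl rfl

/-- Min isolates o3 and splits off o7T and o11T, which differ by a line of the second kind. Among
the types with Min 2 × 3, such a line singles out o8 and o9, and only o8 has rank-one points with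
independent first factors. A line of the first kind separates o12 from o13 to o17. The number of
rank-one points settles these except o15 against o16, which are told apart by an o10 line. -/
theorem eq_of_mem_orbit (huv : QuadCond u v) (habc : CubicCond α β γ) {o o' : PlaneType}
    (h : PG (o.rep u v α β γ) ∈ MulAction.orbit (Hbar₂ F) (PG (o'.rep u v α β γ))) : o = o' := by
  -- These implications are one-sided; applying them also to the reversed orbit relation covers both
  -- orders of each pair of types.
  have aux : ∀ {o o' : PlaneType},
      PG (o.rep u v α β γ) ∈ MulAction.orbit (Hbar₂ F) (PG (o'.rep u v α β γ)) →
      (o.secondKind = true → o'.secondKind = true) ∧ (o = o8 → o' ≠ o9) ∧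
      (o = o12 → o'.pointCount = none) ∧ (o = o15 → o' ≠ o16) ∧
      ∀ n n', o.pointCount = some n → o'.pointCount = some n' → n = n' := by
    intro o o' h
    have h' := MulAction.mem_orbit_symm.mp h
    refine ⟨fun hs => ?_, ?_, ?_, ?_, fun n n' hn hn' => ?_⟩
    · exact (hasSecondKind_rep_iff huv habc o').mp
        (((hasSecondKind_rep_iff huv habc o).mpr hs).of_mem_orbit h')
    · rintro rfl rfl
      exact not_hasTwoFactors_o9 (hasTwoFactors_o8.of_mem_orbit h')
    · rintro rfl
      by_contra hne
      obtain ⟨n, hn⟩ := Option.ne_none_iff_exists'.mp hne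
      obtain ⟨a, b, hab⟩ := exists_rankOnePoints huv habc hn
      exact hab.not_hasFirstKind (hasFirstKind_o12.of_mem_orbit h')
    · rintro rfl rfl
      exact o16_not_mem_orbit_o15 huv habc h'
    · obtain ⟨a, b, hab⟩ := exists_rankOnePoints huv habc hn
      obtain ⟨a', b', hab'⟩ := exists_rankOnePoints huv habc hn'
      rw [← hab.ncard, ncard_inter_eq_of_mem_orbit h, hab'.ncard]
  have hmin := (o.hasMinSegre_rep huv.1 α β γ).unique
    ((o'.hasMinSegre_rep huv.1 α β γ).of_mem_orbit h)
  obtain ⟨h1, h2, h3, h4, h5⟩ := aux h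
  obtain ⟨h1', h2', h3', h4', -⟩ := aux (MulAction.mem_orbit_symm.mp h)
  clear aux h
  cases o <;> cases o' <;> first
    | rfl
    | exact absurd hmin (by decide)
    | exact absurd (h1 rfl) (by decide)
    | exact absurd (h1' rfl) (by decide)
    | exact absurd rfl (h2 rfl)
    | exact absurd rfl (h2' rfl)
    | exact absurd (h3 rfl) (by decide)
    | exact absurd (h3' rfl) (by decide)
    | exact absurd rfl (h4 rfl)
    | exact absurd rfl (h4' rfl)
    | exact absurd (h5 _ _ rfl rfl) (by decide)

end PlaneType

/-! ### Counting orbits -/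

theorem numOrbits_eq {k : ℕ} {ι : Type} {r : ι → Submodule F (V F)}
    (h : IsOrbitTransversal k r) : numOrbits F k = Nat.card ι := by
  have hset : {O : Set (Set (ℙ F (V F))) | ∃ U, IsProjSubspace k U ∧
      O = MulAction.orbit (Hbar₂ F) U} =
      Set.range fun i => MulAction.orbit (Hbar₂ F) (PG (r i)) := by
    ext O
    constructor
    · rintro ⟨U, hU, rfl⟩
      obtain ⟨i, hi, -⟩ := h.2 U hU
      exact ⟨i, (MulAction.orbit_eq_iff.mpr hi).symm⟩
    · rintro ⟨i, rfl⟩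
      exact ⟨_, h.1 i, rfl⟩
  rw [numOrbits, hset, Set.ncard_range_of_injective]
  intro i j hij
  exact (h.2 _ (h.1 i)).unique (MulAction.mem_orbit_self _) (MulAction.orbit_eq_iff.mp hij)

theorem isOrbitTransversal_of {k : ℕ} {ι : Type} {r : ι → Submodule F (V F)}
    (hr : ∀ i, Module.finrank F (r i) = k + 1)
    (hex : ∀ W : Submodule F (V F), Module.finrank F W = k + 1 →
      ∃ i, PG W ∈ MulAction.orbit (Hbar₂ F) (PG (r i)))
    (hun : ∀ i j, PG (r i) ∈ MulAction.orbit (Hbar₂ F) (PG (r j)) → i = j) :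
    IsOrbitTransversal k r := by
  refine ⟨fun i => ⟨_, hr i, rfl⟩, ?_⟩
  rintro U ⟨W, hW, rfl⟩
  obtain ⟨i, hi⟩ := hex W hW
  refine ⟨i, hi, fun j hj => hun j i ?_⟩
  rw [← MulAction.orbit_eq_iff] at hi hj ⊢
  rw [← hi, ← hj]

theorem card_pointType : Nat.card PointType = 2 :=
  Nat.card_eq_of_equiv_fin
    { toFun := fun o => match o with | .o1 => 0 | .o4 => 1
      invFun := ![.o1, .o4]
      left_inv := fun o => by cases o <;> rfl
      right_inv := fun i => by fin_cases i <;> rfl }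

theorem card_lineType : Nat.card LineType = 7 :=
  Nat.card_eq_of_equiv_fin
    { toFun := fun o => match o with
        | .o2 => 0 | .o4T => 1 | .o5 => 2 | .o6 => 3 | .o7 => 4 | .o10 => 5 | .o11 => 6
      invFun := ![.o2, .o4T, .o5, .o6, .o7, .o10, .o11]
      left_inv := fun o => by cases o <;> rfl
      right_inv := fun i => by fin_cases i <;> rfl }

theorem card_planeType : Nat.card PlaneType = 11 :=
  Nat.card_eq_of_equiv_fin
    { toFun := fun o => match o with
        | .o3 => 0 | .o7T => 1 | .o8 => 2 | .o9 => 3 | .o11T => 4 | .o12 => 5 | .o13 => 6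
        | .o14 => 7 | .o15 => 8 | .o16 => 9 | .o17 => 10
      invFun := ![.o3, .o7T, .o8, .o9, .o11T, .o12, .o13, .o14, .o15, .o16, .o17]
      left_inv := fun o => by cases o <;> rfl
      right_inv := fun i => by fin_cases i <;> rfl }

theorem PointType.isOrbitTransversal : IsOrbitTransversal 0 (PointType.rep F) :=
  isOrbitTransversal_of (fun o => o.span_spec.2) (fun _ => point_classification)
    fun _ _ => eq_of_mem_orbit

theorem LineType.isOrbitTransversal [Finite F] {u v : F} (huv : QuadCond u v) :
    IsOrbitTransversal 1 (LineType.rep u v) :=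
  isOrbitTransversal_of (fun o => (o.span_spec u v).2) (fun _ => line_classification huv)
    fun _ _ => eq_of_mem_orbit huv

theorem PlaneType.isOrbitTransversal [Finite F] {u v α β γ : F} (huv : QuadCond u v)
    (habc : CubicCond α β γ) : IsOrbitTransversal 2 (PlaneType.rep u v α β γ) :=
  isOrbitTransversal_of (fun o => (o.span_spec u v α β γ).2)
    (fun _ => plane_classification huv habc) fun _ _ => eq_of_mem_orbit huv habc

end Tensor23

end

/-! ### The classification theorem -/

theorem theorem3p1 (F : Type*) [Field F] [Finite F] :
    (∃ φ : Matrix.ProjGenLinGroup (Fin 2) F × Matrix.ProjGenLinGroup (Fin 3) F ≃* Tensor23.Hbar₂ F,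
      ∀ (g : GL (Fin 2) F) (h : GL (Fin 3) F) (p : ℙ F (Tensor23.V F)),
        φ (Matrix.ProjGenLinGroup.mk g, Matrix.ProjGenLinGroup.mk h) • p =
          Tensor23.tensorHom F (g, h) • p) ∧
    Tensor23.numOrbits F 0 = 2 ∧ Tensor23.numOrbits F 1 = 7 ∧ Tensor23.numOrbits F 2 = 11 ∧
    (∃ u v : F, Tensor23.QuadCond u v) ∧ (∃ α β γ : F, Tensor23.CubicCond α β γ) ∧
    (Tensor23.IsOrbitTransversal 0 (Tensor23.PointType.rep F) ∧
      ∀ o : Tensor23.PointType,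
        ∀ U ∈ MulAction.orbit (Tensor23.Hbar₂ F) (Tensor23.PG (o.rep F)),
          o.Intersection U ∧ Tensor23.HasMinSegre U o.minDims) ∧
    (∀ u v : F, Tensor23.QuadCond u v →
      Tensor23.IsOrbitTransversal 1 (Tensor23.LineType.rep u v) ∧
      ∀ o : Tensor23.LineType,
        ∀ U ∈ MulAction.orbit (Tensor23.Hbar₂ F) (Tensor23.PG (o.rep u v)),
          o.Intersection U ∧ Tensor23.HasMinSegre U o.minDims) ∧
    (∀ u v α β γ : F, Tensor23.QuadCond u v → Tensor23.CubicCond α β γ →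
      Tensor23.IsOrbitTransversal 2 (Tensor23.PlaneType.rep u v α β γ) ∧
      ∀ o : Tensor23.PlaneType,
        ∀ U ∈ MulAction.orbit (Tensor23.Hbar₂ F) (Tensor23.PG (o.rep u v α β γ)),
          o.Intersection u v U ∧ Tensor23.HasMinSegre U o.minDims) := by
  obtain ⟨u, v, huv⟩ := Tensor23.exists_quadCond F
  obtain ⟨α, β, γ, habc⟩ := Tensor23.exists_cubicCond F
  refine ⟨Tensor23.exists_mulEquiv_Hbar₂ F, ?_, ?_, ?_, ⟨u, v, huv⟩, ⟨α, β, γ, habc⟩,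
    ⟨Tensor23.PointType.isOrbitTransversal, fun o U hU =>
      ⟨o.intersection_rep.of_mem_orbit hU, o.hasMinSegre_rep.of_mem_orbit hU⟩⟩,
    fun u v huv => ⟨Tensor23.LineType.isOrbitTransversal huv, fun o U hU =>
      ⟨(o.intersection_rep huv).of_mem_orbit hU, (o.hasMinSegre_rep huv.1).of_mem_orbit hU⟩⟩,
    fun u v α β γ huv habc => ⟨Tensor23.PlaneType.isOrbitTransversal huv habc, fun o U hU =>
      ⟨(o.intersection_rep huv habc).of_mem_orbit hU,
        (o.hasMinSegre_rep huv.1 α β γ).of_mem_orbit hU⟩⟩⟩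
  · rw [Tensor23.numOrbits_eq Tensor23.PointType.isOrbitTransversal, Tensor23.card_pointType]
  · rw [Tensor23.numOrbits_eq (Tensor23.LineType.isOrbitTransversal huv), Tensor23.card_lineType]
  · rw [Tensor23.numOrbits_eq (Tensor23.PlaneType.isOrbitTransversal huv habc),
      Tensor23.card_planeType]
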